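/- Let $m\ge 3$ and let $\mathrm{RS}_m$ be the class of complete $m$-dimensional rotationally symmetric Riemannian manifolds (with a pole and no boundary, or with one boundary sphere; that is, of the form $ds^2+f(s)^2g_0$ with $s\in[0,\infty)$ the distance from the pole or the boundary and $g_0$ the round metric of $S^{m-1}$) which have nonnegative scalar curvature and no closed minimal hypersurface in the interior, and whose boundary, if nonempty, is a stable minimal hypersurface. The ADM mass of $M\in \mathrm{RS}_m$ is $\mathrm{m}_{\mathrm{ADM}}(M)=\lim_{s\to\infty}\frac{f(s)^{m-2}}{2}\bigl(1-f'(s)^2\bigr)$, the limit of the Hawking masses of the symmetric spheres. Write $\Sigma_{\alpha}$ for the symmetric sphere of area $\alpha$ in $M$, and for the sphere of area $\alpha$ about $0$ in Euclidean space $\mathbb{E}^m$. For $L>0$ let $\mathbb{E}^m\cup[0,L]$ be Euclidean space with a segment of length $L$ attached at the origin, with its length metric. (i) For every $L_0>0$ there is a sequence $M_j\in \mathrm{RS}_m$ with finite ADM masses, $\lim_{j\to\infty}\mathrm{m}_{\mathrm{ADM}}(M_j)=0$, whose pointed Gromov–Hausdorff limit is $\mathbb{E}^m\cup[0,L_0]$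 in the following sense. For every $\alpha_0>0$ the sphere $\Sigma_{\alpha_0}\subset M_j$ exists for all large $j$; and for all $p_j\in M_j$ such that $p_j\in\Sigma_{\alpha_0}\subset M_j$ for all large $j$, every $q\in\Sigma_{\alpha_0}\subset\mathbb{E}^m$ and every $D>0$ there are $D_j\to D$ such that $$d_{GH}\bigl((B_{p_j}(D_j)\subset M_j,\;p_j),\ (B_{q}(D)\subset \mathbb{E}^m\cup[0,L_0],\;q)\bigr)\longrightarrow 0 ,$$ where $d_{GH}$ is the pointed Gromov–Hausdorff distance: the infimum, over all distance-preserving maps of the two balls into a common metric space, of the larger of the Hausdorff distance of the images and the distance of the images of the base points. (ii) Consequently the positive mass theorem is not stable with respect to the Gromov–Hausdorff distance, even in the rotationally symmetric class: it is not true that for all $\varepsilon,D,A_0>0$ there is a $\delta>0$ such that every $M\in \mathrm{RS}_m$ with $\mathrm{m}_{\mathrm{ADM}}(M)<\delta$ in which $\Sigma_{A_0}$ exists satisfies $$d_{GH}\bigl(T_D(\Sigma_{A_0})\subset M,\ T_D(\Sigma_{A_0})\subset\mathbb{E}^m\bigr)<\varepsilon ,$$ where $T_D$ denotes the open tubular neighbourhood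 of radius $D$, with the restricted distance, and $d_{GH}$ is the ordinary (unpointed) Gromov–Hausdorff distance. -/

import Mathlib

open Filter Topology MeasureTheory
open scoped ENNReal ContDiff Matrix

noncomputable section

namespace RotSym

/-- Euclidean `m`-space. -/
abbrev Eu (m : ℕ) := EuclideanSpace ℝ (Fin m)

/-! ### Riemannian geometry of a metric tensor `g` on a region `S` of `ℝ^m`, in coordinates

`S` will be either `ℝ^m` or the complement of an open ball. Derivatives are taken within `S`, so
that they make sense (as the one-sided ones) at boundary points; they are the usual partial
derivatives at interior points. -/

section Coordinates

variable {m : ℕ}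

/-- The partial derivative `∂_k u` at `x`. -/
def pd (S : Set (Eu m)) (u : Eu m → ℝ) (k : Fin m) (x : Eu m) : ℝ :=
  fderivWithin ℝ u S x (EuclideanSpace.single k 1)

/-- Christoffel symbols `Γ^k_{ij}` of the Levi-Civita connection. -/
def christoffel (S : Set (Eu m)) (g : Eu m → Matrix (Fin m) (Fin m) ℝ) (k i j : Fin m)
    (x : Eu m) : ℝ :=
  (1 / 2) * ∑ l, (g x)⁻¹ k l *
    (pd S (fun y => g y j l) i x + pd S (fun y => g y i l) j x - pd S (fun y => g y i j) l x)

/-- The Ricci tensor `R_{jk}` (positive on round spheres). -/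
def ricci (S : Set (Eu m)) (g : Eu m → Matrix (Fin m) (Fin m) ℝ) (j k : Fin m) (x : Eu m) : ℝ :=
  ∑ i, (pd S (christoffel S g i j k) i x - pd S (christoffel S g i i k) j x
    + ∑ p, (christoffel S g i i p x * christoffel S g p j k x
      - christoffel S g i j p x * christoffel S g p i k x))

/-- The scalar curvature `g^{jk} R_{jk}`. -/
def scalarCurv (S : Set (Eu m)) (g : Eu m → Matrix (Fin m) (Fin m) ℝ) (x : Eu m) : ℝ :=
  ∑ j, ∑ k, (g x)⁻¹ j k * ricci S g j k x

/-- The covariant Hessian `∇²_{ij} u = ∂_i ∂_j u - Γ^k_{ij} ∂_k u`. -/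
def hess (S : Set (Eu m)) (g : Eu m → Matrix (Fin m) (Fin m) ℝ) (u : Eu m → ℝ) (i j : Fin m)
    (x : Eu m) : ℝ :=
  pd S (pd S u j) i x - ∑ k, christoffel S g k i j x * pd S u k x

/-- The length `|∇u|_g` of the gradient. -/
def gradNorm (S : Set (Eu m)) (g : Eu m → Matrix (Fin m) (Fin m) ℝ) (u : Eu m → ℝ)
    (x : Eu m) : ℝ :=
  √(∑ i, ∑ j, (g x)⁻¹ i j * pd S u i x * pd S u j x)

/-- The unit normal `ν^i = g^{ij} ∂_j u / |∇u|` of the level set of `u` through `x`. -/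
def normal (S : Set (Eu m)) (g : Eu m → Matrix (Fin m) (Fin m) ℝ) (u : Eu m → ℝ)
    (i : Fin m) (x : Eu m) : ℝ :=
  (∑ j, (g x)⁻¹ i j * pd S u j x) / gradNorm S g u x

/-- The inverse metric `h^{ij} = g^{ij} - ν^i ν^j` of the level set of `u` through `x`. -/
def tangInv (S : Set (Eu m)) (g : Eu m → Matrix (Fin m) (Fin m) ℝ) (u : Eu m → ℝ)
    (i j : Fin m) (x : Eu m) : ℝ :=
  (g x)⁻¹ i j - normal S g u i x * normal S g u j x

/-- The mean curvature `div ν` of the level set of `u` through `x`, with respect to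
`ν = ∇u / |∇u|`: the trace over the tangent space of the level set of its second fundamental form
`∇²u / |∇u|`. -/
def meanCurv (S : Set (Eu m)) (g : Eu m → Matrix (Fin m) (Fin m) ℝ) (u : Eu m → ℝ)
    (x : Eu m) : ℝ :=
  (∑ i, ∑ j, tangInv S g u i j x * hess S g u i j x) / gradNorm S g u x

/-- The squared norm `|A|²` of the second fundamental form of the level set of `u` through `x`. -/
def secondFormSq (S : Set (Eu m)) (g : Eu m → Matrix (Fin m) (Fin m) ℝ) (u : Eu m → ℝ)
    (x : Eu m) : ℝ :=
  (∑ i, ∑ j, ∑ k, ∑ l, tangInv S g u i k x * tangInv S g u j l x *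
    hess S g u i j x * hess S g u k l x) / gradNorm S g u x ^ 2

/-- `Ric(ν, ν)` for the unit normal `ν` of the level set of `u` through `x`. -/
def ricciNormal (S : Set (Eu m)) (g : Eu m → Matrix (Fin m) (Fin m) ℝ) (u : Eu m → ℝ)
    (x : Eu m) : ℝ :=
  ∑ i, ∑ j, ricci S g i j x * normal S g u i x * normal S g u j x

/-- `|∇^Σ φ|²` at `x`, where `Σ` is the level set of `u` through `x`. -/
def tangGradSq (S : Set (Eu m)) (g : Eu m → Matrix (Fin m) (Fin m) ℝ) (u φ : Eu m → ℝ)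
    (x : Eu m) : ℝ :=
  ∑ i, ∑ j, tangInv S g u i j x * pd S φ i x * pd S φ j x

/-- The ratio between the area element induced by `g` on the centred sphere through `x` and the
Euclidean area element: `√(det g · g⁻¹(n, n))`, where `n = x / |x|`. -/
def areaDensity (g : Eu m → Matrix (Fin m) (Fin m) ℝ) (x : Eu m) : ℝ :=
  √((g x).det * ∑ i, ∑ j, (g x)⁻¹ i j * (x i / ‖x‖) * (x j / ‖x‖))

/-- The integral of `φ` over the sphere `{|x| = t}` for the area measure induced by `g`. -/
def sphereIntegral (g : Eu m → Matrix (Fin m) (Fin m) ℝ) (t : ℝ) (φ : Eu m → ℝ) : ℝ :=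
  ∫ w : Metric.sphere (0 : Eu m) 1,
    φ (t • (w : Eu m)) * areaDensity g (t • (w : Eu m)) * t ^ (m - 1)
    ∂((volume : Measure (Eu m)).toSphere)

/-- `ω_{m-1}`, the area of the unit sphere of Euclidean `m`-space. -/
def omega (m : ℕ) : ℝ := ((volume : Measure (Eu m)).toSphere Set.univ).toReal

/-- The immersion `F : N → ℝ^m` of a compact space `N` is a closed minimal hypersurface for the
metric `g`: locally, `F` is an embedding onto a regular level set of a smooth function, with
vanishing mean curvature. (Embedded closed hypersurfaces: `F` is the inclusion of a compact
set `N`.) -/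
def IsClosedMinimalHypersurface (S : Set (Eu m)) (g : Eu m → Matrix (Fin m) (Fin m) ℝ)
    (N : Type) [TopologicalSpace N] (F : N → Eu m) : Prop :=
  CompactSpace N ∧ T2Space N ∧ Nonempty N ∧
  ∀ z : N, ∃ (V : Set N) (U : Set (Eu m)) (u : Eu m → ℝ),
    IsOpen V ∧ z ∈ V ∧ IsOpen U ∧ IsEmbedding (V.domRestrict F) ∧
    F '' V = {x ∈ U | u x = 0} ∧ U ⊆ interior S ∧ ContDiffOn ℝ ∞ u U ∧
    (∀ x ∈ U, fderiv ℝ u x ≠ 0) ∧ ∀ x ∈ U, u x = 0 → meanCurv S g u x = 0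

end Coordinates

/-! ### Rotationally symmetric manifolds -/

/-- A rotationally symmetric Riemannian manifold of dimension `m`, with a pole and no boundary or
with one boundary sphere, in coordinates in which the rotations act linearly: the region
`{x ∈ ℝ^m : |x| ≥ a}` (all of `ℝ^m` for `a = 0`) with a smooth Riemannian metric `g` that is
invariant under the orthogonal group. -/
structure RotSymManifold (m : ℕ) where
  a : ℝ
  a_nonneg : 0 ≤ a
  g : Eu m → Matrix (Fin m) (Fin m) ℝ
  smooth : ∀ i j, ContDiffOn ℝ ∞ (fun x => g x i j) {x : Eu m | a ≤ ‖x‖}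
  posDef : ∀ x : Eu m, a ≤ ‖x‖ → (g x).PosDef
  invariant : ∀ Q ∈ Matrix.orthogonalGroup (Fin m) ℝ, ∀ x : Eu m, a ≤ ‖x‖ →
    Qᵀ * g (WithLp.toLp 2 (Q *ᵥ x.ofLp)) * Q = g x

namespace RotSymManifold

variable {m : ℕ} (M : RotSymManifold m)

/-- The underlying set. -/
def carrier : Set (Eu m) := {x | M.a ≤ ‖x‖}

/-- `ℓ` is the length of a `C¹` path in the manifold from `x` to `y`. -/
def IsPathLength (x y : Eu m) (ℓ : ℝ) : Prop :=
  ∃ γ : ℝ → Eu m, ContDiffOn ℝ 1 γ (Set.Icc 0 1) ∧ (∀ t ∈ Set.Icc (0 : ℝ) 1, γ t ∈ M.carrier) ∧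
    γ 0 = x ∧ γ 1 = y ∧
    ℓ = ∫ t in (0 : ℝ)..1, √(∑ i, ∑ j, M.g (γ t) i j *
      derivWithin γ (Set.Icc 0 1) t i * derivWithin γ (Set.Icc 0 1) t j)

/-- The Riemannian distance: the infimum of the lengths of paths. -/
def rdist (x y : Eu m) : ℝ := sInf {ℓ | M.IsPathLength x y ℓ}

/-- Metric completeness. -/
def Complete : Prop :=
  ∀ u : ℕ → Eu m, (∀ n, u n ∈ M.carrier) →
    (∀ ε > 0, ∃ N, ∀ i ≥ N, ∀ j ≥ N, M.rdist (u i) (u j) < ε) →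
    ∃ x ∈ M.carrier, Tendsto (fun n => M.rdist (u n) x) atTop (𝓝 0)

/-- The boundary sphere `{|x| = a}` is a minimal hypersurface. -/
def BoundaryMinimal : Prop :=
  ∀ x : Eu m, ‖x‖ = M.a → meanCurv M.carrier M.g (fun y => ‖y‖) x = 0

/-- The boundary sphere satisfies the stability inequality
`∫_Σ (|A|² + Ric(ν, ν)) φ² ≤ ∫_Σ |∇^Σ φ|²` for all smooth `φ`. -/
def BoundaryStable : Prop :=
  ∀ φ : Eu m → ℝ, ContDiff ℝ ∞ φ →
    sphereIntegral M.g M.a (fun x =>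
      (secondFormSq M.carrier M.g (fun y => ‖y‖) x +
        ricciNormal M.carrier M.g (fun y => ‖y‖) x) * φ x ^ 2) ≤
    sphereIntegral M.g M.a (tangGradSq M.carrier M.g (fun y => ‖y‖) φ)

/-- The class `RS_m`: complete, of nonnegative scalar curvature, without closed minimal
hypersurfaces in the interior, and such that the boundary, if there is one, is a stable minimal
hypersurface. -/
structure IsRS : Prop where
  complete : M.Complete
  scalar_nonneg : ∀ x ∈ M.carrier, 0 ≤ scalarCurv M.carrier M.g x
  no_minimal : ∀ (N : Type) [TopologicalSpace N] (F : N → Eu m),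
    ¬ IsClosedMinimalHypersurface M.carrier M.g N F
  boundary : 0 < M.a → M.BoundaryMinimal ∧ M.BoundaryStable

/-- The area of the symmetric sphere `{|x| = t}`. -/
def area (t : ℝ) : ℝ := sphereIntegral M.g t (fun _ => 1)

/-- The area radius of the symmetric sphere `{|x| = t}`. -/
def areaRadius (t : ℝ) : ℝ := (M.area t / omega m) ^ (1 / ((m : ℝ) - 1))

/-- The Hawking mass of the symmetric sphere `Σ = {|x| = t}`: with the area `A`, the area radius `f`
and the mean curvature `H` of `Σ`, it is `(f^{m-2} / 2) (1 - (f² / A) ∫_Σ (H / (m-1))²)`. For the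
metric `ds² + f(s)² g₀` this is `(f^{m-2} / 2) (1 - f'²)`, and for `m = 3` it is
`(1/2) (A / 4π)^{1/2} (1 - (1/4π) ∫_Σ (H/2)²)`. -/
def hawkingMass (t : ℝ) : ℝ :=
  M.areaRadius t ^ (m - 2) / 2 *
    (1 - M.areaRadius t ^ 2 / M.area t *
      sphereIntegral M.g t (fun x =>
        (meanCurv M.carrier M.g (fun y => ‖y‖) x / ((m : ℝ) - 1)) ^ 2))

/-- The ADM mass exists, is finite, and equals `μ`: it is the limit at infinity of the Hawking
masses of the symmetric spheres. -/
def HasADMMass (μ : ℝ) : Prop := Tendsto M.hawkingMass atTop (𝓝 μ)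

/-- The symmetric sphere of area `α`. -/
def symSphere (α : ℝ) : Set (Eu m) := {x ∈ M.carrier | M.area ‖x‖ = α}

end RotSymManifold

/-! ### Gromov-Hausdorff distance

Metric spaces are given here by a set and a distance function on it; subsets carry the restricted
distance. -/

/-- The Gromov-Hausdorff distance between `(A, dX)` and `(B, dY)`: the infimum of the Hausdorff
distances between the images of distance-preserving maps into a common metric space. -/
def ghDist {X Y : Type} (dX : X → X → ℝ) (A : Set X) (dY : Y → Y → ℝ) (B : Set Y) : ℝ≥0∞ :=
  sInf {r | ∃ (Z : Type) (_ : MetricSpace Z) (φ : X → Z) (ψ : Y → Z),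
    (∀ x ∈ A, ∀ x' ∈ A, dist (φ x) (φ x') = dX x x') ∧
    (∀ y ∈ B, ∀ y' ∈ B, dist (ψ y) (ψ y') = dY y y') ∧
    r = Metric.hausdorffEDist (φ '' A) (ψ '' B)}

/-- The pointed Gromov-Hausdorff distance between `(A, dX, p)` and `(B, dY, q)`: as `ghDist`, but
the images of the base points have to be close as well. It is at least `ghDist`. -/
def pointedGHDist {X Y : Type} (dX : X → X → ℝ) (A : Set X) (p : X)
    (dY : Y → Y → ℝ) (B : Set Y) (q : Y) : ℝ≥0∞ :=
  sInf {r | ∃ (Z : Type) (_ : MetricSpace Z) (φ : X → Z) (ψ : Y → Z),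
    (∀ x ∈ A, ∀ x' ∈ A, dist (φ x) (φ x') = dX x x') ∧
    (∀ y ∈ B, ∀ y' ∈ B, dist (ψ y) (ψ y') = dY y y') ∧
    r = max (Metric.hausdorffEDist (φ '' A) (ψ '' B)) (edist (φ p) (ψ q))}

/-- The open ball of radius `D` about `p` in the space `(S, d)`. -/
def ballIn {X : Type} (d : X → X → ℝ) (S : Set X) (p : X) (D : ℝ) : Set X := {x ∈ S | d p x < D}

/-- The tubular neighbourhood of radius `D` about `A` in the space `(S, d)`. -/
def tubeIn {X : Type} (d : X → X → ℝ) (S A : Set X) (D : ℝ) : Set X :=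
  {x ∈ S | ∃ y ∈ A, d x y < D}

/-- Pointed Gromov-Hausdorff convergence `(S_j, d_j, p_j) → (T, e, q)`: for every `D > 0` there
are `D_j → D` such that the balls of radius `D_j` about `p_j` converge to the ball of radius `D`
about `q`. -/
def PointedGHTendsto {X Y : Type} (d : ℕ → X → X → ℝ) (S : ℕ → Set X) (p : ℕ → X)
    (e : Y → Y → ℝ) (T : Set Y) (q : Y) : Prop :=
  ∀ D : ℝ, 0 < D → ∃ D' : ℕ → ℝ, Tendsto D' atTop (𝓝 D) ∧
    Tendsto (fun j => pointedGHDist (d j) (ballIn (d j) (S j) (p j) (D' j)) (p j)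
      e (ballIn e T q D) q) atTop (𝓝 0)

/-! ### The limit space -/

/-- Euclidean space with a segment of length `L` attached at the origin, as the subset
`ℝ^m × {0} ∪ {0} × [0, L]` of `ℝ^m × ℝ`. -/
def segSpace (m : ℕ) (L : ℝ) : Set (Eu m × ℝ) :=
  {z | z.2 ∈ Set.Icc 0 L ∧ (z.1 = 0 ∨ z.2 = 0)}

/-- The length distance of `segSpace`: it is `|x - y|` on `ℝ^m`, `|s - t|` on the segment, and
`|x| + t` between `x ∈ ℝ^m` and the point `t` of the segment. -/
def segDist {m : ℕ} (z w : Eu m × ℝ) : ℝ := ‖z.1 - w.1‖ + |z.2 - w.2|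

/-- The centred sphere of area `α` in Euclidean space. -/
def euclSphere (m : ℕ) (α : ℝ) : Set (Eu m) := {x | omega m * ‖x‖ ^ (m - 1) = α}

/-- Stability of the positive mass theorem in the class `RS_m` with respect to the Gromov-Hausdorff
distance: for all `ε, D, A₀ > 0` there is `δ > 0` such that for every `M ∈ RS_m` of ADM mass less
than `δ` the tubular neighbourhoods of radius `D` about the symmetric spheres of area `A₀` in `M`
and in Euclidean space have Gromov-Hausdorff distance less than `ε`. -/
def GHStable (m : ℕ) : Prop :=
  ∀ ε D A₀ : ℝ, 0 < ε → 0 < D → 0 < A₀ → ∃ δ : ℝ, 0 < δ ∧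
    ∀ M : RotSymManifold m, M.IsRS → ∀ μ : ℝ, M.HasADMMass μ → μ < δ →
      (M.symSphere A₀).Nonempty →
      ghDist M.rdist (tubeIn M.rdist M.carrier (M.symSphere A₀) D)
        dist (tubeIn dist Set.univ (euclSphere m A₀) D) < ENNReal.ofReal ε

end RotSym

end

namespace RotSym

/-! ### Conformally flat metrics -/

section Conformal

variable {m : ℕ}

/-! The examples are conformally flat, `u^{4/n} δ` on all of `ℝ^m` with `n = m - 2`, so there is a
pole and the boundary clause of `IsRS` is vacuous. Nonnegative scalar curvature means that `u` is
superharmonic. The Schwarzschild factor `1 + k²/|x|^n` would have mass `2k²`, but also a horizon.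
The choice here is `u = 1 + k²/(V(V + k))` with `V = (|x|² + b)^{n/4}`. Far out `V` is about
`|x|^{n/2}`, so `u` agrees with the Schwarzschild factor to leading order and the mass is still
`2k²`. Where `V` is much smaller than `k`, `u` is about `k/V`; for small `b` and `|x|` well above
`√b` the length factor `u^{2/n}` is then about `k^{2/n}/|x|`, which is a cylinder of radius
`k^{2/n}`. The area radius keeps increasing. For `b = 0` the cylinder would be infinitely long; `b >
0` caps it off smoothly.

With `k = ε^n` the mass tends to `0` as `ε → 0`, the metric is within a factor `e^{2ε^n}` of the
Euclidean one on `{|x| ≥ ε}` (`neckFactor_le_exp`), and the symmetric spheres in `{|x| < ε}` have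
small radius. The length of this neck depends continuously on `b` and grows logarithmically as `b →
0`, so it can be made equal to `L` (`exists_neck_length`). Collapsing each symmetric sphere of the
neck to a point of the segment is an almost isometry onto `ℝ^m` with the segment
(`IsNeckFactor.collapse_distortion`), which gives the pointed convergence.

Closed minimal hypersurfaces are excluded by the maximum principle: at a point farthest from the
origin such a hypersurface touches a mean convex symmetric sphere from inside
(`not_isClosedMinimalHypersurface`).

For (ii), the limit space contains a tripod with legs of length 1: two opposite unit vectors, the
origin and the tip of the segment. Stability would map it almost isometrically into Euclidean space,
where the midpoint of two given points is unique (`no_tripod`). -/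

lemma pd_univ (u : Eu m → ℝ) (k : Fin m) (x : Eu m) :
    pd Set.univ u k x = fderiv ℝ u x (EuclideanSpace.single k 1) := by
  rw [pd, fderivWithin_univ]

/-- The conformally flat metric `e^{2w} δ`. -/
noncomputable def confMetric (w : Eu m → ℝ) (x : Eu m) : Matrix (Fin m) (Fin m) ℝ :=
  Real.exp (2 * w x) • 1

lemma confMetric_apply (w : Eu m → ℝ) (x : Eu m) (i j : Fin m) :
    confMetric w x i j = Real.exp (2 * w x) * (if i = j then 1 else 0) := by
  simp [confMetric, Matrix.one_apply]

lemma confMetric_inv (w : Eu m → ℝ) (x : Eu m) :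
    (confMetric w x)⁻¹ = Real.exp (-(2 * w x)) • 1 := by
  apply Matrix.inv_eq_right_inv
  rw [confMetric, Matrix.smul_mul, Matrix.mul_smul, smul_smul, ← Real.exp_add]
  simp

lemma confMetric_inv_apply (w : Eu m → ℝ) (x : Eu m) (i j : Fin m) :
    (confMetric w x)⁻¹ i j = Real.exp (-(2 * w x)) * (if i = j then 1 else 0) := by
  simp [confMetric_inv, Matrix.one_apply]

lemma contDiff_pd {w : Eu m → ℝ} (hw : ContDiff ℝ ∞ w) (k : Fin m) :
    ContDiff ℝ ∞ (pd Set.univ w k) := by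
  have : pd Set.univ w k = fun x => fderiv ℝ w x (EuclideanSpace.single k 1) := by
    ext x; exact pd_univ w k x
  rw [this]
  exact (hw.fderiv_right (m := ∞) (by simp)).clm_apply contDiff_const

lemma pd_confMetric {w : Eu m → ℝ} (hw : ContDiff ℝ ∞ w) (i j k : Fin m) (x : Eu m) :
    pd Set.univ (fun y => confMetric w y i j) k x =
      2 * pd Set.univ w k x * Real.exp (2 * w x) * (if i = j then 1 else 0) := by
  have hd : HasFDerivAt w (fderiv ℝ w x) x := (hw.differentiable (by simp) x).hasFDerivAt
  have h1 : HasFDerivAt (fun y => Real.exp (2 * w y) * (if i = j then (1 : ℝ) else 0))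
      ((if i = j then (1 : ℝ) else 0) • (Real.exp (2 * w x) • ((2 : ℝ) • fderiv ℝ w x))) x :=
    ((hd.const_mul 2).exp).mul_const _
  simp only [confMetric_apply, pd_univ, h1.fderiv,
    smul_apply, smul_eq_mul]
  ring

lemma christoffel_confMetric {w : Eu m → ℝ} (hw : ContDiff ℝ ∞ w) (k i j : Fin m) :
    christoffel Set.univ (confMetric w) k i j = fun x =>
      (if k = j then 1 else 0) * pd Set.univ w i x + (if k = i then 1 else 0) * pd Set.univ w j x
        - (if i = j then 1 else 0) * pd Set.univ w k x := by
  ext x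
  have he : Real.exp (-(2 * w x)) * Real.exp (2 * w x) = 1 := by rw [← Real.exp_add]; simp
  simp only [christoffel, pd_confMetric hw, confMetric_inv_apply]
  rw [Finset.sum_eq_single k]
  · rw [if_pos rfl]
    simp only [eq_comm (a := k)]
    linear_combination ((if j = k then 1 else 0) * pd Set.univ w i x
      + (if i = k then 1 else 0) * pd Set.univ w j x
      - (if i = j then 1 else 0) * pd Set.univ w k x) * he
  · intro l _ hl
    rw [if_neg (Ne.symm hl)]; ring
  · simp

lemma pd_christoffel_confMetric {w : Eu m → ℝ} (hw : ContDiff ℝ ∞ w) (k i j l : Fin m)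
    (x : Eu m) :
    pd Set.univ (christoffel Set.univ (confMetric w) k i j) l x =
      (if k = j then 1 else 0) * pd Set.univ (pd Set.univ w i) l x
        + (if k = i then 1 else 0) * pd Set.univ (pd Set.univ w j) l x
        - (if i = j then 1 else 0) * pd Set.univ (pd Set.univ w k) l x := by
  have hd : ∀ a, HasFDerivAt (pd Set.univ w a) (fderiv ℝ (pd Set.univ w a) x) x := fun a =>
    ((contDiff_pd hw a).differentiable (by simp) x).hasFDerivAt
  rw [christoffel_confMetric hw, pd_univ]
  have h := (((hd i).const_mul (if k = j then (1 : ℝ) else 0)).add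
    ((hd j).const_mul (if k = i then (1 : ℝ) else 0))).sub
    ((hd k).const_mul (if i = j then (1 : ℝ) else 0))
  refine (congrArg (fun L : Eu m →L[ℝ] ℝ => L (EuclideanSpace.single l 1)) h.fderiv).trans ?_
  simp only [sub_apply, add_apply,
    smul_apply, smul_eq_mul, pd_univ]

/-- The scalar curvature of `e^{2w} δ` is `-(m-1) e^{-2w} (2 Δw + (m-2) |∇w|²)`. -/
lemma scalarCurv_confMetric {w : Eu m → ℝ} (hw : ContDiff ℝ ∞ w) (x : Eu m) :
    scalarCurv Set.univ (confMetric w) x = -((m : ℝ) - 1) * Real.exp (-(2 * w x)) *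
      (2 * ∑ i, pd Set.univ (pd Set.univ w i) i x
        + ((m : ℝ) - 2) * ∑ i, pd Set.univ w i x ^ 2) := by
  have h1 : scalarCurv Set.univ (confMetric w) x =
      Real.exp (-(2 * w x)) * ∑ j, ricci Set.univ (confMetric w) j j x := by
    simp [scalarCurv, confMetric_inv_apply, Finset.mul_sum]
  have h2 : ∑ j, ricci Set.univ (confMetric w) j j x =
      -((m : ℝ) - 1) * (2 * ∑ i, pd Set.univ (pd Set.univ w i) i x
        + ((m : ℝ) - 2) * ∑ i, pd Set.univ w i x ^ 2) := by
    simp only [ricci, pd_christoffel_confMetric hw]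
    simp only [christoffel_confMetric hw]
    -- With the first and second derivatives of `w` replaced by arbitrary families `p` and `q`, only
    -- contractions of Kronecker deltas remain.
    generalize hq : (fun i j => pd Set.univ (pd Set.univ w i) j x) = q
    have hq' : ∀ i j, pd Set.univ (pd Set.univ w i) j x = q i j := fun i j => by rw [← hq]
    simp only [hq']
    generalize (pd Set.univ w) = p
    simp only [mul_add, add_mul, mul_sub, sub_mul, Finset.sum_add_distrib, Finset.sum_sub_distrib,
      ite_mul, mul_ite, one_mul, zero_mul, mul_zero, Finset.sum_ite_eq,
      Finset.sum_ite_eq', Finset.mem_univ, if_true, ← Finset.mul_sum, Finset.sum_const,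
      Finset.card_univ, Fintype.card_fin, nsmul_eq_mul]
    simp [Finset.sum_ite_eq, Finset.sum_add_distrib, ← sq]
    have h3 : ∑ i, p i x * (m * p i x) = m * ∑ i, p i x ^ 2 := by
      rw [Finset.mul_sum]
      exact Finset.sum_congr rfl fun i _ => by ring
    rw [h3]
    ring
  rw [h1, h2]; ring

lemma gradNorm_confMetric (w u : Eu m → ℝ) (x : Eu m) :
    gradNorm Set.univ (confMetric w) u x =
      Real.exp (-w x) * √(∑ i, pd Set.univ u i x ^ 2) := by
  have h : ∑ i, ∑ j, (confMetric w x)⁻¹ i j * pd Set.univ u i x * pd Set.univ u j x =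
      Real.exp (-w x) ^ 2 * ∑ i, pd Set.univ u i x ^ 2 := by
    have he : Real.exp (-(2 * w x)) = Real.exp (-w x) ^ 2 := by
      rw [← Real.exp_nat_mul]; push_cast; ring_nf
    simp [confMetric_inv_apply, Finset.mul_sum, he]
    exact Finset.sum_congr rfl fun i _ => by ring
  rw [gradNorm, h, Real.sqrt_mul (by positivity), Real.sqrt_sq (Real.exp_pos _).le]

lemma normal_confMetric (w u : Eu m → ℝ) (x : Eu m) (i : Fin m) :
    normal Set.univ (confMetric w) u i x =
      Real.exp (-w x) * (pd Set.univ u i x / √(∑ i, pd Set.univ u i x ^ 2)) := by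
  have he : Real.exp (-(2 * w x)) = Real.exp (-w x) * Real.exp (-w x) := by
    rw [← Real.exp_add]; ring_nf
  rw [normal, gradNorm_confMetric]
  simp only [confMetric_inv_apply, mul_ite, mul_one, mul_zero, ite_mul, zero_mul,
    Finset.sum_ite_eq, Finset.mem_univ, if_true, he]
  rw [mul_assoc, mul_div_mul_left _ _ (Real.exp_pos _).ne', mul_div_assoc]

lemma hess_confMetric {w : Eu m → ℝ} (hw : ContDiff ℝ ∞ w) (u : Eu m → ℝ) (x : Eu m)
    (i j : Fin m) :
    hess Set.univ (confMetric w) u i j x = pd Set.univ (pd Set.univ u j) i x -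
      (pd Set.univ u j x * pd Set.univ w i x + pd Set.univ u i x * pd Set.univ w j x
        - (if i = j then 1 else 0) * ∑ k, pd Set.univ w k x * pd Set.univ u k x) := by
  simp only [hess, christoffel_confMetric hw, sub_mul, add_mul, Finset.sum_sub_distrib,
    Finset.sum_add_distrib, ite_mul, one_mul, zero_mul, Finset.sum_ite_eq', Finset.mem_univ,
    if_true]
  split_ifs <;> simp <;> ring

/-- The mean curvature of the level sets of `u` for the metric `e^{2w} δ`. -/
lemma meanCurv_confMetric {w : Eu m → ℝ} (hw : ContDiff ℝ ∞ w) (u : Eu m → ℝ) (x : Eu m)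
    {r : ℝ} (hr : r = √(∑ i, pd Set.univ u i x ^ 2)) (hr0 : r ≠ 0) :
    meanCurv Set.univ (confMetric w) u x = Real.exp (-w x) / r *
      (∑ i, ∑ j, ((if i = j then 1 else 0) - pd Set.univ u i x / r * (pd Set.univ u j x / r)) *
          pd Set.univ (pd Set.univ u j) i x
        + ((m : ℝ) - 1) * ∑ k, pd Set.univ w k x * pd Set.univ u k x) := by
  have he : Real.exp (-(2 * w x)) = Real.exp (-w x) * Real.exp (-w x) := by
    rw [← Real.exp_add]; ring_nf
  have hr2 : ∑ i, pd Set.univ u i x ^ 2 = r ^ 2 := by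
    rw [hr, Real.sq_sqrt (Finset.sum_nonneg fun i _ => sq_nonneg _)]
  have hN : ∑ i, (pd Set.univ u i x / r) ^ 2 = 1 := by
    simp only [div_pow, ← Finset.sum_div, hr2]; field_simp
  have key : ∑ i, ∑ j, tangInv Set.univ (confMetric w) u i j x *
      hess Set.univ (confMetric w) u i j x = Real.exp (-w x) ^ 2 *
      (∑ i, ∑ j, ((if i = j then 1 else 0) - pd Set.univ u i x / r * (pd Set.univ u j x / r)) *
          pd Set.univ (pd Set.univ u j) i x
        + ((m : ℝ) - 1) * ∑ k, pd Set.univ w k x * pd Set.univ u k x) := by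
    simp only [tangInv, normal_confMetric, hess_confMetric hw, confMetric_inv_apply, ← hr, he]
    generalize ∑ k, pd Set.univ w k x * pd Set.univ u k x = Q
    have h1 : ∑ i, ∑ j, ((if i = j then (1 : ℝ) else 0)
        - pd Set.univ u i x / r * (pd Set.univ u j x / r)) * (if i = j then 1 else 0) = m - 1 := by
      simp [← sq, hN]
    -- The tangential projection annihilates the gradient of `u`, so the two mixed terms of the
    -- conformal Hessian do not contribute (`h2`, `h3`). Its trace `m - 1` (`h1`) multiplies the
    -- remaining term `⟨∇w, ∇u⟩`.
    have h2 : ∑ i, ∑ j, ((if i = j then (1 : ℝ) else 0)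
        - pd Set.univ u i x / r * (pd Set.univ u j x / r)) *
        (pd Set.univ u j x * pd Set.univ w i x) = 0 := by
      refine Finset.sum_eq_zero fun i _ => ?_
      have : ∑ j, ((if i = j then (1 : ℝ) else 0)
          - pd Set.univ u i x / r * (pd Set.univ u j x / r)) *
          (pd Set.univ u j x * pd Set.univ w i x) =
          pd Set.univ u i x * pd Set.univ w i x - pd Set.univ u i x * pd Set.univ w i x *
            ∑ j, (pd Set.univ u j x / r) ^ 2 := by
        simp only [sub_mul, Finset.sum_sub_distrib, ite_mul, one_mul, zero_mul, Finset.sum_ite_eq,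
          Finset.mem_univ, if_true, Finset.mul_sum]
        congr 1
        exact Finset.sum_congr rfl fun j _ => by field_simp
      rw [this, hN]; ring
    have h3 : ∑ i, ∑ j, ((if i = j then (1 : ℝ) else 0)
        - pd Set.univ u i x / r * (pd Set.univ u j x / r)) *
        (pd Set.univ u i x * pd Set.univ w j x) = 0 := by
      rw [Finset.sum_comm]
      refine Eq.trans ?_ h2
      refine Finset.sum_congr rfl fun i _ => Finset.sum_congr rfl fun j _ => ?_
      rw [mul_comm (pd Set.univ u j x / r)]
      simp only [eq_comm]
    have h4 : ∀ i j, (Real.exp (-w x) * Real.exp (-w x) * (if i = j then 1 else 0) -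
        Real.exp (-w x) * (pd Set.univ u i x / r) * (Real.exp (-w x) * (pd Set.univ u j x / r))) *
        (pd Set.univ (pd Set.univ u j) i x -
          (pd Set.univ u j x * pd Set.univ w i x + pd Set.univ u i x * pd Set.univ w j x
            - (if i = j then 1 else 0) * Q)) =
        Real.exp (-w x) ^ 2 * (((if i = j then (1 : ℝ) else 0)
          - pd Set.univ u i x / r * (pd Set.univ u j x / r)) * pd Set.univ (pd Set.univ u j) i x)
        - Real.exp (-w x) ^ 2 * (((if i = j then (1 : ℝ) else 0)
          - pd Set.univ u i x / r * (pd Set.univ u j x / r)) *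
          (pd Set.univ u j x * pd Set.univ w i x))
        - Real.exp (-w x) ^ 2 * (((if i = j then (1 : ℝ) else 0)
          - pd Set.univ u i x / r * (pd Set.univ u j x / r)) *
          (pd Set.univ u i x * pd Set.univ w j x))
        + Real.exp (-w x) ^ 2 * Q * (((if i = j then (1 : ℝ) else 0)
          - pd Set.univ u i x / r * (pd Set.univ u j x / r)) * (if i = j then 1 else 0)) :=
      fun i j => by ring
    simp only [h4, Finset.sum_add_distrib, Finset.sum_sub_distrib, ← Finset.mul_sum] at h1 h2 h3 ⊢
    rw [h2, h3, h1]
    ring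
  rw [meanCurv, key, gradNorm_confMetric, ← hr]
  have := (Real.exp_pos (-w x)).ne'
  generalize ∑ i, ∑ j, ((if i = j then (1 : ℝ) else 0)
    - pd Set.univ u i x / r * (pd Set.univ u j x / r)) * pd Set.univ (pd Set.univ u j) i x = T
  field_simp

end Conformal

/-! ### Absence of closed minimal hypersurfaces -/

section SecondVariation

variable {E : Type*} [NormedAddCommGroup E] [NormedSpace ℝ E]

lemma eventually_deriv_comp_curve {F : E → ℝ} {c : ℝ → E}
    (hF : ContDiffAt ℝ ∞ F (c 0)) (hc : ContDiffAt ℝ ∞ c 0) :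
    ∀ᶠ t in 𝓝 (0 : ℝ), deriv (fun t => F (c t)) t = fderiv ℝ F (c t) (deriv c t) := by
  have h1 : ∀ᶠ y in 𝓝 (c 0), DifferentiableAt ℝ F y :=
    ((hF.of_le (m := 1) (by norm_num)).eventually (by simp)).mono
      fun y hy => hy.differentiableAt (by simp)
  have h2 : ∀ᶠ t in 𝓝 (0 : ℝ), DifferentiableAt ℝ c t :=
    ((hc.of_le (m := 1) (by norm_num)).eventually (by simp)).mono
      fun y hy => hy.differentiableAt (by simp)
  filter_upwards [hc.continuousAt.eventually h1, h2] with t ht1 ht2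
  exact (ht1.hasFDerivAt.comp_hasDerivAt t ht2.hasDerivAt).deriv

lemma deriv_deriv_comp_curve {F : E → ℝ} {c : ℝ → E}
    (hF : ContDiffAt ℝ ∞ F (c 0)) (hc : ContDiffAt ℝ ∞ c 0) :
    deriv (deriv fun t => F (c t)) 0 =
      fderiv ℝ (fderiv ℝ F) (c 0) (deriv c 0) (deriv c 0)
        + fderiv ℝ F (c 0) (deriv (deriv c) 0) := by
  have h : deriv (fun t => F (c t)) =ᶠ[𝓝 0] fun t => fderiv ℝ F (c t) (deriv c t) :=
    eventually_deriv_comp_curve hF hc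
  rw [h.deriv_eq]
  have h1 : DifferentiableAt ℝ (fderiv ℝ F) (c 0) :=
    (hF.fderiv_right (m := ∞) (by simp)).differentiableAt (by simp)
  have h2 : DifferentiableAt ℝ c 0 := hc.differentiableAt (by simp)
  have h3 : DifferentiableAt ℝ (deriv c) 0 := by
    have : ContDiffAt ℝ ∞ (fun t => fderiv ℝ c t 1) 0 :=
      (hc.fderiv_right (m := ∞) (by simp)).clm_apply contDiffAt_const
    exact this.differentiableAt (by simp)
  have h4 := (h1.hasFDerivAt.comp_hasDerivAt (0 : ℝ) h2.hasDerivAt).clm_apply h3.hasDerivAt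
  simpa using h4.deriv

/-- Through every tangent vector of a regular level set there is a curve in the level set. -/
lemma exists_curve_in_level_set [CompleteSpace E] {u : E → ℝ} {x₀ : E}
    (hu : ContDiffAt ℝ ∞ u x₀) (hu0 : u x₀ = 0) (hdu : fderiv ℝ u x₀ ≠ 0) {v : E}
    (hv : fderiv ℝ u x₀ v = 0) :
    ∃ c : ℝ → E, ContDiffAt ℝ ∞ c 0 ∧ c 0 = x₀ ∧ deriv c 0 = v ∧ ∀ᶠ t in 𝓝 0, u (c t) = 0 := by
  obtain ⟨n, hn⟩ : ∃ n, fderiv ℝ u x₀ n = 1 := by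
    obtain ⟨y, hy⟩ : ∃ y, fderiv ℝ u x₀ y ≠ 0 := by
      by_contra! h
      exact hdu (ContinuousLinearMap.ext h)
    exact ⟨(fderiv ℝ u x₀ y)⁻¹ • y, by simp [hy]⟩
  set L := fderiv ℝ u x₀
  -- `Ψ` straightens the level set: `L (Ψ x - x₀) = u x`, because `L n = 1`, and the derivative of
  -- `Ψ` at `x₀` is the identity. The curve is the image of the line `x₀ + t v` under the local
  -- inverse of `Ψ`.
  set Ψ : E → E := fun x => x + (u x - L (x - x₀)) • n with hΨ
  have hΨ0 : Ψ x₀ = x₀ := by simp [hΨ, hu0]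
  have hΨs : ContDiffAt ℝ ∞ Ψ x₀ :=
    contDiffAt_id.add ((hu.sub (L.contDiff.contDiffAt.comp x₀
      (contDiffAt_id.sub contDiffAt_const))).smul contDiffAt_const)
  have hΨd : HasFDerivAt Ψ ((ContinuousLinearEquiv.refl ℝ E : E ≃L[ℝ] E) : E →L[ℝ] E) x₀ := by
    have h1 : HasFDerivAt u L x₀ := (hu.differentiableAt (by simp)).hasFDerivAt
    have h2 : HasFDerivAt (fun x => L (x - x₀)) L x₀ := by
      simpa using L.hasFDerivAt (x := x₀).sub_const (L x₀)
    have h3 := (hasFDerivAt_id x₀).add ((h1.sub h2).smul_const n)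
    rw [sub_self, ContinuousLinearMap.zero_smulRight, add_zero] at h3
    exact h3
  set θ := hΨs.localInverse hΨd (by simp)
  have hθ0 : θ x₀ = x₀ := by
    have := hΨs.localInverse_apply_image hΨd (by simp)
    rwa [hΨ0] at this
  have hθs : ContDiffAt ℝ ∞ θ x₀ := by
    have := hΨs.to_localInverse hΨd (by simp)
    rwa [hΨ0] at this
  have hst := hΨs.hasStrictFDerivAt' hΨd (by simp)
  have hθd : HasFDerivAt θ (ContinuousLinearMap.id ℝ E) x₀ := by
    have := hst.to_localInverse.hasFDerivAt
    rw [hΨ0] at this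
    exact this
  have hr : ∀ᶠ y in 𝓝 x₀, Ψ (θ y) = y := by
    have := hst.eventually_right_inverse
    rw [hΨ0] at this
    exact this
  have hl : HasDerivAt (fun t : ℝ => x₀ + t • v) v 0 := by
    simpa using ((hasDerivAt_id (0 : ℝ)).smul_const v).const_add x₀
  have hl0 : x₀ + (0 : ℝ) • v = x₀ := by simp
  refine ⟨fun t => θ (x₀ + t • v), ?_, by simp [hθ0], ?_, ?_⟩
  · refine ContDiffAt.comp (0 : ℝ) (by rwa [hl0]) ?_
    exact contDiffAt_const.add (contDiffAt_id.smul contDiffAt_const)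
  · have := HasFDerivAt.comp_hasDerivAt (x := (0 : ℝ)) (f := fun t : ℝ => x₀ + t • v)
      (by rw [hl0]; exact hθd) hl
    exact this.deriv
  · have ht : Tendsto (fun t : ℝ => x₀ + t • v) (𝓝 0) (𝓝 x₀) := by
      have := hl.continuousAt.tendsto
      rwa [hl0] at this
    filter_upwards [ht.eventually hr] with t h
    have h1 := congrArg (fun y => L (y - x₀)) h
    simp only [hΨ, add_sub_right_comm, map_add, map_smul, hn, hv, smul_eq_mul, sub_self, mul_one,
      map_zero, mul_zero, add_zero] at h1
    simp only [map_sub] at h1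
    simpa using h1

/-- If the second derivative were positive, the point would be a local minimum too. Then `q` would
be locally constant and its second derivative zero. -/
lemma deriv_deriv_nonpos_of_isLocalMax {q : ℝ → ℝ} {a : ℝ} (h : IsLocalMax q a)
    (hq : ContinuousAt q a) : deriv (deriv q) a ≤ 0 := by
  by_contra! hpos
  have hmin := isLocalMin_of_deriv_deriv_pos hpos h.deriv_eq_zero hq
  have : q =ᶠ[𝓝 a] fun _ => q a := by
    filter_upwards [h, hmin] with t h1 h2 using le_antisymm h1 h2
  have h2 : deriv q =ᶠ[𝓝 a] deriv fun _ => q a := this.deriv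
  rw [h2.deriv_eq] at hpos
  simp at hpos

end SecondVariation

/-- First and second order conditions at a point of a regular level set of maximal norm. -/
lemma level_set_norm_max {E : Type*} [NormedAddCommGroup E] [InnerProductSpace ℝ E]
    [CompleteSpace E] {u : E → ℝ} {x₀ : E} (hu : ContDiffAt ℝ ∞ u x₀) (hu0 : u x₀ = 0)
    (hdu : fderiv ℝ u x₀ ≠ 0) (hmax : ∀ᶠ x in 𝓝 x₀, u x = 0 → ‖x‖ ≤ ‖x₀‖) :
    ∃ l : ℝ, (∀ v, inner ℝ x₀ v = l * fderiv ℝ u x₀ v) ∧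
      ∀ v, fderiv ℝ u x₀ v = 0 → ‖v‖ ^ 2 ≤ l * fderiv ℝ (fderiv ℝ u) x₀ v v := by
  have hN : ContDiff ℝ ∞ fun x : E => ‖x‖ ^ 2 := contDiff_norm_sq ℝ
  have hN1 : fderiv ℝ (fun x : E => ‖x‖ ^ 2) = fun x => 2 • innerSL ℝ x := by
    ext1 x; exact fderiv_norm_sq_apply x
  have hN2 : ∀ v, fderiv ℝ (fderiv ℝ fun x : E => ‖x‖ ^ 2) x₀ v v = 2 * ‖v‖ ^ 2 := by
    intro v
    rw [hN1]
    have : HasFDerivAt (fun x : E => 2 • innerSL ℝ x) (2 • innerSL ℝ : E →L[ℝ] E →L[ℝ] ℝ) x₀ :=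
      (2 • innerSL ℝ : E →L[ℝ] E →L[ℝ] ℝ).hasFDerivAt
    rw [this.fderiv]
    simp
    exact real_inner_self_eq_norm_sq v
  -- Here `z` is the acceleration at time `0` of a curve in the level set with velocity `v`. The
  -- three relations are the first and second order conditions for `|c|²` at its maximum, and the
  -- second derivative of `u ∘ c = 0`. Eliminating `z` by means of the multiplier `l = ⟨x₀, n⟩`
  -- gives the claim.
  have curve : ∀ v, fderiv ℝ u x₀ v = 0 → ∃ z : E, inner ℝ x₀ v = 0 ∧
      ‖v‖ ^ 2 + inner ℝ x₀ z ≤ 0 ∧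
      fderiv ℝ (fderiv ℝ u) x₀ v v + fderiv ℝ u x₀ z = 0 := by
    intro v hv
    obtain ⟨c, hc, hc0, hcv, hcu⟩ := exists_curve_in_level_set hu hu0 hdu hv
    have hq : IsLocalMax (fun t => ‖c t‖ ^ 2) 0 := by
      have : Tendsto c (𝓝 0) (𝓝 x₀) := by rw [← hc0]; exact hc.continuousAt
      filter_upwards [this.eventually hmax, hcu] with t h1 h2
      rw [hc0]
      exact pow_le_pow_left₀ (norm_nonneg _) (h1 h2) 2
    refine ⟨deriv (deriv c) 0, ?_, ?_, ?_⟩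
    · have h1 := hq.deriv_eq_zero
      have h2 := (eventually_deriv_comp_curve (F := fun x : E => ‖x‖ ^ 2)
        hN.contDiffAt hc).self_of_nhds
      rw [h1, hN1, hc0, hcv] at h2
      simpa using h2.symm
    · have h1 := deriv_deriv_nonpos_of_isLocalMax hq (hc.continuousAt.norm.pow 2)
      rw [deriv_deriv_comp_curve (F := fun x : E => ‖x‖ ^ 2) hN.contDiffAt hc, hc0, hcv, hN2,
        hN1] at h1
      simp at h1
      linarith
    · have h1 : (fun t => u (c t)) =ᶠ[𝓝 0] fun _ => 0 := hcu
      have h2 : deriv (fun t => u (c t)) =ᶠ[𝓝 0] deriv fun _ => (0 : ℝ) := h1.deriv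
      have h3 := deriv_deriv_comp_curve (F := u) (hc0 ▸ hu) hc
      rw [h2.deriv_eq, hc0, hcv] at h3
      simpa using h3.symm
  obtain ⟨n, hn⟩ : ∃ n, fderiv ℝ u x₀ n = 1 := by
    obtain ⟨y, hy⟩ : ∃ y, fderiv ℝ u x₀ y ≠ 0 := by
      by_contra! h
      exact hdu (ContinuousLinearMap.ext h)
    exact ⟨(fderiv ℝ u x₀ y)⁻¹ • y, by simp [hy]⟩
  have hl : ∀ v, inner ℝ x₀ v = inner ℝ x₀ n * fderiv ℝ u x₀ v := by
    intro v
    obtain ⟨z, hz, -⟩ := curve (v - fderiv ℝ u x₀ v • n) (by simp [hn])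
    rw [inner_sub_right, inner_smul_right] at hz
    linarith
  refine ⟨inner ℝ x₀ n, hl, fun v hv => ?_⟩
  obtain ⟨z, -, hz1, hz2⟩ := curve v hv
  rw [hl z] at hz1
  have : fderiv ℝ (fderiv ℝ u) x₀ v v = - fderiv ℝ u x₀ z := by linarith
  rw [this]; linarith

/-- For a conformally flat metric `e^{2w} δ` with `r ↦ r e^w` strictly increasing there are no
closed minimal hypersurfaces. -/
lemma not_isClosedMinimalHypersurface {m : ℕ} (hm : 2 ≤ m) {w : Eu m → ℝ} (hw : ContDiff ℝ ∞ w)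
    (hrad : ∀ x, 0 < 1 + ∑ i, pd Set.univ w i x * x i) (N : Type) [TopologicalSpace N]
    (F : N → Eu m) : ¬ IsClosedMinimalHypersurface Set.univ (confMetric w) N F := by
  rintro ⟨hcpt, -, hne, hF⟩
  have hFc : Continuous F := by
    rw [continuous_iff_continuousAt]
    intro z
    obtain ⟨V, U, u, hV, hz, -, hemb, -⟩ := hF z
    have : ContinuousOn F V := continuousOn_iff_continuous_domRestrict.2 hemb.continuous
    exact this.continuousAt (hV.mem_nhds hz)
  -- At a point of maximal Euclidean norm the hypersurface touches a centred sphere from inside.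
  obtain ⟨z, -, hz⟩ := isCompact_univ.exists_isMaxOn (f := fun z => ‖F z‖) Set.univ_nonempty
    hFc.norm.continuousOn
  obtain ⟨V, U, u, hV, hzV, hU, -, himg, -, hu, hdu, hH⟩ := hF z
  have hzU : F z ∈ {x ∈ U | u x = 0} := himg ▸ Set.mem_image_of_mem F hzV
  set x₀ := F z
  have hux : ContDiffAt ℝ ∞ u x₀ := hu.contDiffAt (hU.mem_nhds hzU.1)
  obtain ⟨l, hl1, hl2⟩ := level_set_norm_max hux hzU.2 (hdu x₀ hzU.1) (by
    filter_upwards [hU.mem_nhds hzU.1] with x hx hx0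
    have : x ∈ F '' V := himg ▸ ⟨hx, hx0⟩
    obtain ⟨y, -, rfl⟩ := this
    exact hz (Set.mem_univ y))
  have hexp : ∀ v : Eu m, v = ∑ i, v i • EuclideanSpace.single i (1 : ℝ) := fun v => by
    simpa using ((EuclideanSpace.basisFun (Fin m) ℝ).sum_repr v).symm
  have hpd : ∀ i, pd Set.univ u i x₀ = fderiv ℝ u x₀ (EuclideanSpace.single i 1) :=
    fun i => pd_univ u i x₀
  have hD : ∀ v, fderiv ℝ u x₀ v = ∑ i, v i * pd Set.univ u i x₀ := fun v => by
    conv_lhs => rw [hexp v]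
    simp [hpd]
  have hpd2 : ∀ i j, pd Set.univ (pd Set.univ u j) i x₀ =
      fderiv ℝ (fderiv ℝ u) x₀ (EuclideanSpace.single i 1) (EuclideanSpace.single j 1) := by
    intro i j
    rw [pd_univ, show pd Set.univ u j = fun x => fderiv ℝ u x (EuclideanSpace.single j 1) from
      funext fun x => pd_univ u j x]
    have h1 : DifferentiableAt ℝ (fderiv ℝ u) x₀ :=
      (hux.fderiv_right (m := ∞) (by simp)).differentiableAt (by simp)
    have h2 := h1.hasFDerivAt.clm_apply
      (hasFDerivAt_const (EuclideanSpace.single j (1 : ℝ)) x₀)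
    rw [h2.fderiv]
    simp
  have hD2 : ∀ v, fderiv ℝ (fderiv ℝ u) x₀ v v =
      ∑ i, ∑ j, v i * v j * pd Set.univ (pd Set.univ u j) i x₀ := fun v => by
    conv_lhs => rw [hexp v]
    simp only [map_sum, map_smul, sum_apply, smul_apply, smul_eq_mul, hpd2, Finset.mul_sum]
    rw [Finset.sum_comm]
    exact Finset.sum_congr rfl fun i _ => Finset.sum_congr rfl fun j _ => by ring
  set r := √(∑ i, pd Set.univ u i x₀ ^ 2) with hr
  have hr0 : r ≠ 0 := by
    intro h0
    have h1 : ∑ i, pd Set.univ u i x₀ ^ 2 = 0 :=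
      (Real.sqrt_eq_zero (Finset.sum_nonneg fun i _ => sq_nonneg _)).1 h0
    have h2 := (Finset.sum_eq_zero_iff_of_nonneg fun i _ => sq_nonneg _).1 h1
    refine hdu x₀ hzU.1 (ContinuousLinearMap.ext fun v => ?_)
    rw [hD v]
    simpa using Finset.sum_eq_zero fun i _ => by
      rw [pow_eq_zero_iff (two_ne_zero)|>.1 (h2 i (Finset.mem_univ i)), mul_zero]
  have hr2 : ∑ i, pd Set.univ u i x₀ ^ 2 = r ^ 2 := by
    rw [hr, Real.sq_sqrt (Finset.sum_nonneg fun i _ => sq_nonneg _)]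
  have hmc := hH x₀ hzU.1 hzU.2
  rw [meanCurv_confMetric hw u x₀ hr hr0] at hmc
  replace hmc := (mul_eq_zero.1 hmc).resolve_left (div_ne_zero (Real.exp_pos _).ne' hr0)
  set ν : Fin m → ℝ := fun i => pd Set.univ u i x₀ / r with hν
  have hν1 : ∑ i, ν i ^ 2 = 1 := by
    simp only [hν, div_pow, ← Finset.sum_div, hr2]; field_simp
  set P : Fin m → Fin m → ℝ := fun i j => (if i = j then 1 else 0) - ν i * ν j with hP
  have hPP : ∀ i j, ∑ k, P i k * P j k = P i j := by
    intro i j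
    have : ∀ k, P i k * P j k = (if i = k then 1 else 0) * (if j = k then 1 else 0)
        - (if i = k then 1 else 0) * (ν j * ν k) - (if j = k then 1 else 0) * (ν i * ν k)
        + ν i * ν j * ν k ^ 2 := fun k => by simp only [hP]; ring
    simp only [this, Finset.sum_add_distrib, Finset.sum_sub_distrib, ← Finset.mul_sum, hν1]
    simp [hP, eq_comm]
    ring
  -- The columns of the tangential projection `P` are tangent vectors. Summing the second order
  -- condition over them traces it over the tangent space, because `P` is symmetric and idempotent.
  have htr : ∑ i, P i i = m - 1 := by
    simp only [hP, if_true, Finset.sum_sub_distrib, ← sq, hν1]; simp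
  have hvar : ∀ k, ∑ i, P i k ^ 2 ≤
      l * ∑ i, ∑ j, P i k * P j k * pd Set.univ (pd Set.univ u j) i x₀ := by
    intro k
    have h1 := hl2 (WithLp.toLp 2 fun i => P i k) (by
      rw [hD]
      have : ∀ i, P i k * pd Set.univ u i x₀ = (if i = k then pd Set.univ u i x₀ else 0)
          - pd Set.univ u k x₀ * ν i ^ 2 := fun i => by
        simp only [hP, hν]; split_ifs <;> field_simp
        ring
      simp only [this, Finset.sum_sub_distrib, ← Finset.mul_sum, hν1]
      simp)
    rw [hD2, EuclideanSpace.norm_sq_eq] at h1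
    simpa using h1
  have hsum : (m : ℝ) - 1 ≤ l * ∑ i, ∑ j, P i j * pd Set.univ (pd Set.univ u j) i x₀ := by
    have h1 := Finset.sum_le_sum fun k (_ : k ∈ Finset.univ) => hvar k
    rw [← Finset.mul_sum, Finset.sum_comm] at h1
    rw [Finset.sum_comm (f := fun k i => ∑ j, P i k * P j k * _)] at h1
    have h2 : ∀ i, ∑ k, ∑ j, P i k * P j k * pd Set.univ (pd Set.univ u j) i x₀ =
        ∑ j, P i j * pd Set.univ (pd Set.univ u j) i x₀ := by
      intro i
      rw [Finset.sum_comm]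
      exact Finset.sum_congr rfl fun j _ => by rw [← Finset.sum_mul, hPP]
    simp only [h2] at h1
    simpa only [sq, hPP, htr] using h1
  have hx : ∀ i, x₀ i = l * pd Set.univ u i x₀ := by
    intro i
    rw [hpd, ← hl1]
    simp [EuclideanSpace.inner_single_right]
  have hw1 : l * ∑ k, pd Set.univ w k x₀ * pd Set.univ u k x₀ =
      ∑ k, pd Set.univ w k x₀ * x₀ k := by
    rw [Finset.mul_sum]
    exact Finset.sum_congr rfl fun k _ => by rw [hx]; ring
  have hm1 : (0 : ℝ) < m - 1 := by
    have : (2 : ℝ) ≤ m := by exact_mod_cast hm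
    linarith
  have := hrad x₀
  -- Minimality turns the traced inequality into `m - 1 ≤ -(m - 1) ∑ ∂ₖw xₖ`, which contradicts
  -- `hrad`.
  have h5 : l * ∑ i, ∑ j, P i j * pd Set.univ (pd Set.univ u j) i x₀ =
      -((m : ℝ) - 1) * ∑ k, pd Set.univ w k x₀ * x₀ k := by
    rw [← hw1]
    linear_combination l * hmc
  rw [h5] at hsum
  nlinarith

/-! ### Rotationally symmetric conformally flat metrics -/

section Radial

variable {m : ℕ}

lemma hasFDerivAt_comp_norm_sq {f : ℝ → ℝ} {f' : ℝ} {x : Eu m} (h : HasDerivAt f f' (‖x‖ ^ 2)) :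
    HasFDerivAt (fun y : Eu m => f (‖y‖ ^ 2)) (f' • (2 • innerSL ℝ x)) x :=
  h.comp_hasFDerivAt x (hasStrictFDerivAt_norm_sq x).hasFDerivAt

lemma hasFDerivAt_coord (i : Fin m) (x : Eu m) :
    HasFDerivAt (fun y : Eu m => y i) (EuclideanSpace.proj i : Eu m →L[ℝ] ℝ) x :=
  (EuclideanSpace.proj i : Eu m →L[ℝ] ℝ).hasFDerivAt

lemma innerSL_single (x : Eu m) (i : Fin m) :
    innerSL ℝ x (EuclideanSpace.single i (1 : ℝ)) = x i := by
  rw [innerSL_apply_apply, EuclideanSpace.inner_single_right]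
  simp

variable {κ κ₁ κ₂ : ℝ → ℝ}

lemma pd_radial (h1 : ∀ ρ, 0 ≤ ρ → HasDerivAt κ (κ₁ ρ) ρ) (i : Fin m) (x : Eu m) :
    pd Set.univ (fun y : Eu m => κ (‖y‖ ^ 2)) i x = 2 * κ₁ (‖x‖ ^ 2) * x i := by
  rw [pd_univ, (hasFDerivAt_comp_norm_sq (h1 _ (by positivity))).fderiv]
  simp only [smul_apply, innerSL_single, smul_eq_mul, nsmul_eq_mul]
  push_cast; ring

lemma pd_pd_radial (h1 : ∀ ρ, 0 ≤ ρ → HasDerivAt κ (κ₁ ρ) ρ)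
    (h2 : ∀ ρ, 0 ≤ ρ → HasDerivAt κ₁ (κ₂ ρ) ρ) (i : Fin m) (x : Eu m) :
    pd Set.univ (pd Set.univ (fun y : Eu m => κ (‖y‖ ^ 2)) i) i x =
      4 * κ₂ (‖x‖ ^ 2) * x i ^ 2 + 2 * κ₁ (‖x‖ ^ 2) := by
  rw [pd_univ, funext fun x => pd_radial h1 i x]
  have h := ((hasFDerivAt_comp_norm_sq (h2 _ (sq_nonneg ‖x‖))).const_mul 2).mul
    (hasFDerivAt_coord i x)
  refine (congrArg (fun L : Eu m →L[ℝ] ℝ => L (EuclideanSpace.single i 1)) h.fderiv).trans ?_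
  simp only [add_apply, smul_apply, innerSL_single, smul_eq_mul, nsmul_eq_mul,
    PiLp.proj_apply]
  simp
  ring

/-- Writing radial functions in terms of `|x|²` rather than `|x|` makes smoothness at the pole
automatic. -/
lemma contDiff_radial (hs : ∀ ρ, 0 ≤ ρ → ContDiffAt ℝ ∞ κ ρ) :
    ContDiff ℝ ∞ fun y : Eu m => κ (‖y‖ ^ 2) := by
  rw [contDiff_iff_contDiffAt]
  intro x
  exact (hs _ (sq_nonneg ‖x‖)).comp x (contDiff_norm_sq ℝ).contDiffAt

/-- With `w = κ(|x|²)` the left side of `h` is a quarter of `2 Δw + (m - 2)|∇w|²`. For `m > 2` its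
sign is that of the Laplacian of `e^{(m-2)w/2}`, so `h` says that this function is superharmonic. -/
lemma scalarCurv_radial_nonneg (hm : 1 ≤ m) (hs : ∀ ρ, 0 ≤ ρ → ContDiffAt ℝ ∞ κ ρ)
    (h1 : ∀ ρ, 0 ≤ ρ → HasDerivAt κ (κ₁ ρ) ρ) (h2 : ∀ ρ, 0 ≤ ρ → HasDerivAt κ₁ (κ₂ ρ) ρ)
    (h : ∀ ρ, 0 ≤ ρ → 2 * ρ * κ₂ ρ + m * κ₁ ρ + ((m : ℝ) - 2) * ρ * κ₁ ρ ^ 2 ≤ 0) (x : Eu m) :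
    0 ≤ scalarCurv Set.univ (confMetric fun y : Eu m => κ (‖y‖ ^ 2)) x := by
  rw [scalarCurv_confMetric (contDiff_radial hs)]
  simp only [pd_pd_radial h1 h2, pd_radial h1, Finset.sum_add_distrib, mul_pow, ← Finset.mul_sum,
    ← EuclideanSpace.real_norm_sq_eq, Finset.sum_const, Finset.card_univ, Fintype.card_fin,
    nsmul_eq_mul]
  have hm' : (1 : ℝ) ≤ m := by exact_mod_cast hm
  have h3 := h _ (sq_nonneg ‖x‖)
  have h4 := mul_nonneg (sub_nonneg.2 hm') (Real.exp_pos (-(2 * κ (‖x‖ ^ 2)))).le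
  nlinarith [mul_nonneg h4 (neg_nonneg.2 h3)]

lemma pd_norm {x : Eu m} (hx : x ≠ 0) (i : Fin m) :
    pd Set.univ (fun y : Eu m => ‖y‖) i x = x i / ‖x‖ := by
  have hx' : 0 < ‖x‖ := norm_pos_iff.2 hx
  have h := hasFDerivAt_comp_norm_sq (x := x) (Real.hasDerivAt_sqrt (x := ‖x‖ ^ 2) (by positivity))
  simp only [Real.sqrt_sq (norm_nonneg _)] at h
  rw [pd_univ, h.fderiv]
  simp only [smul_apply, innerSL_single, smul_eq_mul, nsmul_eq_mul]
  push_cast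
  field_simp

lemma pd_pd_norm {x : Eu m} (hx : x ≠ 0) (i j : Fin m) :
    pd Set.univ (pd Set.univ (fun y : Eu m => ‖y‖) j) i x =
      ((if i = j then 1 else 0) - x i / ‖x‖ * (x j / ‖x‖)) / ‖x‖ := by
  have hx' : 0 < ‖x‖ := norm_pos_iff.2 hx
  have he : pd Set.univ (fun y : Eu m => ‖y‖) j =ᶠ[𝓝 x] fun y => y j * (√(‖y‖ ^ 2))⁻¹ := by
    filter_upwards [isOpen_ne.mem_nhds hx] with y hy
    rw [pd_norm hy, Real.sqrt_sq (norm_nonneg _), div_eq_mul_inv]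
  rw [pd_univ, he.fderiv_eq]
  have h := (hasFDerivAt_coord j x).mul (hasFDerivAt_comp_norm_sq (x := x)
    ((Real.hasDerivAt_sqrt (x := ‖x‖ ^ 2) (by positivity)).inv (by positivity)))
  refine (congrArg (fun L : Eu m →L[ℝ] ℝ => L (EuclideanSpace.single i 1)) h.fderiv).trans ?_
  simp only [add_apply, smul_apply, innerSL_single, smul_eq_mul, nsmul_eq_mul,
    PiLp.proj_apply, Real.sqrt_sq (norm_nonneg x), PiLp.single_apply,
    Pi.inv_apply]
  simp only [eq_comm (a := j)]
  split_ifs <;> field_simp <;> push_cast <;> ring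

/-- The mean curvature of the symmetric spheres. -/
lemma meanCurv_radial_norm (hs : ∀ ρ, 0 ≤ ρ → ContDiffAt ℝ ∞ κ ρ)
    (h1 : ∀ ρ, 0 ≤ ρ → HasDerivAt κ (κ₁ ρ) ρ) {x : Eu m} (hx : x ≠ 0) :
    meanCurv Set.univ (confMetric fun y : Eu m => κ (‖y‖ ^ 2)) (fun y => ‖y‖) x =
      ((m : ℝ) - 1) * (Real.exp (-κ (‖x‖ ^ 2)) / ‖x‖ * (1 + 2 * ‖x‖ ^ 2 * κ₁ (‖x‖ ^ 2))) := by
  have hx' : 0 < ‖x‖ := norm_pos_iff.2 hx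
  have hN : ∑ i, (x i / ‖x‖) ^ 2 = 1 := by
    simp only [div_pow, ← Finset.sum_div, ← EuclideanSpace.real_norm_sq_eq]
    field_simp
  rw [meanCurv_confMetric (contDiff_radial hs) _ x (r := 1) (by simp [pd_norm hx, hN]) one_ne_zero]
  simp only [pd_norm hx, pd_pd_norm hx, pd_radial h1, div_one]
  have h2 : ∑ i, ∑ j, ((if i = j then (1 : ℝ) else 0) - x i / ‖x‖ * (x j / ‖x‖)) *
      (((if i = j then (1 : ℝ) else 0) - x i / ‖x‖ * (x j / ‖x‖)) / ‖x‖) = ((m : ℝ) - 1) / ‖x‖ := by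
    have : ∀ i j, ((if i = j then (1 : ℝ) else 0) - x i / ‖x‖ * (x j / ‖x‖)) *
      (((if i = j then (1 : ℝ) else 0) - x i / ‖x‖ * (x j / ‖x‖)) / ‖x‖) =
      ((if i = j then 1 - 2 * (x i / ‖x‖) ^ 2 else 0)
        + (x i / ‖x‖) ^ 2 * (x j / ‖x‖) ^ 2) / ‖x‖ := by
      intro i j
      split_ifs with h
      · subst h; ring
      · ring
    simp only [this, ← Finset.sum_div, Finset.sum_add_distrib, ← Finset.mul_sum, hN]
    simp [Finset.sum_sub_distrib, ← Finset.mul_sum, hN]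
    ring
  have h3 : ∑ k, 2 * κ₁ (‖x‖ ^ 2) * x k * (x k / ‖x‖) = 2 * κ₁ (‖x‖ ^ 2) * ‖x‖ := by
    have : ∀ k, 2 * κ₁ (‖x‖ ^ 2) * x k * (x k / ‖x‖) =
      2 * κ₁ (‖x‖ ^ 2) * ‖x‖ * (x k / ‖x‖) ^ 2 := fun k => by field_simp
    simp only [this, ← Finset.mul_sum, hN, mul_one]
  rw [h2, h3]
  field_simp

lemma areaDensity_radial (hm : 1 ≤ m) {x : Eu m} (hx : x ≠ 0) :
    areaDensity (confMetric fun y : Eu m => κ (‖y‖ ^ 2)) x = Real.exp (κ (‖x‖ ^ 2)) ^ (m - 1) := by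
  have hx' : 0 < ‖x‖ := norm_pos_iff.2 hx
  have hN : ∑ i, (x i / ‖x‖) ^ 2 = 1 := by
    simp only [div_pow, ← Finset.sum_div, ← EuclideanSpace.real_norm_sq_eq]
    field_simp
  have h1 : ∑ i, ∑ j, (confMetric (fun y : Eu m => κ (‖y‖ ^ 2)) x)⁻¹ i j * (x i / ‖x‖) *
      (x j / ‖x‖) = Real.exp (-(2 * κ (‖x‖ ^ 2))) := by
    simp only [confMetric_inv_apply, mul_ite, mul_one, mul_zero, ite_mul, zero_mul,
      Finset.sum_ite_eq, Finset.mem_univ, if_true]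
    simp only [mul_assoc, ← Finset.mul_sum, ← sq, hN, mul_one]
  rw [areaDensity, h1, confMetric, Matrix.det_smul, Matrix.det_one, mul_one, Fintype.card_fin]
  obtain ⟨k, rfl⟩ : ∃ k, m = k + 1 := ⟨m - 1, by omega⟩
  have : Real.exp (2 * κ (‖x‖ ^ 2)) ^ (k + 1) * Real.exp (-(2 * κ (‖x‖ ^ 2))) =
      (Real.exp (κ (‖x‖ ^ 2)) ^ k) ^ 2 := by
    simp only [← Real.exp_nat_mul, ← Real.exp_add]
    push_cast; ring_nf
  rw [this, Real.sqrt_sq (by positivity)]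
  simp

lemma sphereIntegral_radial (hm : 2 ≤ m) {t : ℝ} (ht : 0 ≤ t) {φ : Eu m → ℝ} {c : ℝ}
    (hφ : ∀ x, ‖x‖ = t → x ≠ 0 → φ x = c) :
    sphereIntegral (confMetric fun y : Eu m => κ (‖y‖ ^ 2)) t φ =
      omega m * (t * Real.exp (κ (t ^ 2))) ^ (m - 1) * c := by
  -- For `t = 0` the hypothesis on `φ` is empty, but both sides vanish through the factor `t ^ (m -
  -- 1)`.
  rcases ht.eq_or_lt with rfl | ht
  · have : m - 1 ≠ 0 := by omega
    simp [sphereIntegral, this]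
  have h : ∀ w : Metric.sphere (0 : Eu m) 1,
      φ (t • (w : Eu m)) * areaDensity (confMetric fun y : Eu m => κ (‖y‖ ^ 2)) (t • (w : Eu m)) *
        t ^ (m - 1) = (t * Real.exp (κ (t ^ 2))) ^ (m - 1) * c := by
    intro w
    have hn : ‖t • (w : Eu m)‖ = t := by
      rw [norm_smul, norm_eq_of_mem_sphere w, Real.norm_of_nonneg ht.le, mul_one]
    have h0 : t • (w : Eu m) ≠ 0 := norm_pos_iff.1 (by rwa [hn])
    rw [areaDensity_radial (by omega) h0, hφ _ hn h0, hn, mul_pow]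
    ring
  simp only [sphereIntegral, h, integral_const, smul_eq_mul, omega, Measure.real]
  ring

/-- The conformally flat rotationally symmetric manifold `(ℝ^m, e^{2 κ(|x|²)} δ)`. -/
noncomputable def confManifold (m : ℕ) (κ : ℝ → ℝ) (hs : ∀ ρ, 0 ≤ ρ → ContDiffAt ℝ ∞ κ ρ) :
    RotSymManifold m where
  a := 0
  a_nonneg := le_rfl
  g := confMetric fun y : Eu m => κ (‖y‖ ^ 2)
  smooth i j := by
    simp only [confMetric_apply]
    exact ((Real.contDiff_exp.comp (contDiff_const.mul (contDiff_radial hs))).mul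
      contDiff_const).contDiffOn
  posDef x _ := Matrix.PosDef.one.smul (Real.exp_pos _)
  invariant Q hQ x _ := by
    have h1 : Qᵀ * Q = 1 := (Matrix.mem_orthogonalGroup_iff' (Fin m) ℝ).1 hQ
    have h2 : ‖(WithLp.toLp 2 (Q *ᵥ x.ofLp) : Eu m)‖ ^ 2 = ‖x‖ ^ 2 := by
      rw [EuclideanSpace.real_norm_sq_eq, EuclideanSpace.real_norm_sq_eq]
      simp only [sq]
      change (Q *ᵥ x.ofLp) ⬝ᵥ (Q *ᵥ x.ofLp) = x.ofLp ⬝ᵥ x.ofLp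
      rw [Matrix.dotProduct_mulVec, Matrix.vecMul_mulVec, h1, Matrix.vecMul_one]
    simp only [confMetric, h2]
    rw [Matrix.mul_smul, Matrix.smul_mul, Matrix.mul_one, h1]

variable (hs : ∀ ρ, 0 ≤ ρ → ContDiffAt ℝ ∞ κ ρ)

lemma carrier_confManifold : (confManifold m κ hs).carrier = Set.univ := by
  ext x; simp [RotSymManifold.carrier, confManifold]

lemma omega_pos (hm : 1 ≤ m) : 0 < omega m := by
  have : Nontrivial (Eu m) := by
    have : Nonempty (Fin m) := ⟨⟨0, hm⟩⟩
    infer_instance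
  have h := Measure.toSphere_ne_zero (E := Eu m) volume
  exact ENNReal.toReal_pos (fun h0 => h (Measure.measure_univ_eq_zero.1 h0)) (measure_ne_top _ _)

lemma area_confManifold (hm : 2 ≤ m) {t : ℝ} (ht : 0 ≤ t) :
    (confManifold m κ hs).area t = omega m * (t * Real.exp (κ (t ^ 2))) ^ (m - 1) := by
  rw [RotSymManifold.area]
  refine (sphereIntegral_radial hm ht (c := 1) fun _ _ _ => rfl).trans (mul_one _)

/-- The area radius is `f = t e^κ` and the arc length satisfies `ds = e^κ dt`, so `df/ds = 1 +
2t²κ₁` and the mean curvature is `(m - 1) f'/f`. This is the formula `f^{m-2}(1 - f'²)/2`. -/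
lemma hawkingMass_confManifold (hm : 2 ≤ m) (h1 : ∀ ρ, 0 ≤ ρ → HasDerivAt κ (κ₁ ρ) ρ) {t : ℝ}
    (ht : 0 < t) :
    (confManifold m κ hs).hawkingMass t = (t * Real.exp (κ (t ^ 2))) ^ (m - 2) / 2 *
      (1 - (1 + 2 * t ^ 2 * κ₁ (t ^ 2)) ^ 2) := by
  have ho := omega_pos (m := m) (by omega)
  set f := t * Real.exp (κ (t ^ 2)) with hf
  have hf0 : 0 < f := by positivity
  have hm1 : ((m - 1 : ℕ) : ℝ) = m - 1 := by push_cast [show 1 ≤ m by omega]; ring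
  have hm2 : (0 : ℝ) < m - 1 := by
    have : (2 : ℝ) ≤ m := by exact_mod_cast hm
    linarith
  have hr : (confManifold m κ hs).areaRadius t = f := by
    rw [RotSymManifold.areaRadius, area_confManifold hs hm ht.le, mul_div_cancel_left₀ _ ho.ne',
      one_div, ← hm1]
    exact Real.pow_rpow_inv_natCast hf0.le (by omega)
  have hI : sphereIntegral (confManifold m κ hs).g t (fun x =>
      (meanCurv (confManifold m κ hs).carrier (confManifold m κ hs).g (fun y => ‖y‖) x
        / ((m : ℝ) - 1)) ^ 2) =
      omega m * f ^ (m - 1) * ((1 + 2 * t ^ 2 * κ₁ (t ^ 2)) / f) ^ 2 := by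
    refine sphereIntegral_radial hm ht.le fun x hx hx0 => ?_
    rw [carrier_confManifold]
    change (meanCurv Set.univ (confMetric fun y : Eu m => κ (‖y‖ ^ 2)) (fun y => ‖y‖) x / _) ^ 2 = _
    rw [meanCurv_radial_norm hs h1 hx0, mul_div_cancel_left₀ _ hm2.ne', hx, Real.exp_neg, hf]
    field_simp
  rw [RotSymManifold.hawkingMass, hr, hI, area_confManifold hs hm ht.le, ← hf]
  field_simp

end Radial

/-! ### The distance of a conformally flat metric -/

section ConfDist

variable {E : Type*} [NormedAddCommGroup E] [NormedSpace ℝ E]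

/-- `ℓ` is the length of a `C¹` path from `x` to `y` for the metric `c² δ`. -/
def ConfLength (c : E → ℝ) (x y : E) (ℓ : ℝ) : Prop :=
  ∃ γ : ℝ → E, ContDiffOn ℝ 1 γ (Set.Icc 0 1) ∧ γ 0 = x ∧ γ 1 = y ∧
    ℓ = ∫ t in (0 : ℝ)..1, c (γ t) * ‖derivWithin γ (Set.Icc 0 1) t‖

/-- The Riemannian distance of the metric `c² δ`. -/
noncomputable def confDist (c : E → ℝ) (x y : E) : ℝ := sInf {ℓ | ConfLength c x y ℓ}

variable {c : E → ℝ}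

lemma ConfLength.of_hasDerivAt {γ γ' : ℝ → E} (h : ∀ t, HasDerivAt γ (γ' t) t)
    (hc : Continuous γ') :
    ConfLength c (γ 0) (γ 1) (∫ t in (0 : ℝ)..1, c (γ t) * ‖γ' t‖) := by
  have hd : deriv γ = γ' := funext fun t => (h t).deriv
  have h1 : ContDiff ℝ 1 γ :=
    contDiff_one_iff_deriv.2 ⟨fun t => (h t).differentiableAt, by rwa [hd]⟩
  refine ⟨γ, h1.contDiffOn, rfl, rfl, intervalIntegral.integral_congr fun t ht => ?_⟩
  rw [Set.uIcc_of_le zero_le_one] at ht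
  rw [(h t).hasDerivWithinAt.derivWithin (uniqueDiffOn_Icc zero_lt_one t ht)]

/-- A path can be reparametrised such that it extends smoothly to a path on the line that is
constant outside the unit interval. -/
lemma ConfLength.exists_contDiff (hc : Continuous c) {x y : E} {ℓ : ℝ}
    (h : ConfLength c x y ℓ) : ∃ γ : ℝ → E, ContDiff ℝ 1 γ ∧ (∀ t ≤ 0, γ t = x) ∧
      (∀ t, 1 ≤ t → γ t = y) ∧ ∫ t in (0 : ℝ)..1, c (γ t) * ‖deriv γ t‖ = ℓ := by
  obtain ⟨γ, hγ, rfl, rfl, rfl⟩ := h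
  set σ := Real.smoothTransition
  have hσ : ∀ t, σ t ∈ Set.Icc (0 : ℝ) 1 := fun t =>
    ⟨Real.smoothTransition.nonneg t, Real.smoothTransition.le_one t⟩
  have hσs : ContDiff ℝ 1 σ := Real.smoothTransition.contDiff (n := 1)
  have hd : ∀ t, HasDerivAt (fun t => γ (σ t))
      (deriv σ t • derivWithin γ (Set.Icc 0 1) (σ t)) t := fun t =>
    (((hγ.differentiableOn (by simp)) _ (hσ t)).hasDerivWithinAt).scomp_hasDerivAt t
      ((hσs.differentiable (by simp) t).hasDerivAt) hσ
  refine ⟨fun t => γ (σ t), hγ.comp_contDiff hσs hσ, fun t ht => ?_, fun t ht => ?_, ?_⟩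
  · simp only [σ, Real.smoothTransition.zero_of_nonpos ht]
  · simp only [σ, Real.smoothTransition.one_of_one_le ht]
  · set g := fun t => c (γ t) * ‖derivWithin γ (Set.Icc 0 1) t‖ with hg
    have hgc : ContinuousOn g (Set.Icc 0 1) :=
      (hc.comp_continuousOn hγ.continuousOn).mul
        (hγ.continuousOn_derivWithin (uniqueDiffOn_Icc zero_lt_one) (by simp)).norm
    have h1 : ∫ t in (0 : ℝ)..1, (g ∘ σ) t * deriv σ t = ∫ t in (σ 0)..(σ 1), g t := by
      refine intervalIntegral.integral_comp_mul_deriv'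
        (fun t _ => (hσs.differentiable (by simp) t).hasDerivAt)
        (hσs.continuous_deriv (by simp)).continuousOn (hgc.mono ?_)
      rintro _ ⟨t, -, rfl⟩
      exact hσ t
    have h2 : ∀ t, c (γ (σ t)) * ‖deriv (fun t => γ (σ t)) t‖ = (g ∘ σ) t * deriv σ t := by
      intro t
      have : 0 ≤ deriv σ t := Real.smoothTransition.monotone.deriv_nonneg
      rw [(hd t).deriv, norm_smul, Real.norm_of_nonneg this]
      simp only [hg, Function.comp]
      ring
    simp only [h2, h1, σ, Real.smoothTransition.zero, Real.smoothTransition.one]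

lemma deriv_eq_zero_of_eqOn_Iic {γ : ℝ → E} {x : E} {a s : ℝ} (h : ∀ t ≤ a, γ t = x)
    (hd : DifferentiableAt ℝ γ s) (hs : s ≤ a) : deriv γ s = 0 := by
  -- A one-sided derivative determines the derivative, so the endpoint `s = a` is covered as well.
  refine (uniqueDiffWithinAt_Iic s).eq_deriv _ hd.hasDerivAt.hasDerivWithinAt ?_
  exact (hasDerivWithinAt_const s _ x).congr (fun t ht => h t (le_trans ht hs)) (h s hs)

lemma deriv_eq_zero_of_eqOn_Ici {γ : ℝ → E} {x : E} {a s : ℝ} (h : ∀ t, a ≤ t → γ t = x)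
    (hd : DifferentiableAt ℝ γ s) (hs : a ≤ s) : deriv γ s = 0 := by
  refine (uniqueDiffWithinAt_Ici s).eq_deriv _ hd.hasDerivAt.hasDerivWithinAt ?_
  exact (hasDerivWithinAt_const s _ x).congr (fun t ht => h t (le_trans hs ht)) (h s hs)

/-- Paths must be `C¹`, so plain concatenation is not allowed. After reparametrisation both paths
extend to the line and are constant outside the unit interval. Then `γ₁(2t) + γ₂(2t - 1) - y` is
`C¹` and runs through `γ₁` while the other term rests at `y`, and afterwards through `γ₂`. -/
lemma ConfLength.trans (hc : Continuous c) {x y z : E} {ℓ₁ ℓ₂ : ℝ} (h₁ : ConfLength c x y ℓ₁)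
    (h₂ : ConfLength c y z ℓ₂) : ConfLength c x z (ℓ₁ + ℓ₂) := by
  obtain ⟨γ₁, hs₁, hx₁, hy₁, rfl⟩ := h₁.exists_contDiff hc
  obtain ⟨γ₂, hs₂, hx₂, hy₂, rfl⟩ := h₂.exists_contDiff hc
  have hd₁ : ∀ t, HasDerivAt (fun t => γ₁ (2 * t)) ((2 : ℝ) • deriv γ₁ (2 * t)) t := fun t => by
    have h := (hs₁.differentiable (by simp) (2 * t)).hasDerivAt
    simpa [Function.comp_def] using h.scomp t ((hasDerivAt_id t).const_mul 2)
  have hd₂ : ∀ t, HasDerivAt (fun t => γ₂ (2 * t - 1)) ((2 : ℝ) • deriv γ₂ (2 * t - 1)) t :=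
    fun t => by
      have h := (hs₂.differentiable (by simp) (2 * t - 1)).hasDerivAt
      simpa [Function.comp_def] using h.scomp t (((hasDerivAt_id t).const_mul 2).sub_const 1)
  have hc₁ : Continuous (deriv γ₁) := hs₁.continuous_deriv (by simp)
  have hc₂ : Continuous (deriv γ₂) := hs₂.continuous_deriv (by simp)
  have h := ConfLength.of_hasDerivAt (c := c)
    (γ := fun t => γ₁ (2 * t) + γ₂ (2 * t - 1) - y)
    (γ' := fun t => (2 : ℝ) • deriv γ₁ (2 * t) + (2 : ℝ) • deriv γ₂ (2 * t - 1))
    (fun t => ((hd₁ t).add (hd₂ t)).sub_const y) (by fun_prop)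
  have e0 : γ₁ (2 * 0) + γ₂ (2 * 0 - 1) - y = x := by
    rw [hx₁ _ (by norm_num), hx₂ _ (by norm_num)]; simp
  have e1 : γ₁ (2 * 1) + γ₂ (2 * 1 - 1) - y = z := by
    rw [hy₁ _ (by norm_num), hy₂ _ (by norm_num)]; simp
  simp only [e0, e1] at h
  convert h using 1
  have hint : ∀ a b, IntervalIntegrable (fun t => c (γ₁ (2 * t) + γ₂ (2 * t - 1) - y) *
      ‖(2 : ℝ) • deriv γ₁ (2 * t) + (2 : ℝ) • deriv γ₂ (2 * t - 1)‖) volume a b := fun a b => by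
    have := hs₁.continuous
    have := hs₂.continuous
    exact Continuous.intervalIntegrable (by fun_prop) _ _
  rw [← intervalIntegral.integral_add_adjacent_intervals (hint 0 (1 / 2)) (hint (1 / 2) 1)]
  congr 1
  · have h1 := intervalIntegral.smul_integral_comp_mul_left (a := 0) (b := 1 / 2)
      (fun t => c (γ₁ t) * ‖deriv γ₁ t‖) 2
    norm_num at h1
    rw [← h1, ← intervalIntegral.integral_const_mul]
    refine intervalIntegral.integral_congr fun t ht => ?_
    rw [Set.uIcc_of_le (by norm_num)] at ht
    have h2 : 2 * t - 1 ≤ 0 := by linarith [ht.2]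
    rw [hx₂ _ h2, deriv_eq_zero_of_eqOn_Iic hx₂ (hs₂.differentiable (by simp) _) h2, smul_zero,
      add_zero, add_sub_cancel_right, norm_smul, Real.norm_of_nonneg zero_le_two]
    ring
  · have h1 := intervalIntegral.smul_integral_comp_mul_sub (a := 1 / 2) (b := 1)
      (fun t => c (γ₂ t) * ‖deriv γ₂ t‖) 2 1
    norm_num at h1
    rw [← h1, ← intervalIntegral.integral_const_mul]
    refine intervalIntegral.integral_congr fun t ht => ?_
    rw [Set.uIcc_of_le (by norm_num)] at ht
    have h2 : 1 ≤ 2 * t := by linarith [ht.1]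
    rw [hy₁ _ h2, deriv_eq_zero_of_eqOn_Ici hy₁ (hs₁.differentiable (by simp) _) h2, smul_zero,
      zero_add, add_sub_cancel_left, norm_smul, Real.norm_of_nonneg zero_le_two]
    ring

lemma ConfLength.symm (hc : Continuous c) {x y : E} {ℓ : ℝ} (h : ConfLength c x y ℓ) :
    ConfLength c y x ℓ := by
  obtain ⟨γ, hs, hx, hy, rfl⟩ := h.exists_contDiff hc
  have hd : ∀ t, HasDerivAt (fun t => γ (1 - t)) (-deriv γ (1 - t)) t := fun t => by
    have h := (hs.differentiable (by simp) (1 - t)).hasDerivAt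
    simpa [Function.comp_def] using h.scomp t ((hasDerivAt_id t).const_sub 1)
  have hc₁ : Continuous (deriv γ) := hs.continuous_deriv (by simp)
  have h := ConfLength.of_hasDerivAt (c := c) hd (by fun_prop)
  simp only [norm_neg] at h
  rw [intervalIntegral.integral_comp_sub_left (fun t => c (γ t) * ‖deriv γ t‖) 1] at h
  norm_num at h
  rwa [hx 0 le_rfl, hy 1 le_rfl] at h

lemma ConfLength.self (x : E) : ConfLength c x x 0 := by
  have := ConfLength.of_hasDerivAt (c := c) (fun t => hasDerivAt_const t x) continuous_const
  simpa using this

/-- A map with `‖dG‖ ≤ c` is 1-Lipschitz for the metric `c² δ`. The lower bounds on distances come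
from this, with `G` the identity or a smoothed radius. -/
lemma ConfLength.norm_sub_le [CompleteSpace E] {F : Type*} [NormedAddCommGroup F]
    [NormedSpace ℝ F] [CompleteSpace F] (hc : Continuous c) {x y : E} {ℓ : ℝ}
    (h : ConfLength c x y ℓ) {G : E → F} (hG : ContDiff ℝ 1 G) (hb : ∀ z, ‖fderiv ℝ G z‖ ≤ c z) :
    ‖G y - G x‖ ≤ ℓ := by
  obtain ⟨γ, hs, hx, hy, rfl⟩ := h.exists_contDiff hc
  have hd : ∀ t, HasDerivAt (fun t => G (γ t)) (fderiv ℝ G (γ t) (deriv γ t)) t := fun t =>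
    (hG.differentiable (by simp) _).hasFDerivAt.comp_hasDerivAt t
      (hs.differentiable (by simp) t).hasDerivAt
  have hc₁ : Continuous (deriv γ) := hs.continuous_deriv (by simp)
  have hc₂ : Continuous (fderiv ℝ G) := hG.continuous_fderiv (by simp)
  have hc₃ := hs.continuous
  have h1 := intervalIntegral.integral_eq_sub_of_hasDerivAt (a := 0) (b := 1)
    (fun t _ => hd t) (Continuous.intervalIntegrable (by fun_prop) _ _)
  rw [hx 0 le_rfl, hy 1 le_rfl] at h1
  rw [← h1]
  refine intervalIntegral.norm_integral_le_of_norm_le zero_le_one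
    (ae_of_all _ fun t _ => ?_) (Continuous.intervalIntegrable (by fun_prop) _ _)
  exact (ContinuousLinearMap.le_opNorm _ _).trans
    (mul_le_mul_of_nonneg_right (hb _) (norm_nonneg _))

lemma confLength_segment (x y : E) :
    ConfLength c x y (∫ t in (0 : ℝ)..1, c (x + t • (y - x)) * ‖y - x‖) := by
  have h := ConfLength.of_hasDerivAt (c := c) (γ := fun t : ℝ => x + t • (y - x))
    (γ' := fun _ => y - x) (fun t => by
      simpa using ((hasDerivAt_id t).smul_const (y - x)).const_add x) continuous_const
  simpa using h

lemma le_confDist {x y : E} {a : ℝ} (h : ∀ ℓ, ConfLength c x y ℓ → a ≤ ℓ) :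
    a ≤ confDist c x y :=
  le_csInf ⟨_, confLength_segment x y⟩ h

lemma confDist_comm (hc : Continuous c) (x y : E) : confDist c x y = confDist c y x := by
  have : {ℓ | ConfLength c x y ℓ} = {ℓ | ConfLength c y x ℓ} :=
    Set.ext fun ℓ => ⟨fun h => h.symm hc, fun h => h.symm hc⟩
  rw [confDist, this, confDist]

variable [CompleteSpace E]

lemma ConfLength.norm_le (hc : Continuous c) (h1 : ∀ z, 1 ≤ c z) {x y : E} {ℓ : ℝ}
    (h : ConfLength c x y ℓ) : ‖x - y‖ ≤ ℓ := by
  rw [norm_sub_rev]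
  refine h.norm_sub_le hc (G := id) contDiff_id fun z => ?_
  rw [fderiv_id]
  exact ContinuousLinearMap.norm_id_le.trans (h1 z)

lemma confDist_le (hc : Continuous c) (h1 : ∀ z, 1 ≤ c z) {x y : E} {ℓ : ℝ}
    (h : ConfLength c x y ℓ) : confDist c x y ≤ ℓ :=
  csInf_le ⟨0, fun _ hl => (norm_nonneg _).trans (hl.norm_le hc h1)⟩ h

lemma confDist_self (hc : Continuous c) (h1 : ∀ z, 1 ≤ c z) (x : E) : confDist c x x = 0 :=
  le_antisymm (confDist_le hc h1 (.self x))
    (le_confDist fun _ h => (norm_nonneg _).trans (h.norm_le hc h1))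

lemma confDist_triangle (hc : Continuous c) (h1 : ∀ z, 1 ≤ c z) (x y z : E) :
    confDist c x z ≤ confDist c x y + confDist c y z := by
  have h2 : confDist c x z - confDist c x y ≤ confDist c y z := by
    refine le_confDist fun ℓ₂ hl₂ => ?_
    have : confDist c x z - ℓ₂ ≤ confDist c x y := by
      refine le_confDist fun ℓ₁ hl₁ => ?_
      linarith [confDist_le hc h1 (hl₁.trans hc hl₂)]
    linarith
  linarith

lemma norm_sub_le_confDist (hc : Continuous c) (h1 : ∀ z, 1 ≤ c z) (x y : E) :
    ‖x - y‖ ≤ confDist c x y :=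
  le_confDist fun _ h => h.norm_le hc h1

lemma confDist_le_mul_norm (hc : Continuous c) (h1 : ∀ z, 1 ≤ c z) {x y : E} {C : ℝ}
    (hC : ∀ t ∈ Set.Icc (0 : ℝ) 1, c (x + t • (y - x)) ≤ C) :
    confDist c x y ≤ C * ‖x - y‖ := by
  refine (confDist_le hc h1 (confLength_segment x y)).trans ?_
  rw [norm_sub_rev x y]
  have h2 : ∫ t in (0 : ℝ)..1, C * ‖y - x‖ = C * ‖y - x‖ := by simp
  rw [← h2]
  refine intervalIntegral.integral_mono_on zero_le_one
    (Continuous.intervalIntegrable (by fun_prop) _ _)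
    (Continuous.intervalIntegrable (by fun_prop) _ _) fun t ht => ?_
  exact mul_le_mul_of_nonneg_right (hC t ht) (norm_nonneg _)

/-- The distance of the metric `c² δ` as a metric space structure. -/
noncomputable abbrev confMetricSpace (hc : Continuous c) (h1 : ∀ z, 1 ≤ c z) : MetricSpace E where
  dist := confDist c
  dist_self := confDist_self hc h1
  dist_comm := confDist_comm hc
  dist_triangle := confDist_triangle hc h1
  eq_of_dist_eq_zero {x y} h := by
    have := norm_sub_le_confDist hc h1 x y
    rw [h] at this
    exact sub_eq_zero.1 (norm_le_zero_iff.1 this)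

end ConfDist

/-! ### Distances for radial conformal factors -/

section RadialDist

variable {E : Type*} [NormedAddCommGroup E] [InnerProductSpace ℝ E] {φ : ℝ → ℝ}

/-- A great circle arc from `x` to `y`, of angle `arccos (⟨x, y⟩/|x|²)`. The hypothesis `hE`
provides a direction when `x = 0` or `y = ±x`, where the two points do not span a plane. -/
lemma exists_arc (hE : ∀ x : E, ∃ e : E, ‖e‖ = 1 ∧ inner ℝ x e = 0) {x y : E}
    (hxy : ‖x‖ = ‖y‖) : ∃ (e : E) (θ : ℝ), 0 ≤ θ ∧ θ ≤ Real.pi ∧ ‖e‖ = 1 ∧ inner ℝ x e = 0 ∧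
      y = Real.cos θ • x + (‖x‖ * Real.sin θ) • e := by
  rcases eq_or_ne x 0 with rfl | hx
  · obtain ⟨e, he, h0⟩ := hE 0
    refine ⟨e, 0, le_rfl, Real.pi_pos.le, he, h0, ?_⟩
    rw [norm_zero, eq_comm, norm_eq_zero] at hxy
    simp [hxy]
  have hx' : 0 < ‖x‖ := norm_pos_iff.2 hx
  set a := inner ℝ x y / ‖x‖ ^ 2 with ha
  have hin : inner ℝ x y = a * ‖x‖ ^ 2 := by rw [ha]; field_simp
  set z := y - a • x with hz
  have hxz : inner ℝ x z = 0 := by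
    rw [hz, inner_sub_right, inner_smul_right, real_inner_self_eq_norm_sq, hin]; ring
  have hzn : ‖z‖ ^ 2 = ‖x‖ ^ 2 * (1 - a ^ 2) := by
    rw [hz, norm_sub_sq_real, inner_smul_right, real_inner_comm, hin, norm_smul, ← hxy, mul_pow,
      Real.norm_eq_abs, sq_abs]
    ring
  have ha1 : a ^ 2 ≤ 1 := by
    by_contra! h
    nlinarith [sq_nonneg ‖z‖, mul_pos (pow_pos hx' 2) (sub_pos.2 h)]
  have ha2 := abs_le.1 ((sq_le_one_iff_abs_le_one a).1 ha1)
  have hs : ‖x‖ * Real.sin (Real.arccos a) = ‖z‖ := by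
    rw [Real.sin_arccos, ← Real.sqrt_sq (norm_nonneg z), hzn, Real.sqrt_mul (by positivity),
      Real.sqrt_sq hx'.le]
  have hy : y = a • x + z := by rw [hz]; abel
  rcases eq_or_ne z 0 with h0 | h0
  · obtain ⟨e, he, h1⟩ := hE x
    refine ⟨e, Real.arccos a, Real.arccos_nonneg a, Real.arccos_le_pi a, he, h1, ?_⟩
    rw [hs, h0, norm_zero, zero_smul, Real.cos_arccos ha2.1 ha2.2, add_zero, ← add_zero (a • x),
      ← h0]
    exact hy
  · refine ⟨‖z‖⁻¹ • z, Real.arccos a, Real.arccos_nonneg a, Real.arccos_le_pi a,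
      norm_smul_inv_norm h0, by rw [inner_smul_right, hxz, mul_zero], ?_⟩
    rw [hs, Real.cos_arccos ha2.1 ha2.2, smul_smul, mul_inv_cancel₀ (norm_ne_zero_iff.2 h0),
      one_smul]
    exact hy

variable [CompleteSpace E]

lemma confDist_ray_le (hφ : Continuous φ) (hφ1 : ∀ r, 1 ≤ φ r)
    {e : E} (he : ‖e‖ = 1) {r₁ r₂ : ℝ} (h1 : 0 ≤ r₁) (h2 : r₁ ≤ r₂) :
    confDist (fun z : E => φ ‖z‖) (r₁ • e) (r₂ • e) ≤ ∫ r in r₁..r₂, φ r := by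
  refine (confDist_le (hφ.comp continuous_norm) (fun z => hφ1 _)
    (confLength_segment _ _)).trans_eq ?_
  have h3 : ∀ t ∈ Set.uIcc (0 : ℝ) 1,
      φ ‖r₁ • e + t • (r₂ • e - r₁ • e)‖ * ‖r₂ • e - r₁ • e‖ =
        (r₂ - r₁) * φ ((r₂ - r₁) * t + r₁) := by
    intro t ht
    rw [Set.uIcc_of_le zero_le_one] at ht
    have h0 : 0 ≤ (r₂ - r₁) * t + r₁ := by nlinarith [ht.1]
    rw [← sub_smul, smul_smul, ← add_smul, norm_smul, norm_smul, he, mul_one, mul_one,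
      Real.norm_of_nonneg (by linarith : 0 ≤ r₂ - r₁), Real.norm_of_nonneg (by linarith)]
    rw [mul_comm]; ring_nf
  refine (intervalIntegral.integral_congr h3).trans ?_
  rw [intervalIntegral.integral_const_mul]
  simp

/-- The conformal factor is constant along a great circle arc, and the angle is at most `π`. -/
lemma confDist_arc_le (hφ : Continuous φ) (hφ1 : ∀ r, 1 ≤ φ r)
    (hE : ∀ x : E, ∃ e : E, ‖e‖ = 1 ∧ inner ℝ x e = 0) {x y : E}
    (hxy : ‖x‖ = ‖y‖) :
    confDist (fun z : E => φ ‖z‖) x y ≤ Real.pi * (‖x‖ * φ ‖x‖) := by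
  obtain ⟨e, θ, hθ0, hθ, he, hxe, hy⟩ := exists_arc hE hxy
  have hn : ∀ a b : ℝ, ‖a • x + (‖x‖ * b) • e‖ = ‖x‖ * √(a ^ 2 + b ^ 2) := by
    intro a b
    rw [← Real.sqrt_sq (norm_nonneg (_ + _)), norm_add_sq_real, norm_smul, norm_smul, he,
      inner_smul_left, inner_smul_right, hxe]
    simp only [Real.norm_eq_abs, mul_zero, add_zero, mul_one, mul_pow, sq_abs]
    rw [show a ^ 2 * ‖x‖ ^ 2 + ‖x‖ ^ 2 * b ^ 2 = ‖x‖ ^ 2 * (a ^ 2 + b ^ 2) by ring,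
      Real.sqrt_mul (by positivity), Real.sqrt_sq (norm_nonneg x)]
  have hd : ∀ t : ℝ, HasDerivAt
      (fun t : ℝ => Real.cos (θ * t) • x + (‖x‖ * Real.sin (θ * t)) • e)
      ((-Real.sin (θ * t) * θ) • x + (‖x‖ * (Real.cos (θ * t) * θ)) • e) t := by
    intro t
    have h1 : HasDerivAt (fun t : ℝ => θ * t) θ t := by
      simpa using (hasDerivAt_id t).const_mul θ
    exact (h1.cos.smul_const x).add ((h1.sin.const_mul ‖x‖).smul_const e)
  have h := ConfLength.of_hasDerivAt (c := fun z : E => φ ‖z‖) hd (by fun_prop)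
  have h3 : ∀ t : ℝ, √((-Real.sin (θ * t) * θ) ^ 2 + (Real.cos (θ * t) * θ) ^ 2) = θ := by
    intro t
    rw [← Real.sqrt_sq hθ0]
    congr 1
    rw [Real.sqrt_sq hθ0]
    nlinarith [Real.sin_sq_add_cos_sq (θ * t)]
  simp only [hn, h3, Real.cos_sq_add_sin_sq, Real.sqrt_one, mul_one, mul_zero, Real.cos_zero,
    Real.sin_zero, one_smul, zero_smul, add_zero, ← hy] at h
  refine (confDist_le (hφ.comp continuous_norm) (fun z => hφ1 _) h).trans ?_
  simp only [intervalIntegral.integral_const, sub_zero, one_smul]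
  have : 0 ≤ ‖x‖ * φ ‖x‖ := mul_nonneg (norm_nonneg _) (zero_le_one.trans (hφ1 _))
  nlinarith

/-- The radius is a `1`-Lipschitz function. -/
lemma integral_le_confDist (hφ : Continuous φ) (hφ1 : ∀ r, 1 ≤ φ r)
    (hanti : AntitoneOn φ (Set.Ici 0)) (x y : E) :
    ∫ r in ‖y‖..‖x‖, φ r ≤ confDist (fun z : E => φ ‖z‖) x y := by
  set S : ℝ → ℝ := fun r => ∫ u in (0 : ℝ)..r, φ u with hS
  have hSd : ∀ r, HasDerivAt S (φ r) r := fun r =>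
    (hφ.integral_hasStrictDerivAt 0 r).hasDerivAt
  have hSc : ContDiff ℝ 1 S := contDiff_one_iff_deriv.2
    ⟨fun r => (hSd r).differentiableAt, by rwa [funext fun r => (hSd r).deriv]⟩
  -- The function `S(|z|)` need not be differentiable at the origin, so `|z|` is replaced by `√(|z|²
  -- + δ)`, and `δ → 0` at the end. The gradient bound survives because `φ` is decreasing and
  -- `√(|z|² + δ) ≥ |z|`.
  have hδ : ∀ δ : ℝ, 0 < δ →
      S (√(‖x‖ ^ 2 + δ)) - S (√(‖y‖ ^ 2 + δ)) ≤ confDist (fun z : E => φ ‖z‖) x y := by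
    intro δ hδ
    have hG : ContDiff ℝ 1 fun z : E => S (√(‖z‖ ^ 2 + δ)) :=
      hSc.comp (((contDiff_norm_sq ℝ).add contDiff_const).sqrt fun z => by positivity)
    refine le_confDist fun ℓ hl => ?_
    refine (le_abs_self _).trans ((hl.symm (hφ.comp continuous_norm)).norm_sub_le
      (hφ.comp continuous_norm) hG fun z => ?_)
    have hpos : 0 < ‖z‖ ^ 2 + δ := by positivity
    have h2 := ((hSd (√(‖z‖ ^ 2 + δ))).comp _ (Real.hasDerivAt_sqrt hpos.ne')).comp_hasFDerivAt z
      ((hasStrictFDerivAt_norm_sq z).hasFDerivAt.add_const δ)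
    have h3 : fderiv ℝ (fun z : E => S (√(‖z‖ ^ 2 + δ))) z = _ := h2.fderiv
    have hz : ‖z‖ ≤ √(‖z‖ ^ 2 + δ) := Real.le_sqrt_of_sq_le (by linarith)
    have hφz : φ (√(‖z‖ ^ 2 + δ)) ≤ φ ‖z‖ :=
      hanti (norm_nonneg z) (Real.sqrt_nonneg _) hz
    have hφp : 0 < φ (√(‖z‖ ^ 2 + δ)) := zero_lt_one.trans_le (hφ1 _)
    have hsp : 0 < √(‖z‖ ^ 2 + δ) := Real.sqrt_pos.2 hpos
    rw [h3, norm_smul, ← Nat.cast_smul_eq_nsmul ℝ, norm_smul, innerSL_apply_norm,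
      Real.norm_of_nonneg (by positivity)]
    simp only [Nat.cast_ofNat, Real.norm_ofNat]
    calc φ (√(‖z‖ ^ 2 + δ)) * (1 / (2 * √(‖z‖ ^ 2 + δ))) * (2 * ‖z‖)
        = φ (√(‖z‖ ^ 2 + δ)) * (‖z‖ / √(‖z‖ ^ 2 + δ)) := by field_simp
      _ ≤ φ (√(‖z‖ ^ 2 + δ)) * 1 :=
        mul_le_mul_of_nonneg_left ((div_le_one hsp).2 hz) hφp.le
      _ ≤ φ ‖z‖ := by rwa [mul_one]
  have hcont : ∀ z : E, Continuous fun δ : ℝ => S (√(‖z‖ ^ 2 + δ)) := fun z =>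
    hSc.continuous.comp (Real.continuous_sqrt.comp (continuous_const.add continuous_id))
  have hlim : Tendsto (fun δ : ℝ => S (√(‖x‖ ^ 2 + δ)) - S (√(‖y‖ ^ 2 + δ))) (𝓝[>] 0)
      (𝓝 (S ‖x‖ - S ‖y‖)) := by
    have := (((hcont x).sub (hcont y)).tendsto 0).mono_left
      (nhdsWithin_le_nhds (s := Set.Ioi 0))
    simpa [Pi.sub_def] using this
  have h4 : S ‖x‖ - S ‖y‖ = ∫ r in ‖y‖..‖x‖, φ r :=
    intervalIntegral.integral_interval_sub_left (hφ.intervalIntegrable _ _)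
      (hφ.intervalIntegrable _ _)
  rw [← h4]
  exact le_of_tendsto hlim (eventually_mem_nhdsWithin.mono fun δ h => hδ δ h)

/-- Move along the ray from `x` inwards to the sphere through `y`, then along a great circle arc of
that sphere. -/
lemma confDist_le_integral_add (hφ : Continuous φ) (hφ1 : ∀ r, 1 ≤ φ r)
    (hE : ∀ x : E, ∃ e : E, ‖e‖ = 1 ∧ inner ℝ x e = 0) {x y : E}
    (hxy : ‖y‖ ≤ ‖x‖) : confDist (fun z : E => φ ‖z‖) x y ≤
      (∫ r in ‖y‖..‖x‖, φ r) + Real.pi * (‖y‖ * φ ‖y‖) := by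
  have hc : Continuous fun z : E => φ ‖z‖ := hφ.comp continuous_norm
  obtain ⟨e, he, hx⟩ : ∃ e : E, ‖e‖ = 1 ∧ ‖x‖ • e = x := by
    rcases eq_or_ne x 0 with rfl | h
    · obtain ⟨e, he, -⟩ := hE 0
      exact ⟨e, he, by simp⟩
    · exact ⟨‖x‖⁻¹ • x, norm_smul_inv_norm h, by
        rw [smul_smul, mul_inv_cancel₀ (norm_ne_zero_iff.2 h), one_smul]⟩
  have hn : ‖‖y‖ • e‖ = ‖y‖ := by rw [norm_smul, he, mul_one, norm_norm]
  have h1 := confDist_ray_le hφ hφ1 he (norm_nonneg y) hxy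
  have h2 := confDist_arc_le hφ hφ1 hE hn
  rw [hx, confDist_comm hc] at h1
  rw [hn] at h2
  exact (confDist_triangle hc (fun z => hφ1 _) _ (‖y‖ • e) _).trans (add_le_add h1 h2)

end RadialDist

/-! ### Gromov-Hausdorff distance -/

section GromovHausdorff

/-- The common space is the disjoint union with `x ∈ A` placed at distance `ε` from `F x`.
Distortion at most `2ε` is what the triangle inequality requires for this. A point of `B` lies
within `ε` of some `F x`, hence within `2ε` of `x`. -/
lemma pointedGHDist_le {X Y : Type} [MetricSpace X] [MetricSpace Y] {A : Set X} {B : Set Y}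
    {p : X} {q : Y} {F : X → Y} {ε : ℝ} (hε : 0 < ε) (hp : p ∈ A)
    (hF : ∀ x ∈ A, ∀ x' ∈ A, |dist x x' - dist (F x) (F x')| ≤ 2 * ε) (hAB : ∀ x ∈ A, F x ∈ B)
    (hBA : ∀ y ∈ B, ∃ x ∈ A, dist (F x) y ≤ ε) (hpq : dist (F p) q ≤ ε) :
    pointedGHDist dist A p dist B q ≤ ENNReal.ofReal (2 * ε) := by
  have : Nonempty A := ⟨⟨p, hp⟩⟩
  let Φ : A → X := Subtype.val
  let Ψ : A → Y := fun x => F x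
  let Z : MetricSpace (X ⊕ Y) := Metric.glueMetricApprox Φ Ψ ε hε
    fun x x' => hF x x.2 x' x'.2
  have hd : ∀ x ∈ A, ∀ y, dist (F x) y ≤ ε →
      edist (Sum.inl x : X ⊕ Y) (Sum.inr y) ≤ ENNReal.ofReal (2 * ε) := by
    intro x hx y hy
    have h1 : dist (Sum.inl x : X ⊕ Y) (Sum.inr (F x)) = ε :=
      Metric.glueDist_glued_points Φ Ψ ε ⟨x, hx⟩
    have h2 : dist (Sum.inr (F x) : X ⊕ Y) (Sum.inr y) = dist (F x) y := rfl
    rw [edist_dist]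
    refine ENNReal.ofReal_le_ofReal ((dist_triangle _ (Sum.inr (F x)) _).trans ?_)
    rw [h1, h2]; linarith
  rw [pointedGHDist]
  refine sInf_le_of_le (b := max (Metric.hausdorffEDist (Sum.inl '' A : Set (X ⊕ Y)) (Sum.inr '' B))
    (edist (Sum.inl p : X ⊕ Y) (Sum.inr q))) ⟨X ⊕ Y, Z, Sum.inl, Sum.inr, fun x _ x' _ => rfl,
    fun y _ y' _ => rfl, rfl⟩ (max_le ?_ (hd p hp q hpq))
  refine Metric.hausdorffEDist_le_of_mem_edist ?_ ?_
  · rintro _ ⟨x, hx, rfl⟩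
    exact ⟨Sum.inr (F x), Set.mem_image_of_mem _ (hAB x hx), hd x hx _ (by simp [hε.le])⟩
  · rintro _ ⟨y, hy, rfl⟩
    obtain ⟨x, hx, hxy⟩ := hBA y hy
    refine ⟨Sum.inl x, Set.mem_image_of_mem _ hx, ?_⟩
    rw [edist_comm]
    exact hd x hx y hxy

/-! ### Almost isometries from small Gromov-Hausdorff distance, and the tripod -/

variable {X Y : Type} {dX : X → X → ℝ} {A : Set X} {dY : Y → Y → ℝ} {B : Set Y} {r : ℝ}

lemma exists_almost_isometry {Z : Type} [MetricSpace Z] {φ : X → Z} {ψ : Y → Z}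
    (hφ : ∀ x ∈ A, ∀ x' ∈ A, dist (φ x) (φ x') = dX x x')
    (hψ : ∀ y ∈ B, ∀ y' ∈ B, dist (ψ y) (ψ y') = dY y y')
    (h : Metric.hausdorffEDist (φ '' A) (ψ '' B) < ENNReal.ofReal r) :
    ∃ f : A → Y, ∀ x, f x ∈ B ∧ ∀ x' : A, |dX x x' - dY (f x) (f x')| ≤ 2 * r := by
  have h1 : ∀ x : A, ∃ y ∈ B, dist (φ x) (ψ y) < r := by
    intro x
    obtain ⟨_, ⟨y, hy, rfl⟩, hxy⟩ :=
      Metric.exists_edist_lt_of_hausdorffEDist_lt (Set.mem_image_of_mem φ x.2) h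
    rw [edist_dist] at hxy
    exact ⟨y, hy, (ENNReal.ofReal_lt_ofReal_iff_of_nonneg dist_nonneg).1 hxy⟩
  choose f hf hfr using h1
  refine ⟨f, fun x => ⟨hf x, fun x' => ?_⟩⟩
  rw [← hφ x x.2 x' x'.2, ← hψ _ (hf x) _ (hf x'), ← Real.dist_eq]
  refine (dist_dist_dist_le _ _ _ _).trans ?_
  linarith [hfr x, hfr x']

lemma exists_almost_isometry_of_ghDist_lt (h : ghDist dX A dY B < ENNReal.ofReal r) :
    ∃ f : A → Y, ∀ x, f x ∈ B ∧ ∀ x' : A, |dX x x' - dY (f x) (f x')| ≤ 2 * r := by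
  obtain ⟨_, ⟨Z, _, φ, ψ, hφ, hψ, rfl⟩, hr⟩ := sInf_lt_iff.1 h
  exact exists_almost_isometry hφ hψ hr

/-- The map goes from the second space to the first, that is from the limit space into the manifold.
-/
lemma exists_almost_isometry_of_pointedGHDist_lt {p : X} {q : Y}
    (h : pointedGHDist dX A p dY B q < ENNReal.ofReal r) :
    ∃ f : B → X, ∀ y, f y ∈ A ∧ ∀ y' : B, |dY y y' - dX (f y) (f y')| ≤ 2 * r := by
  obtain ⟨_, ⟨Z, _, φ, ψ, hφ, hψ, rfl⟩, hr⟩ := sInf_lt_iff.1 h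
  refine exists_almost_isometry hψ hφ ?_
  rw [Metric.hausdorffEDist_comm]
  exact (le_max_left _ _).trans_lt hr

/-- A tripod does not embed almost isometrically into an inner product space. -/
lemma no_tripod {E : Type*} [NormedAddCommGroup E] [InnerProductSpace ℝ E] {a b o p : E} {e : ℝ}
    (he0 : 0 ≤ e) (he : e ≤ 1 / 100) (hab : 2 - e ≤ dist a b) (hao : dist a o ≤ 1 + e)
    (hbo : dist b o ≤ 1 + e) (hpo : dist p o ≤ 1 + e) (hap : 2 - e ≤ dist a p)
    (hbp : 2 - e ≤ dist b p) : False := by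
  rw [dist_eq_norm] at hab hao hbo hpo hap hbp
  set x := a - o
  set y := b - o
  set z := p - o
  have e1 : a - b = x - y := by simp only [x, y]; abel
  have e2 : a - p = x - z := by simp only [x, z]; abel
  have e3 : b - p = y - z := by simp only [y, z]; abel
  rw [e1] at hab
  rw [e2] at hap
  rw [e3] at hbp
  -- Since `o` is almost a midpoint of `a` and `b`, the parallelogram law makes `x + y` small. The
  -- distances of `p` from `a` and `b` force both `⟨x, z⟩` and `⟨y, z⟩` to be close to `-1`, so `⟨x
  -- + y, z⟩` cannot be small.
  have h1 := parallelogram_law_with_norm ℝ x y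
  have h2 := norm_sub_sq_real x z
  have h3 := norm_sub_sq_real y z
  have h4 : |inner ℝ (x + y) z| ≤ ‖x + y‖ * ‖z‖ := abs_real_inner_le_norm _ _
  rw [inner_add_left] at h4
  have h5 := (abs_le.1 h4).1
  have hx := norm_nonneg x
  have hy := norm_nonneg y
  have hz := norm_nonneg z
  have hx2 : ‖x‖ ^ 2 ≤ 1.03 := by nlinarith
  have hy2 : ‖y‖ ^ 2 ≤ 1.03 := by nlinarith
  have hz2 : ‖z‖ ^ 2 ≤ 1.03 := by nlinarith
  have hab2 : 3.96 ≤ ‖x - y‖ ^ 2 := by nlinarith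
  have hap2 : 3.96 ≤ ‖x - z‖ ^ 2 := by nlinarith
  have hbp2 : 3.96 ≤ ‖y - z‖ ^ 2 := by nlinarith
  have hs : ‖x + y‖ ^ 2 ≤ 0.16 := by nlinarith
  have hs1 : ‖x + y‖ ≤ 0.4 := abs_le_of_sq_le_sq' (by linarith) (by norm_num) |>.2
  nlinarith [mul_le_mul hs1 (hpo.trans (by linarith : 1 + e ≤ 1.1)) hz (by norm_num)]

end GromovHausdorff

/-! ### The conformal factor of a Euclidean space with a long thin neck -/

section Neck

/-- The function `(ρ + b)^{n/4}` of `ρ = |x|²`. -/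
noncomputable def neckBase (n : ℕ) (b ρ : ℝ) : ℝ := (ρ + b) ^ ((n : ℝ) / 4)

/-- The function `κ` of `ρ = |x|²` such that the metric is `e^{2κ} δ`, that is `u^{4/n} δ` with
`u = 1 + k² / (V (V + k))` and `V = (ρ + b)^{n/4}`. -/
noncomputable def neckExponent (n : ℕ) (k b ρ : ℝ) : ℝ :=
  2 / n * Real.log (1 + k ^ 2 / (neckBase n b ρ * (neckBase n b ρ + k)))

/-- The logarithmic derivative of `u` with respect to `V`, with the opposite sign. -/
noncomputable def neckSlope (k v : ℝ) : ℝ :=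
  k ^ 2 * (2 * v + k) / ((v + k) * (v ^ 2 + k * v + k ^ 2))

/-- The derivative of `neckSlope`. -/
noncomputable def neckSlopeDeriv (k v : ℝ) : ℝ :=
  (k ^ 2 * 2 * ((v + k) * (v ^ 2 + k * v + k ^ 2)) - k ^ 2 * (2 * v + k) *
    ((v ^ 2 + k * v + k ^ 2) + (v + k) * (2 * v + k))) / ((v + k) * (v ^ 2 + k * v + k ^ 2)) ^ 2

variable {n : ℕ} {k b ρ v : ℝ}

lemma neckBase_pos (hb : 0 < b) (hρ : 0 ≤ ρ) : 0 < neckBase n b ρ :=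
  Real.rpow_pos_of_pos (by linarith) _

lemma hasDerivAt_neckBase (hb : 0 < b) (hρ : 0 ≤ ρ) :
    HasDerivAt (neckBase n b) ((n : ℝ) / 4 * neckBase n b ρ / (ρ + b)) ρ := by
  have h := ((hasDerivAt_id ρ).add_const b).rpow_const (p := (n : ℝ) / 4)
    (Or.inl (by simp only [id]; linarith))
  have h' : HasDerivAt (neckBase n b) _ ρ := h
  refine h'.congr_deriv ?_
  simp only [neckBase, id]
  rw [Real.rpow_sub_one (by linarith)]
  ring

lemma contDiffAt_neckBase (hb : 0 < b) (hρ : 0 ≤ ρ) : ContDiffAt ℝ ∞ (neckBase n b) ρ :=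
  (contDiffAt_id.add contDiffAt_const).rpow_const_of_ne (by simp only [id]; linarith)

lemma neckSlope_pos (hk : 0 < k) (hv : 0 < v) : 0 < neckSlope k v := by
  unfold neckSlope; positivity

/-- `neckSlope` equals `-d log u / d log V`, so the bound says that `u V` does not decrease in `V`.
Equality would be the exact cylinder `u = k/V`. -/
lemma neckSlope_le_one (hk : 0 < k) (hv : 0 < v) : neckSlope k v ≤ 1 := by
  rw [neckSlope, div_le_one (by positivity)]
  have : 0 ≤ v ^ 3 + 2 * k * v ^ 2 := by positivity
  nlinarith

lemma hasDerivAt_neckSlope (hk : 0 < k) (hv : 0 < v) :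
    HasDerivAt (neckSlope k) (neckSlopeDeriv k v) v := by
  have h1 : HasDerivAt (fun v : ℝ => k ^ 2 * (2 * v + k)) (k ^ 2 * 2) v := by
    simpa using (((hasDerivAt_id v).const_mul 2).add_const k).const_mul (k ^ 2)
  have h2 : HasDerivAt (fun v : ℝ => v + k) 1 v := (hasDerivAt_id v).add_const k
  have h3 : HasDerivAt (fun v : ℝ => v ^ 2 + k * v + k ^ 2) (2 * v + k) v := by
    simpa using (((hasDerivAt_id v).pow 2).add ((hasDerivAt_id v).const_mul k)).add_const (k ^ 2)
  have h := h1.div (h2.mul h3) (by simp only [Pi.mul_apply]; positivity)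
  refine h.congr_deriv ?_
  simp only [neckSlopeDeriv, Pi.mul_apply]
  ring

/-- In the variable `s = log V` this is `u_ss + 2 u_s ≤ 0`, the superharmonicity of `u` for `b = 0`.
The difference of the two sides is a fraction whose numerator has only nonnegative coefficients. -/
lemma neckSlope_ineq (hk : 0 < k) (hv : 0 < v) :
    -(v * neckSlopeDeriv k v) + neckSlope k v ^ 2 ≤ 2 * neckSlope k v := by
  have hD : 0 < (v + k) * (v ^ 2 + k * v + k ^ 2) := by positivity
  have h : 2 * neckSlope k v - (-(v * neckSlopeDeriv k v) + neckSlope k v ^ 2) =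
      k ^ 2 * (3 * v ^ 3 * k + 4 * v ^ 2 * k ^ 2 + 4 * v * k ^ 3 + k ^ 4) /
        ((v + k) * (v ^ 2 + k * v + k ^ 2)) ^ 2 := by
    rw [neckSlope, neckSlopeDeriv]
    field_simp
    ring
  have : 0 ≤ 2 * neckSlope k v - (-(v * neckSlopeDeriv k v) + neckSlope k v ^ 2) := by
    rw [h]; positivity
  linarith

/-- The derivative of `neckExponent`. -/
noncomputable def neckExponentDeriv (n : ℕ) (k b ρ : ℝ) : ℝ :=
  -(1 / 2) * neckSlope k (neckBase n b ρ) / (ρ + b)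

/-- The second derivative of `neckExponent`. -/
noncomputable def neckExponentDeriv₂ (n : ℕ) (k b ρ : ℝ) : ℝ :=
  1 / 2 * (neckSlope k (neckBase n b ρ) -
    (n : ℝ) / 4 * (neckBase n b ρ * neckSlopeDeriv k (neckBase n b ρ))) / (ρ + b) ^ 2

lemma hasDerivAt_neckExponent (hn : n ≠ 0) (hk : 0 < k) (hb : 0 < b) (hρ : 0 ≤ ρ) :
    HasDerivAt (neckExponent n k b) (neckExponentDeriv n k b ρ) ρ := by
  have hV := neckBase_pos (n := n) hb hρ
  have hd := hasDerivAt_neckBase (n := n) hb hρ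
  have h1 : HasDerivAt (fun ρ => neckBase n b ρ * (neckBase n b ρ + k)) _ ρ :=
    hd.mul (hd.add_const k)
  have hpos : 0 < 1 + k ^ 2 * (neckBase n b ρ * (neckBase n b ρ + k))⁻¹ := by positivity
  have hne : neckBase n b ρ * (neckBase n b ρ + k) ≠ 0 := (mul_pos hV (add_pos hV hk)).ne'
  have h2 := (((h1.fun_inv hne).const_mul (k ^ 2)).const_add 1).log hpos.ne'
  have h3 := h2.const_mul (2 / (n : ℝ))
  have hn' : (n : ℝ) ≠ 0 := by exact_mod_cast hn
  have hρb : ρ + b ≠ 0 := by positivity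
  have he : neckExponent n k b = fun ρ => 2 / (n : ℝ) * Real.log (1 + k ^ 2 *
      (neckBase n b ρ * (neckBase n b ρ + k))⁻¹) := by
    ext ρ; simp only [neckExponent, div_eq_mul_inv]
  rw [he]
  refine h3.congr_deriv ?_
  simp only [neckExponentDeriv, neckSlope]
  field_simp
  ring

lemma hasDerivAt_neckExponentDeriv (hk : 0 < k) (hb : 0 < b) (hρ : 0 ≤ ρ) :
    HasDerivAt (neckExponentDeriv n k b) (neckExponentDeriv₂ n k b ρ) ρ := by
  have hV := neckBase_pos (n := n) hb hρ
  have h1 := (hasDerivAt_neckSlope hk hV).comp ρ (hasDerivAt_neckBase hb hρ)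
  have hρb : ρ + b ≠ 0 := by positivity
  have h := (h1.const_mul (-(1 / 2))).div ((hasDerivAt_id ρ).add_const b) hρb
  refine h.congr_deriv ?_
  simp only [neckExponentDeriv₂, id, Function.comp]
  field_simp
  ring

lemma contDiffAt_neckExponent (hk : 0 < k) (hb : 0 < b) (hρ : 0 ≤ ρ) :
    ContDiffAt ℝ ∞ (neckExponent n k b) ρ := by
  have hV := neckBase_pos (n := n) hb hρ
  have hc := contDiffAt_neckBase (n := n) hb hρ
  have hpos : 0 < 1 + k ^ 2 / (neckBase n b ρ * (neckBase n b ρ + k)) := by positivity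
  exact contDiffAt_const.mul ((contDiffAt_const.add (contDiffAt_const.div
    (hc.mul (hc.add contDiffAt_const)) (by positivity))).log hpos.ne')

lemma neckExponent_superharmonic {m : ℕ} (hm : 2 ≤ m) (hk : 0 < k) (hb : 0 < b) (hρ : 0 ≤ ρ) :
    2 * ρ * neckExponentDeriv₂ (m - 2) k b ρ + m * neckExponentDeriv (m - 2) k b ρ +
      ((m : ℝ) - 2) * ρ * neckExponentDeriv (m - 2) k b ρ ^ 2 ≤ 0 := by
  have hV := neckBase_pos (n := m - 2) hb hρ
  have hθ := neckSlope_pos hk hV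
  have hT := neckSlope_ineq hk hV
  have hn : ((m - 2 : ℕ) : ℝ) = m - 2 := by push_cast [hm]; ring
  have hm' : (0 : ℝ) ≤ m - 2 := by rw [← hn]; positivity
  simp only [neckExponentDeriv₂, neckExponentDeriv]
  rw [hn]
  set V := neckBase (m - 2) b ρ
  set θ := neckSlope k V
  set T := V * neckSlopeDeriv k V
  have hρb : 0 < ρ + b := by linarith
  set σ := ρ / (ρ + b) with hσ
  have hσ0 : 0 ≤ σ := by positivity
  have hσ1 : σ ≤ 1 := by rw [hσ, div_le_one hρb]; linarith
  -- After multiplication by `ρ + b` the expression is affine in `σ ∈ [0, 1]`. At `σ = 0` it is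
  -- `-mθ/2`, and at `σ = 1` it is nonpositive by `neckSlope_ineq`.
  have key : 2 * ρ * (1 / 2 * (θ - ((m : ℝ) - 2) / 4 * T) / (ρ + b) ^ 2) +
      m * (-(1 / 2) * θ / (ρ + b)) + ((m : ℝ) - 2) * ρ * (-(1 / 2) * θ / (ρ + b)) ^ 2 =
      (σ * (θ + ((m : ℝ) - 2) / 4 * (-T + θ ^ 2)) - m / 2 * θ) / (ρ + b) := by
    rw [hσ]; field_simp; ring
  rw [key]
  refine div_nonpos_of_nonpos_of_nonneg ?_ hρb.le
  have h1 : θ + ((m : ℝ) - 2) / 4 * (-T + θ ^ 2) ≤ m / 2 * θ := by nlinarith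
  have h2 : 0 ≤ (m : ℝ) / 2 * θ := by positivity
  nlinarith [mul_le_mul_of_nonneg_left h1 hσ0]

/-- This is the derivative of the area radius with respect to arc length, `1 - θ ρ/(ρ + b)`. It is
positive because `θ ≤ 1` and `b > 0`. -/
lemma neckExponent_radial_pos (hk : 0 < k) (hb : 0 < b) (hρ : 0 ≤ ρ) :
    0 < 1 + 2 * ρ * neckExponentDeriv n k b ρ := by
  have hV := neckBase_pos (n := n) hb hρ
  have hθ := neckSlope_pos hk hV
  have hθ1 := neckSlope_le_one hk hV
  have hρb : 0 < ρ + b := by linarith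
  have : 1 + 2 * ρ * neckExponentDeriv n k b ρ =
      (b + ρ * (1 - neckSlope k (neckBase n b ρ))) / (ρ + b) := by
    rw [neckExponentDeriv]; field_simp; ring
  rw [this]
  exact div_pos (by nlinarith [mul_nonneg hρ (sub_nonneg.2 hθ1)]) hρb

lemma neckExponent_nonneg (hk : 0 < k) (hb : 0 < b) (hρ : 0 ≤ ρ) : 0 ≤ neckExponent n k b ρ := by
  have hV := neckBase_pos (n := n) hb hρ
  have : 0 ≤ k ^ 2 / (neckBase n b ρ * (neckBase n b ρ + k)) := by positivity
  exact mul_nonneg (by positivity) (Real.log_nonneg (by linarith))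

lemma neckExponent_le (hn : n ≠ 0) (hk : 0 < k) (hb : 0 < b) (hρ : 0 ≤ ρ) :
    neckExponent n k b ρ ≤ 2 * (k ^ 2 / neckBase n b ρ ^ 2) := by
  have hV := neckBase_pos (n := n) hb hρ
  have hn' : (1 : ℝ) ≤ n := by exact_mod_cast Nat.one_le_iff_ne_zero.2 hn
  have h1 : Real.log (1 + k ^ 2 / (neckBase n b ρ * (neckBase n b ρ + k))) ≤
      k ^ 2 / neckBase n b ρ ^ 2 := by
    refine (Real.log_le_sub_one_of_pos (by positivity)).trans ?_
    rw [add_sub_cancel_left]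
    exact div_le_div_of_nonneg_left (by positivity) (by positivity) (by nlinarith)
  have h2 : 2 / (n : ℝ) ≤ 2 := by rw [div_le_iff₀ (by linarith)]; linarith
  exact mul_le_mul h2 h1 (Real.log_nonneg (by
    have : 0 ≤ k ^ 2 / (neckBase n b ρ * (neckBase n b ρ + k)) := by positivity
    linarith)) zero_le_two

/-- The conformal factor as a function of the Euclidean radius. -/
noncomputable def neckFactor (n : ℕ) (k b r : ℝ) : ℝ := Real.exp (neckExponent n k b (r ^ 2))

lemma continuous_neckFactor (hk : 0 < k) (hb : 0 < b) : Continuous (neckFactor n k b) := by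
  refine Real.continuous_exp.comp (continuous_iff_continuousAt.2 fun r => ?_)
  exact ContinuousAt.comp (f := fun r : ℝ => r ^ 2)
    (contDiffAt_neckExponent hk hb (sq_nonneg r)).continuousAt (by fun_prop)

lemma one_le_neckFactor (hk : 0 < k) (hb : 0 < b) (r : ℝ) : 1 ≤ neckFactor n k b r :=
  Real.one_le_exp (neckExponent_nonneg hk hb (sq_nonneg r))

lemma hasDerivAt_neckFactor (hn : n ≠ 0) (hk : 0 < k) (hb : 0 < b) (r : ℝ) :
    HasDerivAt (neckFactor n k b)
      (neckFactor n k b r * (2 * r * neckExponentDeriv n k b (r ^ 2))) r := by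
  have h : HasDerivAt (neckFactor n k b) _ r := (HasDerivAt.comp (h := fun r : ℝ => r ^ 2) r
    (hasDerivAt_neckExponent hn hk hb (sq_nonneg r)) (hasDerivAt_pow 2 r)).exp
  refine h.congr_deriv ?_
  simp [neckFactor]
  ring

lemma antitoneOn_neckFactor (hn : n ≠ 0) (hk : 0 < k) (hb : 0 < b) :
    AntitoneOn (neckFactor n k b) (Set.Ici 0) := by
  refine antitoneOn_of_deriv_nonpos (convex_Ici 0) (continuous_neckFactor hk hb).continuousOn
    (fun r _ => (hasDerivAt_neckFactor hn hk hb r).differentiableAt.differentiableWithinAt)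
    fun r hr => ?_
  rw [interior_Ici] at hr
  rw [(hasDerivAt_neckFactor hn hk hb r).deriv]
  have h1 : neckExponentDeriv n k b (r ^ 2) ≤ 0 := by
    have := neckSlope_pos hk (neckBase_pos (n := n) hb (sq_nonneg r))
    rw [neckExponentDeriv]
    exact div_nonpos_of_nonpos_of_nonneg (by linarith) (by positivity)
  have h2 : 0 < r := hr
  have h3 : 0 < neckFactor n k b r := Real.exp_pos _
  nlinarith [mul_nonneg h3.le (mul_nonneg h2.le (neg_nonneg.2 h1))]

lemma monotoneOn_mul_neckFactor (hn : n ≠ 0) (hk : 0 < k) (hb : 0 < b) :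
    MonotoneOn (fun r => r * neckFactor n k b r) (Set.Ici 0) := by
  have hd : ∀ r, HasDerivAt (fun r => r * neckFactor n k b r)
      (neckFactor n k b r * (1 + 2 * r ^ 2 * neckExponentDeriv n k b (r ^ 2))) r := fun r =>
    ((hasDerivAt_id r).mul (hasDerivAt_neckFactor hn hk hb r)).congr_deriv (by
      simp only [id]; ring)
  refine monotoneOn_of_deriv_nonneg (convex_Ici 0)
    (continuous_id.mul (continuous_neckFactor hk hb)).continuousOn
    (fun r _ => (hd r).differentiableAt.differentiableWithinAt) fun r _ => ?_
  rw [(hd r).deriv]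
  exact mul_nonneg (Real.exp_pos _).le (neckExponent_radial_pos hk hb (sq_nonneg r)).le

/-- For `r ≥ ε` one has `V² ≥ ε^n = k`, so `k²/V² ≤ k`: outside the ball of radius `ε` the metric is
almost Euclidean, whatever `b` is. -/
lemma neckFactor_le_exp (hn : n ≠ 0) {ε : ℝ} (hε : 0 < ε) (hb : 0 < b) {r : ℝ} (hr : ε ≤ r) :
    neckFactor n (ε ^ n) b r ≤ Real.exp (2 * ε ^ n) := by
  refine Real.exp_le_exp.2 ((neckExponent_le hn (by positivity) hb (sq_nonneg r)).trans ?_)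
  refine mul_le_mul_of_nonneg_left ?_ zero_le_two
  have h1 : ε ^ n ≤ neckBase n b (r ^ 2) ^ 2 := by
    have h2 : (ε ^ 2) ^ ((n : ℝ) / 4) ≤ neckBase n b (r ^ 2) :=
      Real.rpow_le_rpow (by positivity) (by nlinarith) (by positivity)
    refine le_trans (le_of_eq ?_) (pow_le_pow_left₀ (by positivity) h2 2)
    rw [← Real.rpow_natCast ε 2, ← Real.rpow_mul hε.le, ← Real.rpow_natCast (_ ^ _) 2,
      ← Real.rpow_mul hε.le, ← Real.rpow_natCast]
    congr 1
    push_cast; ring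
  have hV : 0 < neckBase n b (r ^ 2) := neckBase_pos hb (sq_nonneg r)
  rw [div_le_iff₀ (by positivity), sq]
  exact mul_le_mul_of_nonneg_left h1 (by positivity)

/-- With `σ = t²/(t² + b)` and the slope `θ`, the mass function is `t^n u² σθ(2 - σθ)/2`. Here `σ →
1`, `u → 1`, `θ → 0`, while `t^n θ = σ^{n/2} V² θ → 2k²`. -/
lemma tendsto_neck_hawkingMass (hn : n ≠ 0) (hk : 0 < k) (hb : 0 < b) :
    Tendsto (fun t : ℝ => (t * Real.exp (neckExponent n k b (t ^ 2))) ^ n / 2 *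
      (1 - (1 + 2 * t ^ 2 * neckExponentDeriv n k b (t ^ 2)) ^ 2)) atTop (𝓝 (2 * k ^ 2)) := by
  have hn' : (0 : ℝ) < n := by exact_mod_cast Nat.pos_of_ne_zero hn
  have htb : Tendsto (fun t : ℝ => t ^ 2 + b) atTop atTop :=
    tendsto_atTop_add_const_right _ _ (tendsto_pow_atTop two_ne_zero)
  have hσ : Tendsto (fun t : ℝ => t ^ 2 / (t ^ 2 + b)) atTop (𝓝 1) := by
    have h1 : Tendsto (fun t : ℝ => 1 - b * (t ^ 2 + b)⁻¹) atTop (𝓝 (1 - b * 0)) :=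
      tendsto_const_nhds.sub (tendsto_const_nhds.mul (tendsto_inv_atTop_zero.comp htb))
    rw [mul_zero, sub_zero] at h1
    refine h1.congr fun t => ?_
    field_simp
    ring
  have hV : Tendsto (fun t : ℝ => neckBase n b (t ^ 2)) atTop atTop :=
    (tendsto_rpow_atTop (by positivity : 0 < (n : ℝ) / 4)).comp htb
  have hy : Tendsto (fun t : ℝ => k * (neckBase n b (t ^ 2))⁻¹) atTop (𝓝 0) := by
    simpa using (tendsto_inv_atTop_zero.comp hV).const_mul k
  set σ := fun t : ℝ => t ^ 2 / (t ^ 2 + b) with hσd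
  -- In terms of `y = k/V → 0`, both `u` and `θ` are rational functions that are continuous at `y =
  -- 0`.
  set y := fun t : ℝ => k * (neckBase n b (t ^ 2))⁻¹ with hyd
  have h1y : Tendsto (fun t => 1 + y t) atTop (𝓝 (1 + 0)) := tendsto_const_nhds.add hy
  have h2y : Tendsto (fun t => 2 + y t) atTop (𝓝 (2 + 0)) := tendsto_const_nhds.add hy
  have hD : Tendsto (fun t => (1 + y t) * (1 + y t + y t ^ 2)) atTop
      (𝓝 ((1 + 0) * (1 + 0 + 0 ^ 2))) := h1y.mul (h1y.add (hy.pow 2))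
  have hu : Tendsto (fun t => 1 + y t ^ 2 / (1 + y t)) atTop (𝓝 (1 + 0 ^ 2 / (1 + 0))) :=
    tendsto_const_nhds.add ((hy.pow 2).div h1y (by norm_num))
  have hq : Tendsto (fun t => (2 + y t) / ((1 + y t) * (1 + y t + y t ^ 2))) atTop
      (𝓝 ((2 + 0) / ((1 + 0) * (1 + 0 + 0 ^ 2)))) := h2y.div hD (by norm_num)
  have hrp : Tendsto (fun t => σ t ^ ((n : ℝ) / 4)) atTop (𝓝 (1 ^ ((n : ℝ) / 4))) :=
    hσ.rpow_const (Or.inl one_ne_zero)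
  have hall := ((((hrp.pow 2).mul (hu.pow 2)).mul hσ).mul (hq.const_mul (k ^ 2))).mul
    ((hσ.mul ((hy.pow 2).mul hq)).const_sub 2) |>.const_mul (1 / 2)
  have hval : 1 / 2 * ((((1 : ℝ) ^ ((n : ℝ) / 4)) ^ 2 * (1 + 0 ^ 2 / (1 + 0)) ^ 2 * 1 *
      (k ^ 2 * ((2 + 0) / ((1 + 0) * (1 + 0 + 0 ^ 2))))) *
      (2 - 1 * (0 ^ 2 * ((2 + 0) / ((1 + 0) * (1 + 0 + 0 ^ 2)))))) = 2 * k ^ 2 := by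
    rw [Real.one_rpow]; norm_num; ring
  rw [hval] at hall
  refine hall.congr' ?_
  filter_upwards [eventually_gt_atTop 0] with t ht
  have hVt : 0 < neckBase n b (t ^ 2) := neckBase_pos hb (sq_nonneg t)
  have htb0 : 0 < t ^ 2 + b := by positivity
  have ht1 : t ^ n = (σ t ^ ((n : ℝ) / 4)) ^ 2 * neckBase n b (t ^ 2) ^ 2 := by
    rw [hσd, neckBase, ← mul_pow, ← Real.mul_rpow (by positivity) htb0.le,
      div_mul_cancel₀ _ htb0.ne', ← Real.rpow_natCast t 2, ← Real.rpow_mul ht.le,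
      ← Real.rpow_natCast (_ ^ _) 2, ← Real.rpow_mul ht.le, ← Real.rpow_natCast]
    congr 1
    push_cast; ring
  have hexp : Real.exp (neckExponent n k b (t ^ 2)) ^ n = (1 + y t ^ 2 / (1 + y t)) ^ 2 := by
    rw [← Real.exp_nat_mul, neckExponent, ← mul_assoc, mul_div_cancel₀ _ hn'.ne',
      mul_comm, Real.exp_mul, Real.exp_log (by positivity), Real.rpow_two, hyd]
    congr 1
    field_simp
  have hθ : neckSlope k (neckBase n b (t ^ 2)) =
      y t ^ 2 * ((2 + y t) / ((1 + y t) * (1 + y t + y t ^ 2))) := by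
    rw [neckSlope, hyd]
    field_simp
  have hθ2 : neckSlope k (neckBase n b (t ^ 2)) * neckBase n b (t ^ 2) ^ 2 =
      k ^ 2 * ((2 + y t) / ((1 + y t) * (1 + y t + y t ^ 2))) := by
    rw [hθ]
    simp only [hyd]
    field_simp
  have h5 : 2 * t ^ 2 * neckExponentDeriv n k b (t ^ 2) =
      -(σ t * neckSlope k (neckBase n b (t ^ 2))) := by
    rw [neckExponentDeriv, hσd]; field_simp
  rw [mul_pow t, ht1, hexp, h5, ← hθ2, ← hθ]
  ring

/-- For `b = 1` there is no long neck. This is the short end of the intermediate value argument for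
the length. -/
lemma neckFactor_le_exp_two (hn : n ≠ 0) (hk : 0 < k) (hk1 : k ≤ 1) (r : ℝ) :
    neckFactor n k 1 r ≤ Real.exp 2 := by
  refine Real.exp_le_exp.2 ((neckExponent_le hn hk one_pos (sq_nonneg r)).trans ?_)
  have hV : 1 ≤ neckBase n 1 (r ^ 2) :=
    Real.one_le_rpow (by nlinarith [sq_nonneg r]) (by positivity)
  have : k ^ 2 / neckBase n 1 (r ^ 2) ^ 2 ≤ 1 := by
    rw [div_le_one (by positivity)]
    exact pow_le_pow_left₀ hk.le (hk1.trans hV) 2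
  linarith

/-- The bounds on `r` and `β` give `V ≤ k`, hence `u ≥ k/(2V)`; with `V^{2/n} = √(r² + β²) ≤ r + β`
the factor dominates a multiple of `1/(r + β)`. The integral of this diverges logarithmically as `β
→ 0`, which makes the neck long. -/
lemma le_neckFactor (hn : n ≠ 0) {ε β r : ℝ} (hε : 0 < ε) (hβ : 0 < β) (hβε : β ≤ ε ^ 2 / 2)
    (hr0 : 0 ≤ r) (hr : r ≤ ε ^ 2 / 2) :
    Real.exp (2 / n * Real.log (ε ^ n / 2)) * (r + β)⁻¹ ≤ neckFactor n (ε ^ n) (β ^ 2) r := by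
  have hn' : (0 : ℝ) < n := by exact_mod_cast Nat.pos_of_ne_zero hn
  set k := ε ^ n with hk
  have hk0 : 0 < k := by positivity
  have hV : 0 < neckBase n (β ^ 2) (r ^ 2) := neckBase_pos (by positivity) (by positivity)
  have hVk : neckBase n (β ^ 2) (r ^ 2) ≤ k := by
    have h1 : neckBase n (β ^ 2) (r ^ 2) ≤ (ε ^ 4) ^ ((n : ℝ) / 4) :=
      Real.rpow_le_rpow (by positivity) (by nlinarith [sq_nonneg (ε ^ 2)]) (by positivity)
    refine h1.trans_eq ?_
    rw [← Real.rpow_natCast ε 4, ← Real.rpow_mul hε.le, hk, ← Real.rpow_natCast ε n]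
    congr 1
    push_cast; field_simp
  have hlogV : Real.log (neckBase n (β ^ 2) (r ^ 2)) ≤ (n : ℝ) / 2 * Real.log (r + β) := by
    rw [neckBase, Real.log_rpow (by positivity)]
    have h2 : Real.log (r ^ 2 + β ^ 2) ≤ Real.log ((r + β) ^ 2) :=
      Real.log_le_log (by positivity) (by nlinarith)
    rw [Real.log_pow] at h2
    push_cast at h2
    nlinarith
  have h3 : Real.log (k / 2) - Real.log (neckBase n (β ^ 2) (r ^ 2)) ≤
      Real.log (1 + k ^ 2 / (neckBase n (β ^ 2) (r ^ 2) * (neckBase n (β ^ 2) (r ^ 2) + k))) := by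
    rw [← Real.log_div (by positivity) hV.ne']
    refine Real.log_le_log (by positivity) ?_
    have : k / 2 / neckBase n (β ^ 2) (r ^ 2) ≤
        k ^ 2 / (neckBase n (β ^ 2) (r ^ 2) * (neckBase n (β ^ 2) (r ^ 2) + k)) := by
      rw [div_div, div_le_div_iff₀ (by positivity) (by positivity)]
      nlinarith [mul_pos hV hk0, mul_nonneg (mul_pos hV hk0).le (sub_nonneg.2 hVk)]
    linarith
  have h4 : (r + β)⁻¹ = Real.exp (-Real.log (r + β)) := by
    rw [Real.exp_neg, Real.exp_log (by positivity)]
  rw [h4, ← Real.exp_add, neckFactor, neckExponent]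
  refine Real.exp_le_exp.2 ?_
  have h5 := mul_le_mul_of_nonneg_left h3 (by positivity : 0 ≤ 2 / (n : ℝ))
  have h6 := mul_le_mul_of_nonneg_left hlogV (by positivity : 0 ≤ 2 / (n : ℝ))
  have h7 : 2 / (n : ℝ) * ((n : ℝ) / 2 * Real.log (r + β)) = Real.log (r + β) := by field_simp
  rw [h7] at h6
  linarith

/-- The length of the neck can be prescribed. -/
lemma exists_neck_length (hn : n ≠ 0) {ε L : ℝ} (hε : 0 < ε) (hε1 : ε ≤ 1)
    (hL : Real.exp 2 * ε ≤ L) :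
    ∃ b : ℝ, 0 < b ∧ ∫ r in (0 : ℝ)..ε, neckFactor n (ε ^ n) b r = L := by
  have hk : 0 < ε ^ n := by positivity
  -- The substitution `b = e^τ` makes the parameter range over the whole line, so that the
  -- intermediate value theorem applies directly.
  have hcont : Continuous fun τ : ℝ => ∫ r in (0 : ℝ)..ε, neckFactor n (ε ^ n) (Real.exp τ) r := by
    refine intervalIntegral.continuous_parametric_intervalIntegral_of_continuous' ?_ 0 ε
    have h1 : Continuous fun p : ℝ × ℝ => neckBase n (Real.exp p.1) (p.2 ^ 2) :=
      Continuous.rpow_const (by fun_prop) fun p => Or.inl (by positivity)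
    have h2 : ∀ p : ℝ × ℝ, 0 < neckBase n (Real.exp p.1) (p.2 ^ 2) := fun p =>
      neckBase_pos (Real.exp_pos _) (sq_nonneg _)
    have h3 : Continuous fun p : ℝ × ℝ => (ε ^ n) ^ 2 / (neckBase n (Real.exp p.1) (p.2 ^ 2) *
        (neckBase n (Real.exp p.1) (p.2 ^ 2) + ε ^ n)) :=
      continuous_const.div (h1.mul (h1.add continuous_const)) fun p => by
        have := h2 p; positivity
    have h4 : ∀ p : ℝ × ℝ, 1 + (ε ^ n) ^ 2 / (neckBase n (Real.exp p.1) (p.2 ^ 2) *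
        (neckBase n (Real.exp p.1) (p.2 ^ 2) + ε ^ n)) ≠ 0 := fun p => by
      have := h2 p; positivity
    exact Real.continuous_exp.comp (continuous_const.mul ((continuous_const.add h3).log h4))
  have hub : ∫ r in (0 : ℝ)..ε, neckFactor n (ε ^ n) (Real.exp 0) r ≤ L := by
    rw [Real.exp_zero]
    refine le_trans ?_ hL
    have : ∫ _ in (0 : ℝ)..ε, Real.exp 2 = Real.exp 2 * ε := by simp [mul_comm]
    rw [← this]
    exact intervalIntegral.integral_mono_on hε.le
      ((continuous_neckFactor hk one_pos).intervalIntegrable _ _) (by simp)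
      fun r _ => neckFactor_le_exp_two hn hk (pow_le_one₀ hε.le hε1) r
  set C := Real.exp (2 / n * Real.log (ε ^ n / 2)) with hC
  have hC0 : 0 < C := Real.exp_pos _
  have hL0 : 0 < L := lt_of_lt_of_le (by positivity) hL
  -- Chosen such that `log ((ε²/2)/β) = L/C`; then `∫ C/(r + β)` over `[0, ε²/2]` is already at
  -- least `L`.
  set β := ε ^ 2 / 2 * Real.exp (-(L / C)) with hβ
  have hβ0 : 0 < β := by positivity
  have hβε : β ≤ ε ^ 2 / 2 := by
    have : Real.exp (-(L / C)) ≤ 1 := Real.exp_le_one_iff.2 (neg_nonpos.2 (by positivity))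
    rw [hβ]
    exact mul_le_of_le_one_right (by positivity) this
  have hlb : L ≤ ∫ r in (0 : ℝ)..ε, neckFactor n (ε ^ n) (Real.exp (2 * Real.log β)) r := by
    have he : Real.exp (2 * Real.log β) = β ^ 2 := by
      rw [mul_comm, Real.exp_mul, Real.exp_log hβ0, Real.rpow_two]
    rw [he]
    have hφ := continuous_neckFactor (n := n) hk (pow_pos hβ0 2)
    have h1 : ∫ r in (0 : ℝ)..ε ^ 2 / 2, C * (r + β)⁻¹ =
        C * Real.log ((ε ^ 2 / 2 + β) / β) := by
      rw [intervalIntegral.integral_const_mul,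
        intervalIntegral.integral_comp_add_right (fun r => r⁻¹) β, zero_add,
        integral_inv_of_pos hβ0 (by positivity)]
    have h2 : L ≤ C * Real.log ((ε ^ 2 / 2 + β) / β) := by
      have h3 : L / C ≤ Real.log ((ε ^ 2 / 2 + β) / β) := by
        rw [Real.le_log_iff_exp_le (by positivity), le_div_iff₀ hβ0]
        have : Real.exp (L / C) * β = ε ^ 2 / 2 := by
          rw [hβ, Real.exp_neg]; field_simp
        linarith
      rwa [div_le_iff₀ hC0, mul_comm] at h3
    have hci : IntervalIntegrable (fun r => C * (r + β)⁻¹) volume 0 (ε ^ 2 / 2) := by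
      refine ContinuousOn.intervalIntegrable fun r hr => ?_
      rw [Set.uIcc_of_le (by positivity)] at hr
      have : r + β ≠ 0 := by linarith [hr.1]
      exact ContinuousAt.continuousWithinAt (by fun_prop (disch := assumption))
    have h4 : ∫ r in (0 : ℝ)..ε ^ 2 / 2, C * (r + β)⁻¹ ≤
        ∫ r in (0 : ℝ)..ε ^ 2 / 2, neckFactor n (ε ^ n) (β ^ 2) r :=
      intervalIntegral.integral_mono_on (by positivity) hci (hφ.intervalIntegrable _ _)
        fun r hr => le_neckFactor hn hε hβ0 hβε hr.1 hr.2
    have h5 : ∫ r in (0 : ℝ)..ε ^ 2 / 2, neckFactor n (ε ^ n) (β ^ 2) r ≤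
        ∫ r in (0 : ℝ)..ε, neckFactor n (ε ^ n) (β ^ 2) r :=
      intervalIntegral.integral_mono_interval le_rfl (by positivity) (by nlinarith)
        (ae_of_all _ fun r => zero_le_one.trans (one_le_neckFactor hk (pow_pos hβ0 2) r))
        (hφ.intervalIntegrable _ _)
    linarith
  obtain ⟨τ, hτ⟩ := mem_range_of_exists_le_of_exists_ge hcont ⟨0, hub⟩ ⟨_, hlb⟩
  exact ⟨Real.exp τ, Real.exp_pos τ, hτ⟩

end Neck

/-! ### Completeness and the class `RS_m` -/

section ConfManifold

variable {m : ℕ} {κ κ₁ κ₂ : ℝ → ℝ} (hs : ∀ ρ, 0 ≤ ρ → ContDiffAt ℝ ∞ κ ρ)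

lemma rdist_confManifold :
    (confManifold m κ hs).rdist = confDist fun z => Real.exp (κ (‖z‖ ^ 2)) := by
  have h : ∀ (x v : Eu m), √(∑ i, ∑ j, (confManifold m κ hs).g x i j * v i * v j) =
      Real.exp (κ (‖x‖ ^ 2)) * ‖v‖ := by
    intro x v
    have h1 : ∑ i, ∑ j, (confManifold m κ hs).g x i j * v i * v j =
        (Real.exp (κ (‖x‖ ^ 2)) * ‖v‖) ^ 2 := by
      change ∑ i, ∑ j, confMetric (fun y : Eu m => κ (‖y‖ ^ 2)) x i j * v i * v j = _
      simp only [confMetric_apply, mul_ite, mul_one, mul_zero, ite_mul, zero_mul,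
        Finset.sum_ite_eq, Finset.mem_univ, if_true, mul_assoc, ← Finset.mul_sum, ← sq]
      rw [← EuclideanSpace.real_norm_sq_eq, mul_pow, ← Real.exp_nat_mul]
      push_cast; rfl
    rw [h1, Real.sqrt_sq (by positivity)]
  ext x y
  simp only [RotSymManifold.rdist, RotSymManifold.IsPathLength, h, carrier_confManifold,
    Set.mem_univ, implies_true, true_and]
  rfl

lemma continuous_confFactor (hs : ∀ ρ, 0 ≤ ρ → ContDiffAt ℝ ∞ κ ρ) :
    Continuous fun z : Eu m => Real.exp (κ (‖z‖ ^ 2)) :=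
  Real.continuous_exp.comp (contDiff_radial hs).continuous

/-- Bounds `1 ≤ c ≤ C` make the distance equivalent to the Euclidean one. -/
lemma complete_confManifold (h1 : ∀ z : Eu m, 1 ≤ Real.exp (κ (‖z‖ ^ 2))) {C : ℝ}
    (hC : ∀ z : Eu m, Real.exp (κ (‖z‖ ^ 2)) ≤ C) : (confManifold m κ hs).Complete := by
  have hc := continuous_confFactor (m := m) hs
  intro u _ hu
  rw [rdist_confManifold] at hu ⊢
  have hcs : CauchySeq u := by
    refine Metric.cauchySeq_iff.2 fun ε hε => ?_
    obtain ⟨N, hN⟩ := hu ε hε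
    exact ⟨N, fun i hi j hj => by
      rw [dist_eq_norm]
      exact (norm_sub_le_confDist hc h1 _ _).trans_lt (hN i hi j hj)⟩
  obtain ⟨x, hx⟩ := cauchySeq_tendsto_of_complete hcs
  refine ⟨x, by rw [carrier_confManifold]; trivial, ?_⟩
  have h2 : Tendsto (fun n => C * ‖u n - x‖) atTop (𝓝 0) := by
    simpa using (tendsto_iff_norm_sub_tendsto_zero.1 hx).const_mul C
  exact squeeze_zero (fun n => (norm_nonneg _).trans (norm_sub_le_confDist hc h1 _ _))
    (fun n => confDist_le_mul_norm hc h1 fun t _ => hC _) h2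

lemma isRS_confManifold (hm : 2 ≤ m) (h1 : ∀ ρ, 0 ≤ ρ → HasDerivAt κ (κ₁ ρ) ρ)
    (h2 : ∀ ρ, 0 ≤ ρ → HasDerivAt κ₁ (κ₂ ρ) ρ)
    (hscal : ∀ ρ, 0 ≤ ρ → 2 * ρ * κ₂ ρ + m * κ₁ ρ + ((m : ℝ) - 2) * ρ * κ₁ ρ ^ 2 ≤ 0)
    (hrad : ∀ ρ, 0 ≤ ρ → 0 < 1 + 2 * ρ * κ₁ ρ) (hge : ∀ z : Eu m, 1 ≤ Real.exp (κ (‖z‖ ^ 2)))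
    {C : ℝ} (hC : ∀ z : Eu m, Real.exp (κ (‖z‖ ^ 2)) ≤ C) : (confManifold m κ hs).IsRS where
  complete := complete_confManifold hs hge hC
  scalar_nonneg x _ := by
    rw [carrier_confManifold]
    exact scalarCurv_radial_nonneg (by omega) hs h1 h2 hscal x
  no_minimal N _ F := by
    rw [carrier_confManifold]
    refine not_isClosedMinimalHypersurface hm (contDiff_radial hs) (fun x => ?_) N F
    have : ∑ i, pd Set.univ (fun y : Eu m => κ (‖y‖ ^ 2)) i x * x i =
        2 * ‖x‖ ^ 2 * κ₁ (‖x‖ ^ 2) := by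
      rw [EuclideanSpace.real_norm_sq_eq, Finset.mul_sum, Finset.sum_mul]
      refine Finset.sum_congr rfl fun i _ => ?_
      rw [pd_radial h1, EuclideanSpace.real_norm_sq_eq]
      ring
    rw [this]
    exact hrad _ (sq_nonneg _)
  boundary h := absurd h (lt_irrefl _)

end ConfManifold

/-! ### The limit space -/

section SegSpace

variable {m : ℕ}

/-- The metric space structure of `segDist`. -/
noncomputable abbrev segMetricSpace (m : ℕ) : MetricSpace (Eu m × ℝ) where
  dist := segDist
  dist_self z := by simp [segDist]
  dist_comm z w := by simp only [segDist]; rw [norm_sub_rev, abs_sub_comm]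
  dist_triangle z w y := by
    have h1 := norm_sub_le_norm_sub_add_norm_sub z.1 w.1 y.1
    have h2 := abs_sub_le z.2 w.2 y.2
    simp only [segDist]; linarith
  eq_of_dist_eq_zero {z w} h := by
    simp only [segDist] at h
    have h1 : ‖z.1 - w.1‖ = 0 := by linarith [norm_nonneg (z.1 - w.1), abs_nonneg (z.2 - w.2)]
    have h2 : |z.2 - w.2| = 0 := by linarith
    exact Prod.ext (sub_eq_zero.1 (norm_eq_zero.1 h1)) (sub_eq_zero.1 (abs_eq_zero.1 h2))

lemma segDist_comm (z w : Eu m × ℝ) : segDist z w = segDist w z :=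
  (segMetricSpace m).dist_comm z w

lemma segDist_triangle (z w y : Eu m × ℝ) : segDist z y ≤ segDist z w + segDist w y :=
  (segMetricSpace m).dist_triangle z w y

lemma norm_fst_le_add_segDist (z w : Eu m × ℝ) : ‖z.1‖ ≤ ‖w.1‖ + segDist w z := by
  have h1 := norm_le_insert' z.1 w.1
  have h2 : ‖z.1 - w.1‖ ≤ segDist w z := by
    rw [segDist, norm_sub_rev]
    linarith [abs_nonneg (w.2 - z.2)]
  linarith

/-- Points of a ball of the limit space can be moved into a smaller ball. -/
lemma exists_shrink {L D s : ℝ} {q : Eu m} {z : Eu m × ℝ} (hz : z ∈ segSpace m L)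
    (hs : 0 < s) (hsq : s ≤ ‖q‖) (hsD : s ≤ D) (hzD : segDist (q, (0 : ℝ)) z ≤ D) :
    ∃ z' ∈ segSpace m L, segDist z z' ≤ s ∧ segDist (q, (0 : ℝ)) z' ≤ D - s := by
  obtain ⟨y, t⟩ := z
  obtain ⟨⟨ht0, htL⟩, hyt⟩ := hz
  simp only at ht0 htL hyt
  have hL : (0 : ℝ) ∈ Set.Icc 0 L := ⟨le_rfl, ht0.trans htL⟩
  have hq : 0 < ‖q‖ := hs.trans_le hsq
  simp only [segDist, zero_sub, abs_neg, abs_of_nonneg ht0] at hzD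
  -- The point is moved by `s` along a shortest path to `q`. In `ℝ^m` this is a straight line (or a
  -- jump to `q` itself if `q` is that near). On the segment it is a descent, which continues from
  -- the origin towards `q` when `t < s`.
  rcases eq_or_ne t 0 with rfl | ht
  · by_cases h : ‖y - q‖ ≤ s
    · exact ⟨(q, 0), ⟨hL, Or.inr rfl⟩, by simpa [segDist] using h, by simpa [segDist] using hsD⟩
    · push Not at h
      have hpos : 0 < ‖y - q‖ := hs.trans h
      refine ⟨(q + (1 - s / ‖y - q‖) • (y - q), 0), ⟨hL, Or.inr rfl⟩, ?_, ?_⟩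
      · have : y - (q + (1 - s / ‖y - q‖) • (y - q)) = (s / ‖y - q‖) • (y - q) := by module
        simp only [segDist, this, norm_smul, sub_self, abs_zero, add_zero]
        rw [Real.norm_of_nonneg (by positivity), div_mul_cancel₀ _ hpos.ne']
      · have h1 : 0 ≤ 1 - s / ‖y - q‖ := by
          rw [sub_nonneg, div_le_one hpos]; exact h.le
        simp only [segDist, sub_add_cancel_left, norm_neg, norm_smul, sub_self, abs_zero, add_zero]
        rw [Real.norm_of_nonneg h1, sub_mul, div_mul_cancel₀ _ hpos.ne', one_mul, norm_sub_rev]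
        linarith
  · obtain rfl : y = 0 := hyt.resolve_right ht
    rw [sub_zero] at hzD
    by_cases h : s ≤ t
    · refine ⟨(0, t - s), ⟨⟨by simpa using h, by simp only; linarith⟩, Or.inl rfl⟩, ?_, ?_⟩
      · simp [segDist, abs_of_pos hs]
      · simp only [segDist, sub_zero, zero_sub, abs_neg]
        rw [abs_of_nonneg (by linarith)]
        linarith
    · push Not at h
      refine ⟨(((s - t) / ‖q‖) • q, 0), ⟨hL, Or.inr rfl⟩, ?_, ?_⟩
      · simp only [segDist, zero_sub, norm_neg, sub_zero, norm_smul, abs_of_nonneg ht0]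
        rw [Real.norm_of_nonneg (div_nonneg (by linarith) hq.le), div_mul_cancel₀ _ hq.ne']
        linarith
      · have : q - ((s - t) / ‖q‖) • q = (1 - (s - t) / ‖q‖) • q := by module
        have h1 : 0 ≤ 1 - (s - t) / ‖q‖ := by
          rw [sub_nonneg, div_le_one hq]; linarith
        simp only [segDist, this, norm_smul, sub_self, abs_zero, add_zero]
        rw [Real.norm_of_nonneg h1, sub_mul, div_mul_cancel₀ _ hq.ne', one_mul]
        linarith

/-- A rotation of the limit space. -/
noncomputable def segRotate (U : Eu m ≃ₗᵢ[ℝ] Eu m) (z : Eu m × ℝ) : Eu m × ℝ := (U z.1, z.2)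

lemma segDist_segRotate (U : Eu m ≃ₗᵢ[ℝ] Eu m) (z w : Eu m × ℝ) :
    segDist (segRotate U z) (segRotate U w) = segDist z w := by
  simp only [segDist, segRotate]
  rw [← map_sub, U.norm_map]

lemma segRotate_mem {U : Eu m ≃ₗᵢ[ℝ] Eu m} {L : ℝ} {z : Eu m × ℝ} (hz : z ∈ segSpace m L) :
    segRotate U z ∈ segSpace m L :=
  ⟨hz.1, hz.2.imp (fun h => by simp [segRotate, h]) id⟩

end SegSpace

/-! ### Gromov-Hausdorff approximation of the limit space -/

section Collapse

variable {m : ℕ} {φ : ℝ → ℝ} {ε η L R : ℝ}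

/-- The map to the limit space that collapses the symmetric spheres in the neck `{|x| < ε}`. -/
noncomputable def collapse (φ : ℝ → ℝ) (ε : ℝ) (x : Eu m) : Eu m × ℝ :=
  if ε ≤ ‖x‖ then (x, 0) else (0, ∫ r in ‖x‖..ε, φ r)

/-- `φ` is the conformal factor of a metric with a neck `{|x| < ε}` of length `L`. -/
structure IsNeckFactor (φ : ℝ → ℝ) (ε η L : ℝ) : Prop where
  continuous : Continuous φ
  one_le : ∀ r, 1 ≤ φ r
  anti : AntitoneOn φ (Set.Ici 0)
  mono : MonotoneOn (fun r => r * φ r) (Set.Ici 0)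
  pos : 0 < ε
  length : ∫ r in (0 : ℝ)..ε, φ r = L
  le : ∀ r, ε ≤ r → φ r ≤ 1 + η

namespace IsNeckFactor

lemma eta_nonneg (h : IsNeckFactor φ ε η L) : 0 ≤ η := by linarith [h.one_le ε, h.le ε le_rfl]

lemma integral_nonneg (h : IsNeckFactor φ ε η L) {a b : ℝ} (hab : a ≤ b) : 0 ≤ ∫ r in a..b, φ r :=
  intervalIntegral.integral_nonneg hab fun r _ => zero_le_one.trans (h.one_le r)

lemma integral_add (h : IsNeckFactor φ ε η L) (a b c : ℝ) :
    (∫ r in a..b, φ r) + ∫ r in b..c, φ r = ∫ r in a..c, φ r :=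
  intervalIntegral.integral_add_adjacent_intervals (h.continuous.intervalIntegrable _ _)
    (h.continuous.intervalIntegrable _ _)

lemma sub_le_integral (h : IsNeckFactor φ ε η L) {a b : ℝ} (hab : a ≤ b) :
    b - a ≤ ∫ r in a..b, φ r := by
  have : ∫ _ in a..b, (1 : ℝ) = b - a := by simp
  rw [← this]
  exact intervalIntegral.integral_mono_on hab (by simp) (h.continuous.intervalIntegrable _ _)
    fun r _ => h.one_le r

lemma integral_le (h : IsNeckFactor φ ε η L) {b : ℝ} (hb : ε ≤ b) :
    ∫ r in ε..b, φ r ≤ (1 + η) * (b - ε) := by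
  have : ∫ _ in ε..b, (1 + η) = (1 + η) * (b - ε) := by simp; ring
  rw [← this]
  exact intervalIntegral.integral_mono_on hb (h.continuous.intervalIntegrable _ _) (by simp)
    fun r hr => h.le r hr.1

/-- The area radius increases, so every symmetric sphere in the neck is at most as large as the one
at its mouth. Collapsing them is therefore cheap. -/
lemma mul_le (h : IsNeckFactor φ ε η L) {r : ℝ} (h0 : 0 ≤ r) (hr : r ≤ ε) : r * φ r ≤ ε * (1 + η) :=
  (h.mono h0 h.pos.le hr).trans (mul_le_mul_of_nonneg_left (h.le ε le_rfl) h.pos.le)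

lemma collapse_mem (h : IsNeckFactor φ ε η L) (x : Eu m) : collapse φ ε x ∈ segSpace m L := by
  have hL : 0 ≤ L := h.length ▸ h.integral_nonneg h.pos.le
  rw [collapse]
  split_ifs with hx
  · exact ⟨⟨le_rfl, hL⟩, Or.inr rfl⟩
  · push Not at hx
    refine ⟨⟨h.integral_nonneg hx.le, ?_⟩, Or.inl rfl⟩
    have := h.integral_add 0 ‖x‖ ε
    have h1 := h.integral_nonneg (norm_nonneg x)
    rw [h.length] at this
    simp only; linarith

/-- Inside the neck, distance is height difference up to an arc around a small sphere; outside, it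
is Euclidean up to the factor `1 + η`. The three error terms come from this factor on distances up
to `2R`, from at most two arcs, and from attaching the segment at radius `0` instead of `ε`. -/
lemma collapse_distortion_of_le (h : IsNeckFactor φ ε η L)
    (hE : ∀ x : Eu m, ∃ e : Eu m, ‖e‖ = 1 ∧ inner ℝ x e = 0)
    {x y : Eu m} (hx : ‖x‖ ≤ R) (hyx : ‖y‖ ≤ ‖x‖) :
    |confDist (fun z => φ ‖z‖) x y - segDist (collapse φ ε x) (collapse φ ε y)| ≤
      2 * R * η + 2 * Real.pi * (ε * (1 + η)) + ε := by
  have hc : Continuous fun z : Eu m => φ ‖z‖ := h.continuous.comp continuous_norm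
  have h1 : ∀ z : Eu m, 1 ≤ φ ‖z‖ := fun z => h.one_le _
  have hη := h.eta_nonneg
  have hε := h.pos
  have hR : 0 ≤ R := (norm_nonneg x).trans hx
  have hA : 0 ≤ Real.pi * (ε * (1 + η)) := by have := Real.pi_pos; positivity
  have hRη : 0 ≤ R * η := by positivity
  have hlow := integral_le_confDist h.continuous h.one_le h.anti x y
  have hup := confDist_le_integral_add h.continuous h.one_le hE hyx
  have harc : ∀ r, 0 ≤ r → r ≤ ε → Real.pi * (r * φ r) ≤ Real.pi * (ε * (1 + η)) :=
    fun r h0 hr => mul_le_mul_of_nonneg_left (h.mul_le h0 hr) Real.pi_pos.le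
  by_cases hεx : ε ≤ ‖x‖
  swap
  · push Not at hεx
    have hεy := hyx.trans_lt hεx
    rw [collapse, collapse, if_neg hεx.not_ge, if_neg hεy.not_ge]
    have hi := h.integral_add ‖y‖ ‖x‖ ε
    have h0 := h.integral_nonneg hyx
    simp only [segDist, sub_self, norm_zero, zero_add]
    rw [← hi, sub_add_cancel_right, abs_neg, abs_of_nonneg h0, abs_of_nonneg (by linarith)]
    have := harc ‖y‖ (norm_nonneg y) hεy.le
    linarith
  by_cases hεy : ε ≤ ‖y‖
  swap
  · push Not at hεy
    rw [collapse, collapse, if_pos hεx, if_neg hεy.not_ge]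
    have hi := h.integral_add ‖y‖ ε ‖x‖
    have h0 := h.integral_nonneg hεy.le
    have h2 := h.sub_le_integral hεx
    have h3 := h.integral_le hεx
    have h4 := harc ‖y‖ (norm_nonneg y) hεy.le
    have h5 : η * (‖x‖ - ε) ≤ R * η := by nlinarith
    simp only [segDist, sub_zero, zero_sub, abs_neg, abs_of_nonneg h0]
    rw [abs_le]
    constructor <;> nlinarith
  · rw [collapse, collapse, if_pos hεx, if_pos hεy]
    simp only [segDist, sub_self, abs_zero, add_zero]
    have h2 := norm_sub_le_confDist hc h1 x y
    have h3 : ‖x - y‖ ≤ 2 * R := (norm_sub_le x y).trans (by linarith)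
    have h4 : (1 + η) * ‖x - y‖ ≤ ‖x - y‖ + 2 * R * η := by nlinarith
    rw [abs_of_nonneg (by linarith)]
    by_cases hseg : ∀ t ∈ Set.Icc (0 : ℝ) 1, ε ≤ ‖x + t • (y - x)‖
    · have := confDist_le_mul_norm hc h1 (x := x) (y := y) (C := 1 + η)
        fun t ht => h.le _ (hseg t ht)
      linarith
    -- If the segment from `x` to `y` enters the neck, then `(|x| - ε) + (|y| - ε) ≤ |x - y|`. The
    -- detour in to the sphere of radius `ε`, through the auxiliary point `ε • e`, and out again is
    -- then almost as short.
    · push Not at hseg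
      obtain ⟨t, ht, hz⟩ := hseg
      have hx' : ‖x‖ ≤ t * ‖x - y‖ + ε := by
        have e1 : x = (x + t • (y - x)) + t • (x - y) := by module
        have e2 := norm_add_le (x + t • (y - x)) (t • (x - y))
        rw [← e1, norm_smul, Real.norm_of_nonneg ht.1] at e2
        linarith
      have hy' : ‖y‖ ≤ (1 - t) * ‖x - y‖ + ε := by
        have e1 : y = (x + t • (y - x)) + (-(1 - t)) • (x - y) := by module
        have e2 := norm_add_le (x + t • (y - x)) ((-(1 - t)) • (x - y))
        rw [← e1, norm_smul, norm_neg, Real.norm_of_nonneg (by linarith [ht.2])] at e2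
        linarith
      obtain ⟨e, he, -⟩ := hE 0
      have hw : ‖ε • e‖ = ε := by rw [norm_smul, he, mul_one, Real.norm_of_nonneg hε.le]
      have hb : ∀ z : Eu m, ε ≤ ‖z‖ → confDist (fun z => φ ‖z‖) z (ε • e) ≤
          (1 + η) * (‖z‖ - ε) + Real.pi * (ε * (1 + η)) := by
        intro z hz
        have e1 := confDist_le_integral_add h.continuous h.one_le hE (x := z) (y := ε • e)
          (by rwa [hw])
        rw [hw] at e1
        linarith [h.integral_le hz, harc ε hε.le le_rfl]
      have e1 := confDist_triangle hc h1 x (ε • e) y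
      rw [confDist_comm hc (ε • e) y] at e1
      have e2 := hb x hεx
      have e3 := hb y hεy
      have e4 : (1 + η) * (‖x‖ - ε) ≤ (1 + η) * (t * ‖x - y‖) :=
        mul_le_mul_of_nonneg_left (by linarith) (by linarith)
      have e5 : (1 + η) * (‖y‖ - ε) ≤ (1 + η) * ((1 - t) * ‖x - y‖) :=
        mul_le_mul_of_nonneg_left (by linarith) (by linarith)
      linarith

lemma collapse_distortion (h : IsNeckFactor φ ε η L)
    (hE : ∀ x : Eu m, ∃ e : Eu m, ‖e‖ = 1 ∧ inner ℝ x e = 0)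
    {x y : Eu m} (hx : ‖x‖ ≤ R) (hy : ‖y‖ ≤ R) :
    |confDist (fun z => φ ‖z‖) x y - segDist (collapse φ ε x) (collapse φ ε y)| ≤
      2 * R * η + 2 * Real.pi * (ε * (1 + η)) + ε := by
  rcases le_total ‖y‖ ‖x‖ with hyx | hyx
  · exact h.collapse_distortion_of_le hE hx hyx
  · have hc : Continuous fun z : Eu m => φ ‖z‖ := h.continuous.comp continuous_norm
    rw [confDist_comm hc, segDist_comm]
    exact h.collapse_distortion_of_le hE hy hyx

/-- Points of the segment are attained exactly, by the intermediate value theorem. In `ℝ^m` only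
points of norm less than `ε` are missed, and these are within `2ε` of the sphere of radius `ε`. -/
lemma exists_collapse_near (h : IsNeckFactor φ ε η L)
    (hE : ∀ x : Eu m, ∃ e : Eu m, ‖e‖ = 1 ∧ inner ℝ x e = 0)
    (hεR : ε ≤ R) {z : Eu m × ℝ} (hz : z ∈ segSpace m L) (hzR : ‖z.1‖ ≤ R) :
    ∃ x : Eu m, ‖x‖ ≤ R ∧ segDist (collapse φ ε x) z ≤ 2 * ε := by
  have hε := h.pos
  obtain ⟨e, he, -⟩ := hE 0
  have hn : ∀ r, 0 ≤ r → ‖r • e‖ = r := fun r hr => by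
    rw [norm_smul, he, mul_one, Real.norm_of_nonneg hr]
  obtain ⟨y, t⟩ := z
  obtain ⟨⟨ht0, htL⟩, hyt⟩ := hz
  simp only at ht0 htL hyt hzR
  rcases eq_or_ne t 0 with rfl | ht
  · by_cases hy : ε ≤ ‖y‖
    · refine ⟨y, hzR, ?_⟩
      rw [collapse, if_pos hy]
      simp [segDist, hε.le]
    · push Not at hy
      refine ⟨ε • e, (hn ε hε.le).le.trans hεR, ?_⟩
      rw [collapse, if_pos (hn ε hε.le).ge]
      simp only [segDist, sub_self, abs_zero, add_zero]
      refine (norm_sub_le _ _).trans ?_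
      rw [hn ε hε.le]; linarith
  · obtain rfl : y = 0 := hyt.resolve_right ht
    have hcont : Continuous fun r => ∫ u in r..ε, φ u := by
      have : (fun r => ∫ u in r..ε, φ u) = fun r => -∫ u in ε..r, φ u :=
        funext fun r => intervalIntegral.integral_symm _ _
      rw [this]
      exact (intervalIntegral.continuous_primitive
        (fun a b => h.continuous.intervalIntegrable a b) ε).neg
    obtain ⟨r, hr, hrt⟩ : t ∈ (fun r => ∫ u in r..ε, φ u) '' Set.Icc 0 ε :=
      intermediate_value_Icc' hε.le hcont.continuousOn ⟨by simpa using ht0, by rwa [h.length]⟩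
    simp only at hrt
    have hrε : r < ε := by
      refine lt_of_le_of_ne hr.2 fun h0 => ht ?_
      rw [← hrt, h0, intervalIntegral.integral_same]
    refine ⟨r • e, (hn r hr.1).le.trans (hr.2.trans hεR), ?_⟩
    rw [collapse, if_neg (by rw [hn r hr.1]; exact hrε.not_ge), hn r hr.1, hrt]
    simp [segDist, hε.le]

/-- The approximation is the collapse followed by a linear isometry that carries `p` to the ray of
`q`. By `hpq` the area radius at `p` is `|q|`, so `p` lies outside the neck and its image is within
`δ` of `q`. -/
lemma pointedGHDist_le (h : IsNeckFactor φ ε η L)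
    (hE : ∀ x : Eu m, ∃ e : Eu m, ‖e‖ = 1 ∧ inner ℝ x e = 0)
    {p q : Eu m} {D δ : ℝ} (hD : 0 < D) (hδ0 : 0 < δ)
    (hδ : 2 * (‖q‖ + D) * η + 2 * Real.pi * (ε * (1 + η)) + 2 * ε ≤ δ)
    (hδq : 6 * δ ≤ ‖q‖) (hδD : 6 * δ ≤ D) (hεq : ε * (1 + η) < ‖q‖)
    (hpq : ‖p‖ * φ ‖p‖ = ‖q‖) :
    pointedGHDist (confDist fun z => φ ‖z‖)
      (ballIn (confDist fun z => φ ‖z‖) Set.univ p (D - 2 * δ)) p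
      segDist (ballIn segDist (segSpace m L) (q, (0 : ℝ)) D) (q, (0 : ℝ)) ≤
        ENNReal.ofReal (14 * δ) := by
  have hc : Continuous fun z : Eu m => φ ‖z‖ := h.continuous.comp continuous_norm
  have h1 : ∀ z : Eu m, 1 ≤ φ ‖z‖ := fun z => h.one_le _
  have hη := h.eta_nonneg
  have hε := h.pos
  have hA : 0 ≤ Real.pi * (ε * (1 + η)) := by have := Real.pi_pos; positivity
  have hq0 : 0 < ‖q‖ := by linarith
  have hηq : 0 ≤ (‖q‖ + D) * η := by positivity
  have hpn : ‖p‖ ≤ ‖q‖ := by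
    rw [← hpq]; exact le_mul_of_one_le_right (norm_nonneg p) (h1 p)
  have hεp : ε ≤ ‖p‖ := by
    by_contra! hlt
    have := h.mul_le (norm_nonneg p) hlt.le
    linarith
  have hp0 : 0 < ‖p‖ := hε.trans_le hεp
  have hqp : ‖q‖ - ‖p‖ ≤ δ := by
    have h2 : ‖q‖ ≤ ‖p‖ * (1 + η) := by
      rw [← hpq]; exact mul_le_mul_of_nonneg_left (h.le _ hεp) hp0.le
    have h3 : ‖p‖ * η ≤ (‖q‖ + D) * η := mul_le_mul_of_nonneg_right (by linarith) hη
    linarith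
  obtain ⟨U, hU⟩ : ∃ U : Eu m ≃ₗᵢ[ℝ] Eu m, U p = (‖p‖ / ‖q‖) • q := by
    have hn : ‖p‖ = ‖(‖p‖ / ‖q‖) • q‖ := by
      rw [norm_smul, Real.norm_of_nonneg (by positivity), div_mul_cancel₀ _ hq0.ne']
    -- The reflection that exchanges two vectors of equal norm.
    exact ⟨_, Submodule.reflection_sub hn⟩
  set G : Eu m → Eu m × ℝ := fun x => segRotate U (collapse φ ε x) with hG
  have hGp : segDist (G p) (q, (0 : ℝ)) ≤ δ := by
    have h2 : (‖p‖ / ‖q‖) • q - q = (-(1 - ‖p‖ / ‖q‖)) • q := by module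
    have h3 : 0 ≤ 1 - ‖p‖ / ‖q‖ := by rw [sub_nonneg, div_le_one hq0]; exact hpn
    simp only [hG, collapse, if_pos hεp, segRotate, segDist, hU, h2, norm_smul, norm_neg, sub_self,
      abs_zero, add_zero]
    rw [Real.norm_of_nonneg h3, sub_mul, div_mul_cancel₀ _ hq0.ne', one_mul]
    exact hqp
  have hdis : ∀ x y : Eu m, ‖x‖ ≤ ‖q‖ + D → ‖y‖ ≤ ‖q‖ + D →
      |confDist (fun z => φ ‖z‖) x y - segDist (G x) (G y)| ≤ δ := by
    intro x y hx hy
    rw [hG]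
    simp only [segDist_segRotate]
    exact (h.collapse_distortion hE hx hy).trans (by linarith)
  have hball : ∀ x ∈ ballIn (confDist fun z : Eu m => φ ‖z‖) Set.univ p (D - 2 * δ),
      ‖x‖ ≤ ‖q‖ + D := by
    rintro x ⟨-, hx⟩
    have h2 := norm_sub_le_confDist hc h1 p x
    have h3 := norm_le_insert p x
    linarith
  have hpD : ‖p‖ ≤ ‖q‖ + D := by linarith
  -- The radius `D - 2δ` absorbs the distortion and the displacement of the base point, so images
  -- stay in the ball of radius `D`. Conversely a point of that ball is first moved inwards by `6δ`;
  -- its approximate preimage is then at distance at most `D - 3δ` from `p`. The total displacement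
  -- `6δ + δ` explains `7δ`.
  have key := @RotSym.pointedGHDist_le (Eu m) (Eu m × ℝ) (confMetricSpace hc h1)
    (segMetricSpace m) (ballIn (confDist fun z => φ ‖z‖) Set.univ p (D - 2 * δ))
    (ballIn segDist (segSpace m L) (q, (0 : ℝ)) D) p (q, (0 : ℝ)) G (7 * δ) (by positivity)
    ⟨trivial, by rw [confDist_self hc h1]; linarith⟩
    (fun x hx x' hx' => (hdis x x' (hball x hx) (hball x' hx')).trans (by linarith))
    (fun x hx => ⟨segRotate_mem (h.collapse_mem x), by
      have h2 := (abs_le.1 (hdis p x hpD (hball x hx))).1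
      have h3 := segDist_triangle (q, (0 : ℝ)) (G p) (G x)
      rw [segDist_comm _ (G p)] at h3
      have h4 := hx.2
      linarith⟩)
    (fun y hy => by
      obtain ⟨z, hz, hyz, hqz⟩ := exists_shrink hy.1 (by positivity : 0 < 6 * δ) hδq hδD hy.2.le
      have hzR : ‖z.1‖ ≤ ‖q‖ + D := by
        have := norm_fst_le_add_segDist z (q, (0 : ℝ))
        simp only at this
        linarith
      obtain ⟨x, hx, hxz⟩ := h.exists_collapse_near hE (R := ‖q‖ + D) (by nlinarith)
        (segRotate_mem (U := U.symm) hz) (by simpa [segRotate] using hzR)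
      have hGz : segDist (G x) z ≤ δ := by
        have : z = segRotate U (segRotate U.symm z) := by simp [segRotate]
        rw [this, hG]
        simp only [segDist_segRotate]
        linarith
      refine ⟨x, ⟨trivial, ?_⟩, ?_⟩
      · have h2 := (abs_le.1 (hdis p x hpD hx)).2
        have h3 := segDist_triangle (G p) (q, (0 : ℝ)) (G x)
        have h4 := segDist_triangle (q, (0 : ℝ)) z (G x)
        rw [segDist_comm z] at h4
        linarith
      · have h3 := segDist_triangle (G x) z y
        rw [segDist_comm z y] at h3
        exact h3.trans (by linarith))
    (hGp.trans (by linarith))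
  refine key.trans_eq ?_
  ring_nf

end IsNeckFactor

end Collapse

/-! ### The manifolds with a long thin neck -/

section NeckManifold

variable {m : ℕ}

lemma exists_unit_orthogonal (hm : 2 ≤ m) (x : Eu m) :
    ∃ e : Eu m, ‖e‖ = 1 ∧ inner ℝ x e = 0 := by
  have h1 : (ℝ ∙ x)ᗮ ≠ ⊥ := by
    intro h
    rw [Submodule.orthogonal_eq_bot_iff] at h
    have h2 := finrank_span_le_card (R := ℝ) ({x} : Set (Eu m))
    rw [h, finrank_top, finrank_euclideanSpace_fin, Set.toFinset_singleton,
      Finset.card_singleton] at h2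
    omega
  obtain ⟨v, hv, hv0⟩ := Submodule.exists_mem_ne_zero_of_ne_bot h1
  refine ⟨‖v‖⁻¹ • v, norm_smul_inv_norm hv0, ?_⟩
  rw [inner_smul_right, Submodule.mem_orthogonal_singleton_iff_inner_right.1 hv, mul_zero]

/-- The rotationally symmetric manifold with a neck. -/
noncomputable def neckManifold (m : ℕ) {k b : ℝ} (hk : 0 < k) (hb : 0 < b) : RotSymManifold m :=
  confManifold m (neckExponent (m - 2) k b) fun _ hρ => contDiffAt_neckExponent hk hb hρ

variable {k b : ℝ} (hk : 0 < k) (hb : 0 < b)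

lemma rdist_neckManifold :
    (neckManifold m hk hb).rdist = confDist fun z => neckFactor (m - 2) k b ‖z‖ :=
  rdist_confManifold _

lemma carrier_neckManifold : (neckManifold m hk hb).carrier = Set.univ :=
  carrier_confManifold _

lemma isRS_neckManifold (hm : 3 ≤ m) : (neckManifold m hk hb).IsRS := by
  have hn : m - 2 ≠ 0 := by omega
  exact isRS_confManifold (C := neckFactor (m - 2) k b 0) _ (by omega)
    (fun ρ hρ => hasDerivAt_neckExponent hn hk hb hρ)
    (fun ρ hρ => hasDerivAt_neckExponentDeriv hk hb hρ)
    (fun ρ hρ => neckExponent_superharmonic (by omega) hk hb hρ)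
    (fun ρ hρ => neckExponent_radial_pos hk hb hρ) (fun z => one_le_neckFactor hk hb ‖z‖)
    fun z => antitoneOn_neckFactor hn hk hb Set.self_mem_Ici (norm_nonneg z) (norm_nonneg z)

lemma hasADMMass_neckManifold (hm : 3 ≤ m) :
    (neckManifold m hk hb).HasADMMass (2 * k ^ 2) := by
  have hn : m - 2 ≠ 0 := by omega
  refine (tendsto_neck_hawkingMass hn hk hb).congr' ?_
  filter_upwards [eventually_gt_atTop 0] with t ht
  exact (hawkingMass_confManifold _ (by omega)
    (fun ρ hρ => hasDerivAt_neckExponent hn hk hb hρ) ht).symm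

lemma mem_symSphere_neckManifold (hm : 3 ≤ m) {α : ℝ} {x : Eu m} :
    x ∈ (neckManifold m hk hb).symSphere α ↔
      omega m * (‖x‖ * neckFactor (m - 2) k b ‖x‖) ^ (m - 1) = α := by
  rw [RotSymManifold.symSphere, carrier_neckManifold]
  simp only [Set.mem_univ, true_and, Set.mem_ofPred_eq]
  rw [neckManifold, area_confManifold _ (by omega) (norm_nonneg x)]
  rfl

lemma symSphere_neckManifold_nonempty (hm : 3 ≤ m) {α : ℝ} (hα : 0 < α) :
    ((neckManifold m hk hb).symSphere α).Nonempty := by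
  have ho := omega_pos (m := m) (by omega)
  set r₀ := (α / omega m) ^ (((m - 1 : ℕ) : ℝ)⁻¹) with hr₀
  have h0 : 0 ≤ r₀ := by positivity
  have hr : omega m * r₀ ^ (m - 1) = α := by
    rw [hr₀, Real.rpow_inv_natCast_pow (by positivity) (by omega), mul_div_cancel₀ _ ho.ne']
  have hc : Continuous fun r => r * neckFactor (m - 2) k b r :=
    continuous_id.mul (continuous_neckFactor hk hb)
  obtain ⟨r, ⟨hr1, -⟩, hr2⟩ : r₀ ∈ (fun r => r * neckFactor (m - 2) k b r) '' Set.Icc 0 r₀ :=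
    intermediate_value_Icc h0 hc.continuousOn
      ⟨by simpa using h0, le_mul_of_one_le_right h0 (one_le_neckFactor hk hb r₀)⟩
  obtain ⟨e, he, -⟩ := exists_unit_orthogonal (m := m) (by omega) 0
  have hn : ‖r • e‖ = r := by rw [norm_smul, he, mul_one, Real.norm_of_nonneg hr1]
  refine ⟨r • e, (mem_symSphere_neckManifold hk hb hm).2 ?_⟩
  simp only at hr2
  rw [hn, hr2, hr]

end NeckManifold

/-! ### Convergence to the limit space and failure of stability -/

lemma isNeckFactor_neckFactor {n : ℕ} (hn : n ≠ 0) {ε b L : ℝ} (hε : 0 < ε) (hb : 0 < b)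
    (hL : ∫ r in (0 : ℝ)..ε, neckFactor n (ε ^ n) b r = L) :
    IsNeckFactor (neckFactor n (ε ^ n) b) ε (Real.exp (2 * ε ^ n) - 1) L where
  continuous := continuous_neckFactor (by positivity) hb
  one_le := one_le_neckFactor (by positivity) hb
  anti := antitoneOn_neckFactor hn (by positivity) hb
  mono := monotoneOn_mul_neckFactor hn (by positivity) hb
  pos := hε
  length := hL
  le r hr := by rw [add_sub_cancel]; exact neckFactor_le_exp hn hε hb hr

/-- The sequence of manifolds whose pointed Gromov-Hausdorff limit is Euclidean space with a segment
attached. -/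
lemma exists_neck_sequence {m : ℕ} (hm : 3 ≤ m) {L : ℝ} (hL : 0 < L) :
    ∃ (M : ℕ → RotSymManifold m) (μ : ℕ → ℝ),
      (∀ j, (M j).IsRS) ∧ (∀ j, (M j).HasADMMass (μ j)) ∧ Tendsto μ atTop (𝓝 0) ∧
      (∀ j x y, (M j).rdist x y = (M j).rdist y x) ∧
      ∀ α : ℝ, 0 < α → (∀ j, ((M j).symSphere α).Nonempty) ∧
        ∀ (p : ℕ → Eu m) (q : Eu m), (∀ᶠ j in atTop, p j ∈ (M j).symSphere α) →
          q ∈ euclSphere m α →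
          PointedGHTendsto (fun j => (M j).rdist) (fun j => (M j).carrier) p
            segDist (segSpace m L) (q, (0 : ℝ)) := by
  have hn : m - 2 ≠ 0 := by omega
  -- This bound on `ε j` provides both hypotheses `ε ≤ 1` and `e² ε ≤ L` of `exists_neck_length`.
  set a := min 1 (L / Real.exp 2) with ha
  have ha0 : 0 < a := by positivity
  set ε : ℕ → ℝ := fun j => a / (j + 1) with hεdef
  have hε0 : ∀ j, 0 < ε j := fun j => by positivity
  have hεa : ∀ j, ε j ≤ a := fun j =>
    div_le_self ha0.le (by have : (0 : ℝ) ≤ j := j.cast_nonneg; linarith)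
  have hεt : Tendsto ε atTop (𝓝 0) := by
    have := (tendsto_one_div_add_atTop_nhds_zero_nat (𝕜 := ℝ)).const_mul a
    simpa [hεdef, div_eq_mul_inv] using this
  have hb : ∀ j, ∃ b : ℝ, 0 < b ∧
      ∫ r in (0 : ℝ)..ε j, neckFactor (m - 2) (ε j ^ (m - 2)) b r = L := fun j => by
    refine exists_neck_length hn (hε0 j) ((hεa j).trans (min_le_left _ _)) ?_
    have : ε j ≤ L / Real.exp 2 := (hεa j).trans (min_le_right _ _)
    rwa [le_div_iff₀ (Real.exp_pos 2), mul_comm] at this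
  choose b hb0 hbL using hb
  have hk : ∀ j, 0 < ε j ^ (m - 2) := fun j => pow_pos (hε0 j) _
  have hF : ∀ j, IsNeckFactor (neckFactor (m - 2) (ε j ^ (m - 2)) (b j)) (ε j)
      (Real.exp (2 * ε j ^ (m - 2)) - 1) L := fun j =>
    isNeckFactor_neckFactor hn (hε0 j) (hb0 j) (hbL j)
  have hkt : Tendsto (fun j => ε j ^ (m - 2)) atTop (𝓝 0) := by
    simpa [hn] using hεt.pow (m - 2)
  refine ⟨fun j => neckManifold m (hk j) (hb0 j), fun j => 2 * (ε j ^ (m - 2)) ^ 2,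
    fun j => isRS_neckManifold _ _ hm, fun j => hasADMMass_neckManifold _ _ hm,
    by simpa using (hkt.pow 2).const_mul 2, fun j x y => ?_,
    fun α hα => ⟨fun j => symSphere_neckManifold_nonempty _ _ hm hα, fun p q hp hq D hD => ?_⟩⟩
  · rw [rdist_neckManifold]
    have hc : Continuous fun z : Eu m => neckFactor (m - 2) (ε j ^ (m - 2)) (b j) ‖z‖ :=
      (hF j).continuous.comp continuous_norm
    exact confDist_comm hc x y
  have ho := omega_pos (m := m) (by omega)
  have hq' : omega m * ‖q‖ ^ (m - 1) = α := hq
  have hq0 : 0 < ‖q‖ := by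
    refine (norm_nonneg q).lt_of_ne fun h0 => ?_
    rw [← h0, zero_pow (by omega), mul_zero] at hq'
    exact hα.ne hq'
  set η : ℕ → ℝ := fun j => Real.exp (2 * ε j ^ (m - 2)) - 1 with hη
  have hηt : Tendsto η atTop (𝓝 0) := by
    have h1 : Tendsto (fun j => Real.exp (2 * ε j ^ (m - 2))) atTop (𝓝 (Real.exp (2 * 0))) :=
      (Real.continuous_exp.tendsto _).comp (hkt.const_mul 2)
    simpa [hη] using h1.sub_const 1
  have hεη : Tendsto (fun j => ε j * (1 + η j)) atTop (𝓝 0) := by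
    simpa using hεt.mul (hηt.const_add 1)
  set δ : ℕ → ℝ := fun j =>
    2 * (‖q‖ + D) * η j + 2 * Real.pi * (ε j * (1 + η j)) + 2 * ε j with hδ
  have hδt : Tendsto δ atTop (𝓝 0) := by
    simpa using ((hηt.const_mul (2 * (‖q‖ + D))).add (hεη.const_mul (2 * Real.pi))).add
      (hεt.const_mul 2)
  have hδ0 : ∀ j, 0 < δ j := fun j => by
    have h1 : 0 ≤ η j := (hF j).eta_nonneg
    have := hε0 j
    have := Real.pi_pos
    simp only [hδ]
    positivity
  have hδ6 : Tendsto (fun j => 6 * δ j) atTop (𝓝 0) := by simpa using hδt.const_mul 6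
  refine ⟨fun j => D - 2 * δ j, by simpa using (hδt.const_mul 2).const_sub D, ?_⟩
  have hlim : Tendsto (fun j => ENNReal.ofReal (14 * δ j)) atTop (𝓝 0) := by
    have := ENNReal.tendsto_ofReal (hδt.const_mul 14)
    simpa using this
  refine tendsto_of_tendsto_of_tendsto_of_le_of_le' tendsto_const_nhds hlim
    (Eventually.of_forall fun _ => zero_le) ?_
  filter_upwards [hp, hδ6.eventually_le_const hq0, hδ6.eventually_le_const hD,
    hεη.eventually_lt_const hq0] with j hpj h1 h2 h3
  rw [mem_symSphere_neckManifold _ _ hm, ← hq'] at hpj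
  -- Equal areas mean equal area radii.
  have hpq : ‖p j‖ * neckFactor (m - 2) (ε j ^ (m - 2)) (b j) ‖p j‖ = ‖q‖ :=
    (pow_left_inj₀ (mul_nonneg (norm_nonneg _) (Real.exp_pos _).le) hq0.le (by omega)).1
      (mul_left_cancel₀ ho.ne' hpj)
  rw [rdist_neckManifold, carrier_neckManifold]
  exact (hF j).pointedGHDist_le (exists_unit_orthogonal (by omega)) hD (hδ0 j) le_rfl h1 h2 h3 hpq

/-- The failure of stability follows from the convergence to a space that contains a tripod. -/
lemma not_ghStable {m : ℕ} (hm : 3 ≤ m) : ¬ GHStable m := by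
  intro hst
  have ho := omega_pos (m := m) (by omega)
  -- The area `omega m` is that of the unit sphere, so `|q| = 1` and the four points of the tripod
  -- lie within distance 2 of `q`. They are in the ball of radius 3, and `D' j → 3` is eventually
  -- less than the tube radius 4.
  obtain ⟨δ, hδ, hst⟩ := hst (1 / 400) 4 (omega m) (by norm_num) (by norm_num) ho
  obtain ⟨M, μ, hRS, hμ, hμ0, hsymm, hM⟩ := exists_neck_sequence hm one_pos
  obtain ⟨hne, hconv⟩ := hM _ ho
  choose p hp using hne
  obtain ⟨q, hq, -⟩ := exists_unit_orthogonal (m := m) (by omega) 0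
  obtain ⟨D', hD', hGH⟩ := hconv p q (Eventually.of_forall hp) (by simp [euclSphere, hq]) 3
    (by norm_num)
  obtain ⟨j, hj1, hj2, hj3⟩ := ((hD'.eventually_lt_const (by norm_num : (3 : ℝ) < 4)).and
    ((hGH.eventually_lt_const (u := ENNReal.ofReal (1 / 400)) (by simp)).and
      (hμ0.eventually_lt_const hδ))).exists
  obtain ⟨f, hf⟩ := exists_almost_isometry_of_pointedGHDist_lt hj2
  obtain ⟨g, hg⟩ := exists_almost_isometry_of_ghDist_lt
    (hst (M j) (hRS j) (μ j) (hμ j) hj3 ⟨p j, hp j⟩)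
  have hft : ∀ y, f y ∈ tubeIn (M j).rdist (M j).carrier ((M j).symSphere (omega m)) 4 :=
    fun y => ⟨(hf y).1.1, p j, hp j, by rw [hsymm]; exact (hf y).1.2.trans hj1⟩
  -- The almost isometries from the limit ball into the tube of `M j` and from there into Euclidean
  -- space are composed. Each changes distances by at most `2/400`.
  have hgf : ∀ y y' : ballIn segDist (segSpace m 1) (q, (0 : ℝ)) 3,
      |segDist (y : Eu m × ℝ) y' - dist (g ⟨f y, hft y⟩) (g ⟨f y', hft y'⟩)| ≤ 1 / 100 := by
    intro y y'
    have h1 := (hf y).2 y'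
    have h2 := (hg ⟨f y, hft y⟩).2 ⟨f y', hft y'⟩
    refine (abs_sub_le _ _ _).trans ((add_le_add h1 h2).trans ?_)
    norm_num
  have mem : ∀ z : Eu m × ℝ, z ∈ segSpace m 1 → segDist (q, (0 : ℝ)) z ≤ 2 →
      z ∈ ballIn segDist (segSpace m 1) (q, (0 : ℝ)) 3 :=
    fun z h1 h2 => ⟨h1, h2.trans_lt (by norm_num)⟩
  have hqq : ‖q + q‖ = 2 := by rw [← two_smul ℝ q, norm_smul, hq]; norm_num
  have d1 : segDist (q, (0 : ℝ)) (-q, (0 : ℝ)) = 2 := by simp [segDist, hqq]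
  have d2 : segDist (q, (0 : ℝ)) (0, (0 : ℝ)) = 1 := by simp [segDist, hq]
  have d3 : segDist (-q, (0 : ℝ)) (0, (0 : ℝ)) = 1 := by simp [segDist, hq]
  have d4 : segDist ((0 : Eu m), (1 : ℝ)) (0, (0 : ℝ)) = 1 := by simp [segDist]
  have d5 : segDist (q, (0 : ℝ)) (0, (1 : ℝ)) = 2 := by simp [segDist, hq]; norm_num
  have d6 : segDist (-q, (0 : ℝ)) (0, (1 : ℝ)) = 2 := by simp [segDist, hq]; norm_num
  have hA := mem (q, (0 : ℝ)) (by simp [segSpace]) (by simp [segDist])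
  have hB := mem (-q, (0 : ℝ)) (by simp [segSpace]) d1.le
  have hO := mem ((0 : Eu m), (0 : ℝ)) (by simp [segSpace]) (by rw [d2]; norm_num)
  have hP := mem ((0 : Eu m), (1 : ℝ)) (by simp [segSpace]) d5.le
  -- The tripod has the feet `q`, `-q` and `(0, 1)`, and the centre is the origin.
  have e1 := abs_le.1 (d1 ▸ hgf ⟨_, hA⟩ ⟨_, hB⟩)
  have e2 := abs_le.1 (d2 ▸ hgf ⟨_, hA⟩ ⟨_, hO⟩)
  have e3 := abs_le.1 (d3 ▸ hgf ⟨_, hB⟩ ⟨_, hO⟩)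
  have e4 := abs_le.1 (d4 ▸ hgf ⟨_, hP⟩ ⟨_, hO⟩)
  have e5 := abs_le.1 (d5 ▸ hgf ⟨_, hA⟩ ⟨_, hP⟩)
  have e6 := abs_le.1 (d6 ▸ hgf ⟨_, hB⟩ ⟨_, hP⟩)
  exact no_tripod (a := g ⟨f ⟨_, hA⟩, hft _⟩) (b := g ⟨f ⟨_, hB⟩, hft _⟩)
    (o := g ⟨f ⟨_, hO⟩, hft _⟩) (p := g ⟨f ⟨_, hP⟩, hft _⟩) (e := 1 / 100) (by norm_num) le_rfl (by linarith [e1.2]) (by linarith [e2.1])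
    (by linarith [e3.1]) (by linarith [e4.1]) (by linarith [e5.2]) (by linarith [e6.2])

end RotSym

theorem mainTheorem10 (m : ℕ) (hm : 3 ≤ m) :
    (∀ L₀ : ℝ, 0 < L₀ →
      ∃ (M : ℕ → RotSym.RotSymManifold m) (μ : ℕ → ℝ),
        (∀ j, (M j).IsRS) ∧ (∀ j, (M j).HasADMMass (μ j)) ∧ Tendsto μ atTop (𝓝 0) ∧
        ∀ α₀ : ℝ, 0 < α₀ →
          (∀ᶠ j in atTop, ((M j).symSphere α₀).Nonempty) ∧
          ∀ (p : ℕ → RotSym.Eu m) (q : RotSym.Eu m),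
            (∀ᶠ j in atTop, p j ∈ (M j).symSphere α₀) → q ∈ RotSym.euclSphere m α₀ →
            RotSym.PointedGHTendsto (fun j => (M j).rdist) (fun j => (M j).carrier) p
              RotSym.segDist (RotSym.segSpace m L₀) (q, (0 : ℝ))) ∧
    ¬ RotSym.GHStable m := by
  refine ⟨fun L₀ hL₀ => ?_, RotSym.not_ghStable hm⟩
  obtain ⟨M, μ, hRS, hμ, hμ0, -, hM⟩ := RotSym.exists_neck_sequence hm hL₀
  exact ⟨M, μ, hRS, hμ, hμ0, fun α hα =>
    ⟨Eventually.of_forall (hM α hα).1, (hM α hα).2⟩⟩
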